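/- Let $F$ be a non-archimedean local field of characteristic zero and odd residual characteristic, with ring of integers $\mathfrak o_F$, uniformizer $\varpi$, and residue field of cardinality $q$. Let $E=F[\sqrt{\epsilon}]$, where $\epsilon\in\mathfrak o_F^\times$ is not a square, be the unramified quadratic extension of $F$, let $x\mapsto\overline x$ be the non-trivial element of $\mathrm{Gal}(E/F)$, let $\mathfrak o_E$ be the ring of integers of $E$ and $\mathfrak p_E$ its maximal ideal, and let $|\cdot|_E$ be the normalized absolute value of $E$ (so $|\varpi|_E=q^{-2}$). Put $$G=\{g\in \mathrm{GL}_3(E)\mid {}^t\overline g J g=J\},\qquad J=\begin{pmatrix}0&0&1\\0&1&0\\1&0&0\end{pmatrix},$$ let $B$ be the subgroup of upper triangular elements of $G$, and for integers $n\ge 0$ and $i$ put $$K_n=\begin{pmatrix}\mathfrak o_E&\mathfrak o_E&\mathfrak p_E^{-n}\\ \mathfrak p_E^n&1+\mathfrak p_E^n&\mathfrak o_E\\ \mathfrak p_E^n&\mathfrak p_E^n&\mathfrak o_E\end{pmatrix}\cap G,\qquad \gamma_i=\begin{pmatrix}1&&\\ \varpi^i&1&\\ -\varpi^{2i}/2&-\varpi^i&1\end{pmatrix}\in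 G.$$ For a representation of $G$ on a complex space $W$ let $W(n)$ be the space of $K_n$-fixed vectors. The conductor of $W$ is the least $n\ge 0$ with $W(n)\ne 0$ (if there is one), and the newforms of $W$ are the elements of $W(n)$ for this $n$. Let $V$ be the space of the normalized parabolic induction $\mathrm{Ind}_B^G(|\cdot|_E\otimes 1)$: the locally constant functions $f:G\to\mathbf C$ with $f(bg)=\delta_B(b)^{1/2}|a|_E f(g)$ for $g\in G$ and $b\in B$ with diagonal $(a,c,\overline a^{-1})$, where $\delta_B(b)=|a|_E^2$; the group $G$ acts by right translation. For $i=1,2$ let $f_{2,i}\in V(2)$ be the function with support $B\gamma_iK_2$ and $f_{2,i}(\gamma_i)=1$. Then $V$ has exactly one irreducible subrepresentation $V_1$; it is the Steinberg representation of $G$, realized in $V$. The functions $f_{2,1}$ and $f_{2,2}$ exist, are unique, and span $V(2)$, which is two-dimensional. The conductor of $V_1$ is $2$, so that $V_1(2)$ is the space of newforms of $V_1$, and a function $f\in V(2)$ lies in $V_1(2)$ if and only if $$f(1)=-q(q-1)f(\gamma_1).$$ In particular, $q(q-1)f_{2,2}-f_{2,1}$ is a (non-zero) newform for the Steinberg representation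 $V_1$. -/

import Mathlib

open scoped ValuativeRel NNReal WithZero Pointwise IntermediateField

noncomputable section

namespace U3

/-! ### Local fields -/

section LocalField

variable (K : Type*) [Field K] [ValuativeRel K] [TopologicalSpace K]
  [IsNonarchimedeanLocalField K]

/-- The cardinality `q_K` of the residue field of `K`. -/
def resCard : ℕ := Nat.card 𝓀[K]

lemma resCard_ne_zero : (resCard K : ℝ≥0) ≠ 0 := by
  have : 0 < Nat.card 𝓀[K] := Nat.card_pos
  exact_mod_cast this.ne'

/-- The absolute value `|·|_K` of a local field, normalized so that a uniformizer has absolute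
value `q_K⁻¹`: the valuation, with values in `ℤᵐ⁰` through the (unique) ordered isomorphism of the
value group, followed by `exp m ↦ q_K ^ m`. -/
def normAbs : K →*₀ ℝ≥0 :=
  ((WithZeroMulInt.toNNReal (resCard_ne_zero K)).comp
    (MonoidWithZeroHom.ofClass
      (IsNonarchimedeanLocalField.valueGroupWithZeroIsoInt K))).comp
      (ValuativeRel.valuation K).toMonoidWithZeroHom

/-- The fractional ideal `𝔭_K ^ n`, for an integer `n`. -/
def primePow (n : ℤ) : Set K := {x | normAbs K x ≤ (resCard K : ℝ≥0) ^ (-n)}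

/-- The quasi-character `|·|_K` of `Kˣ`. -/
def absChar : Kˣ →* ℂˣ :=
  Units.map
    ((Complex.ofRealHom : ℝ →* ℂ).comp ((NNReal.toRealHom : ℝ≥0 →* ℝ).comp
      (normAbs K : K →* ℝ≥0)))

end LocalField

/-! ### The unitary group in three variables

Throughout, `σ` is an automorphism of the extension `E / F`; it is the non-trivial one of a
quadratic extension in the application. -/

section Group

variable {F E : Type*} [Field F] [Field E] [Algebra F E] (σ : E ≃ₐ[F] E)

/-- The matrix `J` of the Hermitian form. -/
def J (E : Type*) [Field E] : Matrix (Fin 3) (Fin 3) E := !![0, 0, 1; 0, 1, 0; 1, 0, 0]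

/-- The conjugate transpose of a matrix, with respect to `σ`. -/
def conjT (g : Matrix (Fin 3) (Fin 3) E) : Matrix (Fin 3) (Fin 3) E := (g.map σ).transpose

lemma conjT_mul (g h : Matrix (Fin 3) (Fin 3) E) : conjT σ (g * h) = conjT σ h * conjT σ g := by
  simp [conjT, Matrix.map_mul, Matrix.transpose_mul]

lemma conjT_one : conjT σ (1 : Matrix (Fin 3) (Fin 3) E) = 1 := by
  simp [conjT, Matrix.map_one]

/-- The group `G = {g ∈ GL₃(E) | ᵗḡ J g = J}`. -/
def G : Subgroup (GL (Fin 3) E) where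
  carrier := {g | conjT σ g.val * J E * g.val = J E}
  one_mem' := by simp [conjT_one]
  mul_mem' := by
    intro a b ha hb
    simp only [Set.mem_ofPred_eq, Units.val_mul, conjT_mul] at *
    calc _ = conjT σ b.val * (conjT σ a.val * J E * a.val) * b.val := by simp only [mul_assoc]
      _ = _ := by rw [ha, hb]
  inv_mem' := by
    intro a ha
    simp only [Set.mem_ofPred_eq] at *
    have h1 : conjT σ (a⁻¹).val * conjT σ a.val = 1 := by
      rw [← conjT_mul, Units.mul_inv, conjT_one]
    have h2 : a.val * (a⁻¹).val = 1 := Units.mul_inv a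
    calc _ = conjT σ (a⁻¹).val * (conjT σ a.val * J E * a.val) * (a⁻¹).val := by rw [ha]
      _ = (conjT σ (a⁻¹).val * conjT σ a.val) * J E * (a.val * (a⁻¹).val) := by
        simp only [mul_assoc]
      _ = _ := by rw [h1, h2]; simp

/-- The `(i, j)`-entry of an element of `G`. -/
def entry (g : G σ) (i j : Fin 3) : E := g.val.val i j

lemma entry_mul (g h : G σ) (i j : Fin 3) :
    entry σ (g * h) i j = ∑ k, entry σ g i k * entry σ h k j := by
  simp [entry, Matrix.mul_apply]

lemma entry_one (i j : Fin 3) : entry σ 1 i j = if i = j then 1 else 0 := by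
  simp [entry, Matrix.one_apply]

/-- The Borel subgroup `B` of upper triangular elements of `G`. -/
def B : Subgroup (G σ) where
  carrier := {g | ∀ i j : Fin 3, j < i → entry σ g i j = 0}
  one_mem' := by
    intro i j hij
    rw [entry_one, if_neg hij.ne']
  mul_mem' := by
    intro a b ha hb i j hij
    rw [entry_mul]
    refine Finset.sum_eq_zero fun k _ => ?_
    rcases lt_or_ge k i with h | h
    · rw [ha i k h, zero_mul]
    · rw [hb k j (hij.trans_le h), mul_zero]
  inv_mem' := by
    intro a ha i j hij
    have h1 : Matrix.BlockTriangular a.val.val id := fun i j hij => ha i j hij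
    have h2 : Matrix.BlockTriangular (a.val.val)⁻¹ id :=
      Matrix.blockTriangular_inv_of_blockTriangular h1
    have h3 : ((a⁻¹ : G σ).val.val) = (a.val.val)⁻¹ := by
      simp [Matrix.coe_units_inv]
    have := h2 hij
    rwa [← h3] at this

lemma entry_diag_mul (b c : B σ) (i : Fin 3) :
    entry σ (b * c : B σ).val i i = entry σ b.val i i * entry σ c.val i i := by
  have hb := b.2
  have hc := c.2
  simp only [Subgroup.coe_mul, entry_mul]
  refine Finset.sum_eq_single i (fun k _ hk => ?_) (by simp)
  rcases lt_or_gt_of_ne hk with h | h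
  · rw [hb i k h, zero_mul]
  · rw [hc k i h, mul_zero]

/-- The `i`-th diagonal entry, as a homomorphism `B → Eˣ`. -/
def diagEntry (i : Fin 3) : B σ →* Eˣ :=
  MonoidHom.toHomUnits
    { toFun := fun b => entry σ b.val i i
      map_one' := by simp [entry_one]
      map_mul' := fun b c => entry_diag_mul σ b c i }

/-- The norm-one subgroup `E¹` of `Eˣ`. -/
def normOne : Subgroup Eˣ where
  carrier := {a | σ (a : E) * a = 1}
  one_mem' := by simp
  mul_mem' := by
    intro a b ha hb
    simp only [Set.mem_ofPred_eq, Units.val_mul, map_mul] at *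
    calc _ = (σ (a : E) * a) * (σ (b : E) * b) := by ring
      _ = 1 := by rw [ha, hb, one_mul]
  inv_mem' := by
    intro a ha
    simp only [Set.mem_ofPred_eq, Units.val_inv_eq_inv_val, map_inv₀] at *
    rw [← mul_inv, ha, inv_one]

lemma diagEntry_one_mem (b : B σ) : diagEntry σ 1 b ∈ normOne σ := by
  have hb := b.2
  have h : conjT σ b.val.val.val * J E * b.val.val.val = J E := b.val.2
  have h10 : b.val.val.val 1 0 = 0 := hb 1 0 (by decide)
  have h21 : b.val.val.val 2 1 = 0 := hb 2 1 (by decide)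
  have := congrFun (congrFun h 1) 1
  simp [conjT, J, Matrix.mul_apply, Fin.sum_univ_three, h21] at this
  exact this

/-- The middle diagonal entry, as a homomorphism `B → E¹`. -/
def midEntry : B σ →* normOne σ := (diagEntry σ 1).codRestrict _ (diagEntry_one_mem σ)

/-- The quasi-character `μ₁ ⊗ μ₂` of `B`: it sends an element with diagonal `(a, b, ā⁻¹)`
to `μ₁ a * μ₂ b`. -/
def tensorChar (μ₁ : Eˣ →* ℂˣ) (μ₂ : normOne σ →* ℂˣ) : B σ →* ℂˣ :=
  μ₁.comp (diagEntry σ 0) * μ₂.comp (midEntry σ)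

/-- The elements `γ_i = (1, 0, 0; ϖ^i, 1, 0; -ϖ^{2i}/2, -ϖ^i, 1)` of `G`. -/
def gam [CharZero F] (ϖ : F) (i : ℤ) : G σ :=
  ⟨Matrix.GeneralLinearGroup.mkOfDetNeZero
      (!![1, 0, 0;
          algebraMap F E (ϖ ^ i), 1, 0;
          algebraMap F E (-(ϖ ^ i) ^ 2 / 2), -algebraMap F E (ϖ ^ i), 1] :
        Matrix (Fin 3) (Fin 3) E)
      (by simp [Matrix.det_fin_three]), by
    change conjT σ _ * J E * _ = J E
    have h2 : algebraMap F E 2 = 2 := map_ofNat _ 2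
    have h3 : σ 2 = 2 := map_ofNat σ 2
    have : (2 : E) ≠ 0 := by
      rw [← h2]
      exact (map_ne_zero _).2 two_ne_zero
    ext a b
    fin_cases a <;> fin_cases b <;>
      simp [conjT, J, Matrix.GeneralLinearGroup.mkOfDetNeZero, Matrix.mul_apply,
        Fin.sum_univ_three, h2, h3] <;> (field_simp; ring)⟩

end Group

/-! ### Fixed vectors, conductors, newforms, and parabolic induction -/

section Rep

variable {F E : Type*} [Field F] [Field E] [Algebra F E] [ValuativeRel E] [TopologicalSpace E]
  [IsNonarchimedeanLocalField E] (σ : E ≃ₐ[F] E)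

/-- The open compact subgroup `K_n` of `G` (only its underlying set is needed):
`[𝔬, 𝔬, 𝔭^{-n}; 𝔭^n, 1 + 𝔭^n, 𝔬; 𝔭^n, 𝔭^n, 𝔬] ∩ G`. -/
def Kn (n : ℕ) : Set (G σ) :=
  {g | entry σ g 0 0 ∈ primePow E 0 ∧ entry σ g 0 1 ∈ primePow E 0 ∧
       entry σ g 0 2 ∈ primePow E (-n) ∧
       entry σ g 1 0 ∈ primePow E n ∧ entry σ g 1 1 - 1 ∈ primePow E n ∧
       entry σ g 1 2 ∈ primePow E 0 ∧
       entry σ g 2 0 ∈ primePow E n ∧ entry σ g 2 1 ∈ primePow E n ∧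
       entry σ g 2 2 ∈ primePow E 0}

variable {σ} in
/-- The space `V(n)` of `K_n`-fixed vectors of a representation of `G`. -/
def fixed {V : Type*} [AddCommMonoid V] [Module ℂ V] (ρ : Representation ℂ (G σ) V) (n : ℕ) :
    Submodule ℂ V where
  carrier := {v | ∀ k ∈ Kn σ n, ρ k v = v}
  zero_mem' := by simp
  add_mem' := by
    intro v w hv hw k hk
    rw [map_add, hv k hk, hw k hk]
  smul_mem' := by
    intro c v hv k hk
    rw [map_smul, hv k hk]

variable {σ} in
/-- `N` is the conductor of `ρ`: the least `n ≥ 0` with `V(n) ≠ 0`. -/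
def IsConductor {V : Type*} [AddCommMonoid V] [Module ℂ V] (ρ : Representation ℂ (G σ) V)
    (N : ℕ) : Prop :=
  IsLeast {n : ℕ | fixed ρ n ≠ ⊥} N

variable {σ} in
/-- `v` is a newform for `ρ`: a non-zero element of `V(N)`, where `N` is the conductor of `ρ`. -/
def IsNewform {V : Type*} [AddCommMonoid V] [Module ℂ V] (ρ : Representation ℂ (G σ) V)
    (v : V) : Prop :=
  ∃ N, IsConductor ρ N ∧ v ∈ fixed ρ N ∧ v ≠ 0

/-- The modulus character of `B`: its value at an element with diagonal `(a, b, ā⁻¹)`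
is `|a|_E ^ 2`. -/
def modulusB (b : B σ) : ℝ := (normAbs E (diagEntry σ 0 b : E) : ℝ) ^ 2

variable {σ} in
/-- The space of the normalized parabolic induction `Ind_B^G μ`: locally constant functions
`f : G → ℂ` with `f (b g) = δ_B(b)^{1/2} μ(b) f(g)`. -/
def Ind (μ : B σ →* ℂˣ) : Submodule ℂ (G σ → ℂ) where
  carrier := {f | IsLocallyConstant f ∧
    ∀ (b : B σ) (g : G σ), f (b.val * g) = (Real.sqrt (modulusB σ b) : ℂ) * (μ b : ℂ) * f g}
  zero_mem' := ⟨IsLocallyConstant.const 0, by simp⟩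
  add_mem' := by
    rintro f h ⟨hf, hf'⟩ ⟨hh, hh'⟩
    refine ⟨hf.add hh, fun b g => ?_⟩
    simp only [Pi.add_apply, hf', hh']
    ring
  smul_mem' := by
    rintro c f ⟨hf, hf'⟩
    refine ⟨hf.comp (fun z => c • z), fun b g => ?_⟩
    simp only [Pi.smul_apply, hf', smul_eq_mul]
    ring

variable {σ} in
/-- The action of `G` on `Ind_B^G μ` by right translation. -/
def indRep (μ : B σ →* ℂˣ) : Representation ℂ (G σ) (Ind μ) where
  toFun g :=
    { toFun := fun f => ⟨fun x => f.val (x * g),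
        f.2.1.comp_continuous (continuous_mul_const g), fun b x => by
          have := f.2.2 b (x * g)
          rwa [← mul_assoc] at this⟩
      map_add' := fun _ _ => rfl
      map_smul' := fun _ _ => rfl }
  map_one' := by
    ext f x
    simp
  map_mul' g h := by
    ext f x
    simp [mul_assoc]

variable {σ} in
/-- `f` is the function `f_{n,i}`: the element of `V(n)`, `V` the space of `Ind_B^G μ`, with
`f(γ_i) = 1` and support `B γ_i K_n`. -/
def IsF [CharZero F] (μ : B σ →* ℂˣ) (ϖ : F) (n : ℕ) (i : ℤ) (f : Ind μ) : Prop :=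
  f ∈ fixed (indRep μ) n ∧ f.val (gam σ ϖ i) = 1 ∧
    Function.support f.val = (B σ : Set (G σ)) * {gam σ ϖ i} * Kn σ n

/-- The quasi-character `|·|_E ⊗ 1` of `B`. -/
def stChar : B σ →* ℂˣ := tensorChar σ (absChar E) 1

variable {σ} in
/-- The Steinberg representation of `G`, realized in `Ind_B^G (|·|_E ⊗ 1)` as its irreducible
subrepresentation. (That there is exactly one such is not built in here.) -/
def IsSteinberg (V₁ : Subrepresentation (indRep (stChar σ))) : Prop :=
  Representation.IsIrreducible (V := V₁.toSubmodule) V₁.toRepresentation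

end Rep

end U3

end

noncomputable section

namespace U3

/-! ### The normalized absolute value -/

section AbsoluteValue

variable {K : Type*} [Field K] [ValuativeRel K] [TopologicalSpace K]
  [IsNonarchimedeanLocalField K]

/-! Throughout, (x, y, z) is the bottom row of an element of G and r = `unifAbs E` = q⁻².

The row is isotropic, x z̄ + y ȳ + z x̄ = 0, and g, g' lie in the same coset of B exactly when their
rows are proportional. Since δ_B^{1/2} · |a|_E = |a|_E² = δ_B and |a|_E = |d|_E⁻¹ for the outer
diagonal entries a, d of an element of B, V is a space of functions of the row that are homogeneous
of degree -2 (`apply_eq_of_row`). Such functions are densities on the compact space B\G of isotropic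
lines, so integration gives a G-invariant functional I on V. The theorem says that V₁ = ker I, and
the constant q(q - 1) is the ratio of the masses of the two K₂-orbits on B\G.

The functional. Haar integration over the compact group K = `congruence σ 0` of integral elements
gives a K-invariant I with I(`sph`) = 1. By Iwasawa, G = BK, and every vector is a combination of
K-translates of the function `ballFun n` of a small ball |x| ≤ r^n |z| (`exists_eq_sum_boxFun`), so
invariance under G reduces to comparing masses of balls. These follow from cutting boxes by lower
unipotents: refining y costs q² pieces (`functional_boxFun_succ_left`), while refining x costs only
q, since the trace of x/z is determined by y/z (`functional_boxFun_succ_right`). Hence I(`ballFun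
n`) = q⁴ I(`ballFun (n + 2)`), which matches the scaling under B (`functional_ballFun_of_mem_B`,
`functional_invariant`).

The subrepresentations. Every non-zero W ⊆ V contains ker I (`ker_le`). Contracting a vector by a
torus element makes it proportional to `ballFun 1` on the support of `ballFun 1`. Averaging over the
stabilizer of `ballFun 1` in K then lands in the plane spanned by `ballFun 1` and `sph`, and from
there one reaches `ballFun 1 - I(ballFun 1) • sph` (`ballFun_one_sub_mem`). Translates of this
vector give the analogous vectors for arbitrarily small balls, and those generate ker I. So ker I is
irreducible, and it is the only irreducible subrepresentation (`isSteinberg_iff`).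

The fixed vectors. G = B K₀ = B K₁, so V(0) and V(1) are lines spanned by functions on which I does
not vanish; they meet ker I in 0 (`eq_zero_of_fixed`). For K₂ there are two double cosets, those of
γ₁ and of γ₂ ∈ K₂, with functions `offFun` and `mainFun` spanning V(2) (`eq_of_fixed_two`). Here
I(`offFun`) = q(q - 1) I(`mainFun`) ≠ 0, so I f = 0 means f(1) + q(q - 1) f(γ₁) = 0
(`functional_fixed_two`). -/

variable (K) in
lemma one_lt_resCard : (1 : ℝ≥0) < resCard K := by
  have : 1 < Nat.card 𝓀[K] := Finite.one_lt_card
  exact_mod_cast this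

lemma normAbs_le_iff {x y : K} :
    normAbs K x ≤ normAbs K y ↔ ValuativeRel.valuation K x ≤ ValuativeRel.valuation K y := by
  change WithZeroMulInt.toNNReal (resCard_ne_zero K)
      (IsNonarchimedeanLocalField.valueGroupWithZeroIsoInt K (ValuativeRel.valuation K x)) ≤
    WithZeroMulInt.toNNReal (resCard_ne_zero K)
      (IsNonarchimedeanLocalField.valueGroupWithZeroIsoInt K (ValuativeRel.valuation K y)) ↔ _
  rw [(WithZeroMulInt.toNNReal_strictMono (one_lt_resCard K)).le_iff_le,
    (IsNonarchimedeanLocalField.valueGroupWithZeroIsoInt K).strictMono.le_iff_le]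

lemma normAbs_lt_iff {x y : K} :
    normAbs K x < normAbs K y ↔ ValuativeRel.valuation K x < ValuativeRel.valuation K y := by
  rw [← not_le, normAbs_le_iff, not_le]

lemma normAbs_eq_iff {x y : K} :
    normAbs K x = normAbs K y ↔ ValuativeRel.valuation K x = ValuativeRel.valuation K y := by
  simp only [le_antisymm_iff, normAbs_le_iff]

lemma normAbs_add_le (x y : K) : normAbs K (x + y) ≤ max (normAbs K x) (normAbs K y) := by
  have := (ValuativeRel.valuation K).map_add x y
  simpa only [le_max_iff, normAbs_le_iff] using this

lemma normAbs_neg (x : K) : normAbs K (-x) = normAbs K x := by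
  rw [normAbs_eq_iff, Valuation.map_neg]

lemma normAbs_sub_le (x y : K) : normAbs K (x - y) ≤ max (normAbs K x) (normAbs K y) := by
  rw [sub_eq_add_neg, ← normAbs_neg y]
  exact normAbs_add_le _ _

lemma normAbs_add_le_of_le {x y : K} {c : ℝ≥0} (hx : normAbs K x ≤ c) (hy : normAbs K y ≤ c) :
    normAbs K (x + y) ≤ c := (normAbs_add_le x y).trans (max_le hx hy)

lemma normAbs_sub_le_of_le {x y : K} {c : ℝ≥0} (hx : normAbs K x ≤ c) (hy : normAbs K y ≤ c) :
    normAbs K (x - y) ≤ c := (normAbs_sub_le x y).trans (max_le hx hy)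

lemma normAbs_add_eq_left {x y : K} (h : normAbs K y < normAbs K x) :
    normAbs K (x + y) = normAbs K x := by
  refine le_antisymm (normAbs_add_le_of_le le_rfl h.le) (not_lt.1 fun h' => ?_)
  have : normAbs K (x + y - y) ≤ max _ _ := normAbs_sub_le (x + y) y
  rw [add_sub_cancel_right] at this
  exact (max_lt h' h).not_ge this

lemma normAbs_add_eq_right {x y : K} (h : normAbs K x < normAbs K y) :
    normAbs K (x + y) = normAbs K y := by
  rw [add_comm, normAbs_add_eq_left h]

lemma normAbs_eq_of_sub_lt {x y : K} (h : normAbs K (x - y) < normAbs K y) :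
    normAbs K x = normAbs K y := by
  have := normAbs_add_eq_left h
  rwa [add_sub_cancel] at this

lemma normAbs_eq_zero {x : K} : normAbs K x = 0 ↔ x = 0 := map_eq_zero _

lemma normAbs_pos {x : K} : 0 < normAbs K x ↔ x ≠ 0 := by
  rw [pos_iff_ne_zero, Ne, normAbs_eq_zero]

variable (K) in
lemma exists_normAbs_eq_zpow (n : ℤ) : ∃ x : K, normAbs K x = (resCard K : ℝ≥0) ^ n := by
  obtain ⟨x, hx⟩ := ValuativeRel.valuation_surjective
    ((IsNonarchimedeanLocalField.valueGroupWithZeroIsoInt K).symm (WithZero.exp n))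
  refine ⟨x, ?_⟩
  change WithZeroMulInt.toNNReal (resCard_ne_zero K)
      (IsNonarchimedeanLocalField.valueGroupWithZeroIsoInt K (ValuativeRel.valuation K x)) = _
  rw [hx, OrderMonoidIso.apply_symm_apply,
    WithZeroMulInt.toNNReal_neg_apply _ (WithZero.exp_ne_zero)]
  simp [WithZero.exp]

lemma normAbs_eq_zpow {x : K} (hx : x ≠ 0) : ∃ n : ℤ, normAbs K x = (resCard K : ℝ≥0) ^ n := by
  have h : IsNonarchimedeanLocalField.valueGroupWithZeroIsoInt K (ValuativeRel.valuation K x) ≠ 0 :=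
    by simpa using hx
  exact ⟨_, WithZeroMulInt.toNNReal_neg_apply (resCard_ne_zero K) h⟩

lemma normAbs_le_one_iff {x : K} : normAbs K x ≤ 1 ↔ x ∈ 𝒪[K] := by
  rw [← map_one (normAbs K), normAbs_le_iff, map_one]
  rfl

variable (K) in
/-- The absolute value `q⁻¹` of a uniformizer. -/
def unifAbs : ℝ≥0 := (resCard K : ℝ≥0)⁻¹

variable (K) in
lemma unifAbs_pos : 0 < unifAbs K := inv_pos.2 (zero_lt_one.trans (one_lt_resCard K))

variable (K) in
lemma unifAbs_ne_zero : unifAbs K ≠ 0 := (unifAbs_pos K).ne'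

variable (K) in
lemma unifAbs_lt_one : unifAbs K < 1 := inv_lt_one_of_one_lt₀ (one_lt_resCard K)

lemma mem_primePow {n : ℤ} {x : K} : x ∈ primePow K n ↔ normAbs K x ≤ unifAbs K ^ n := by
  rw [unifAbs, inv_zpow, ← zpow_neg]
  rfl

/-- The values of the absolute value are discrete. -/
lemma normAbs_le_unifAbs_mul {x y : K} (h : normAbs K x < normAbs K y) :
    normAbs K x ≤ unifAbs K * normAbs K y := by
  rcases eq_or_ne x 0 with rfl | hx
  · simp
  have hy : y ≠ 0 := normAbs_pos.1 (pos_of_gt h)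
  obtain ⟨n, hn⟩ := normAbs_eq_zpow hx
  obtain ⟨m, hm⟩ := normAbs_eq_zpow hy
  rw [hn, hm] at h ⊢
  rw [zpow_lt_zpow_iff_right₀ (one_lt_resCard K)] at h
  rw [unifAbs, ← zpow_neg_one, ← zpow_add₀ (resCard_ne_zero K),
    zpow_le_zpow_iff_right₀ (one_lt_resCard K)]
  lia

lemma normAbs_le_unifAbs {x : K} (h : normAbs K x < 1) : normAbs K x ≤ unifAbs K := by
  have := normAbs_le_unifAbs_mul (K := K) (x := x) (y := 1) (by simpa using h)
  simpa using this

/-- Irreducibility enters through a single factorization: if |ϖ| were smaller than q⁻¹ = |x|, then ϖ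
= x · (ϖ/x) would be a product of two non-units. -/
lemma normAbs_eq_unifAbs {ϖ : 𝒪[K]} (hϖ : Irreducible ϖ) : normAbs K (ϖ : K) = unifAbs K := by
  have hne : (ϖ : K) ≠ 0 := fun h => hϖ.ne_zero (Subtype.ext h)
  have hle : normAbs K (ϖ : K) ≤ 1 := normAbs_le_one_iff.2 ϖ.2
  have hlt : normAbs K (ϖ : K) < 1 := by
    refine lt_of_le_of_ne hle fun h => hϖ.not_isUnit ?_
    have h' : normAbs K (ϖ : K)⁻¹ ≤ 1 := by rw [map_inv₀, h, inv_one]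
    exact IsUnit.of_mul_eq_one ⟨_, normAbs_le_one_iff.1 h'⟩ (Subtype.ext (mul_inv_cancel₀ hne))
  refine le_antisymm (normAbs_le_unifAbs hlt) ?_
  obtain ⟨x, hx⟩ := exists_normAbs_eq_zpow K (-1)
  rw [zpow_neg_one] at hx
  change normAbs K x = unifAbs K at hx
  rw [← hx]
  by_contra! h
  have hx1 : normAbs K x < 1 := hx ▸ unifAbs_lt_one K
  have hx0 : x ≠ 0 := normAbs_pos.1 (hx ▸ unifAbs_pos K)
  have hy : normAbs K ((ϖ : K) / x) < 1 := by
    rw [map_div₀, div_lt_one (normAbs_pos.2 hx0)]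
    exact h
  have heq : ϖ = ⟨x, normAbs_le_one_iff.1 hx1.le⟩ * ⟨(ϖ : K) / x, normAbs_le_one_iff.1 hy.le⟩ :=
    Subtype.ext (mul_div_cancel₀ _ hx0).symm
  have hnu : ∀ (z : K) (hz : normAbs K z < 1), ¬ IsUnit (⟨z, normAbs_le_one_iff.1 hz.le⟩ : 𝒪[K]) := by
    intro z hz hu
    obtain ⟨u, hu⟩ := hu.exists_right_inv
    have h1 : z * (u : K) = 1 := congrArg Subtype.val hu
    have h2 := congrArg (normAbs K) h1
    rw [map_mul, map_one] at h2
    have : normAbs K z * normAbs K (u : K) < 1 :=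
      mul_lt_one_of_nonneg_of_lt_one_left zero_le hz (normAbs_le_one_iff.2 u.2)
    exact this.ne h2
  rcases hϖ.isUnit_or_isUnit heq with h | h
  · exact hnu _ hx1 h
  · exact hnu _ hy h

lemma mem_maximalIdeal_iff {x : 𝒪[K]} : x ∈ 𝓂[K] ↔ normAbs K (x : K) < 1 := by
  rw [IsLocalRing.mem_maximalIdeal, mem_nonunits_iff, ← not_iff_not, not_not, not_lt]
  constructor
  · intro h
    obtain ⟨u, hu⟩ := h.exists_right_inv
    have h1 : (x : K) * (u : K) = 1 := congrArg Subtype.val hu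
    have h2 := congrArg (normAbs K) h1
    rw [map_mul, map_one] at h2
    rw [← h2]
    exact mul_le_of_le_one_right zero_le (normAbs_le_one_iff.2 u.2)
  · intro h
    have hx : (x : K) ≠ 0 := normAbs_pos.1 (zero_lt_one.trans_le h)
    have h' : normAbs K (x : K)⁻¹ ≤ 1 := by
      rw [map_inv₀]
      exact inv_le_one_of_one_le₀ h
    exact IsUnit.of_mul_eq_one ⟨_, normAbs_le_one_iff.1 h'⟩ (Subtype.ext (mul_inv_cancel₀ hx))

lemma residue_eq_iff {x y : 𝒪[K]} :
    IsLocalRing.residue 𝒪[K] x = IsLocalRing.residue 𝒪[K] y ↔ normAbs K ((x : K) - y) < 1 := by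
  rw [← sub_eq_zero, ← map_sub, IsLocalRing.residue_eq_zero_iff, mem_maximalIdeal_iff]
  rfl

variable (K) in
/-- A system of representatives of the residue field. -/
lemma exists_representatives : ∃ R : Finset K, R.card = resCard K ∧ (∀ a ∈ R, normAbs K a ≤ 1) ∧
    ∀ x : K, normAbs K x ≤ 1 → ∃! a, a ∈ R ∧ normAbs K (x - a) < 1 := by
  classical
  have : Fintype 𝓀[K] := Fintype.ofFinite _
  have hsurj := IsLocalRing.residue_surjective (R := 𝒪[K])
  choose g hg using hsurj
  have hinj : Function.Injective fun z => ((g z : 𝒪[K]) : K) := fun a b h => by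
    rw [← hg a, ← hg b, Subtype.ext h]
  refine ⟨Finset.univ.image fun z => ((g z : 𝒪[K]) : K), ?_, ?_, ?_⟩
  · rw [Finset.card_image_of_injective _ hinj, Finset.card_univ, resCard, Nat.card_eq_fintype_card]
  · intro a ha
    obtain ⟨z, -, rfl⟩ := Finset.mem_image.1 ha
    exact normAbs_le_one_iff.2 (g z).2
  · intro x hx
    let x' : 𝒪[K] := ⟨x, normAbs_le_one_iff.1 hx⟩
    refine ⟨g (IsLocalRing.residue _ x'), ⟨Finset.mem_image_of_mem _ (Finset.mem_univ _), ?_⟩, ?_⟩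
    · exact residue_eq_iff (x := x').1 (hg _).symm
    · rintro a ⟨ha, hxa⟩
      obtain ⟨z, -, rfl⟩ := Finset.mem_image.1 ha
      have := residue_eq_iff (x := x').2 hxa
      rw [hg] at this
      rw [this]

lemma isOpen_normAbs_le {c : ℝ≥0} (hc : 0 < c) : IsOpen {x : K | normAbs K x ≤ c} := by
  rw [isOpen_iff_mem_nhds]
  intro x hx
  rw [IsValuativeTopology.mem_nhds_iff']
  obtain ⟨n, hn⟩ : ∃ n : ℕ, unifAbs K ^ n < c := exists_pow_lt_of_lt_one hc (unifAbs_lt_one K)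
  obtain ⟨y, hy⟩ := exists_normAbs_eq_zpow K (-n)
  rw [zpow_neg, ← inv_zpow, zpow_natCast] at hy
  change normAbs K y = unifAbs K ^ n at hy
  have hy0 : y ≠ 0 := normAbs_pos.1 (hy ▸ pow_pos (unifAbs_pos K) n)
  refine ⟨Units.mk0 (ValuativeRel.valuation K y) (by simpa using hy0), fun z hz => ?_⟩
  have hz' : normAbs K (z - x) < normAbs K y := normAbs_lt_iff.2 hz
  have := normAbs_add_le_of_le (hz'.le.trans (hy.trans_le hn.le)) hx
  rwa [sub_add_cancel] at this

lemma exists_normAbs_le_subset {s : Set K} {x : K} (hs : s ∈ nhds x) :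
    ∃ n : ℕ, ∀ y : K, normAbs K (y - x) ≤ unifAbs K ^ n → y ∈ s := by
  rw [IsValuativeTopology.mem_nhds_iff'] at hs
  obtain ⟨γ, hγ⟩ := hs
  obtain ⟨z, hz⟩ := ValuativeRel.valuation_surjective (γ : ValuativeRel.ValueGroupWithZero K)
  have hz0 : z ≠ 0 := fun h => γ.ne_zero (by rw [← hz, h, map_zero])
  obtain ⟨n, hn⟩ := exists_pow_lt_of_lt_one (normAbs_pos.2 hz0) (unifAbs_lt_one K)
  refine ⟨n, fun y hy => hγ ?_⟩
  change ValuativeRel.valuation K (y - x) < γ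
  rw [← hz, ← normAbs_lt_iff]
  exact hy.trans_lt hn

variable (K) in
lemma isCompact_normAbs_le_one : IsCompact {x : K | normAbs K x ≤ 1} := by
  convert IsNonarchimedeanLocalField.isCompact_closedBall K 1 using 2
  ext x
  exact normAbs_le_one_iff

end AbsoluteValue

end U3

end

noncomputable section

namespace U3

/-! ### Unramified quadratic extensions -/

section Hensel

variable {K : Type*} [Field K] [ValuativeRel K] [TopologicalSpace K]
  [IsNonarchimedeanLocalField K]

lemma normAbs_two (h2 : ringChar 𝓀[K] ≠ 2) : normAbs K 2 = 1 := by
  have h : (2 : 𝓀[K]) ≠ 0 := Ring.two_ne_zero h2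
  have hle : normAbs K 2 ≤ 1 := normAbs_le_one_iff.2 (2 : 𝒪[K]).2
  refine le_antisymm hle (not_lt.1 fun hlt => h ?_)
  have : (2 : 𝒪[K]) ∈ 𝓂[K] := mem_maximalIdeal_iff.2 hlt
  rw [← IsLocalRing.residue_eq_zero_iff, map_ofNat] at this
  exact this

/-- Hensel's lemma: a unit that is a square modulo the maximal ideal is a square. -/
lemma isSquare_of_sub_sq_mem (h2 : ringChar 𝓀[K] ≠ 2) (u : 𝒪[K]ˣ) (c : 𝒪[K])
    (hc : (u : 𝒪[K]) - c ^ 2 ∈ 𝓂[K]) : IsSquare u := by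
  let := IsTopologicalAddGroup.rightUniformSpace K
  have := isUniformAddGroup_of_addCommGroup (G := K)
  have hcu : IsUnit c := by
    by_contra hn
    have h1 : c ∈ 𝓂[K] := hn
    have h3 : (u : 𝒪[K]) ∈ 𝓂[K] := by
      have := Ideal.add_mem _ hc (Ideal.pow_mem_of_mem _ h1 2 two_pos)
      rwa [sub_add_cancel] at this
    exact h3 u.isUnit
  have h2u : IsUnit (2 : 𝒪[K]) := by
    by_contra hn
    have h1 : (2 : 𝒪[K]) ∈ 𝓂[K] := hn
    have := mem_maximalIdeal_iff.1 h1
    exact this.ne (normAbs_two h2)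
  obtain ⟨a, ha, -⟩ := HenselianRing.is_henselian (I := 𝓂[K])
    (Polynomial.X ^ 2 - Polynomial.C (u : 𝒪[K])) (Polynomial.monic_X_pow_sub_C _ two_ne_zero) c
    (by
      have := neg_mem hc
      simpa using this)
    (by
      refine IsUnit.map _ ?_
      simpa [one_add_one_eq_two] using h2u.mul hcu)
  have ha' : a * a = u := by
    have : a ^ 2 - (u : 𝒪[K]) = 0 := by simpa [Polynomial.IsRoot.def] using ha
    rw [← sq]
    exact sub_eq_zero.1 this
  have hau : IsUnit a := isUnit_of_mul_isUnit_left (ha' ▸ u.isUnit)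
  exact ⟨hau.unit, Units.ext ha'.symm⟩

end Hensel

/-! ### Extensions generated by a square root. -/

section Quadratic

variable {F E : Type*} [Field F] [Field E] [Algebra F E]

lemma exists_eq_add_mul_of_adjoin_eq_top {s : E} {e : F} (hs : s ^ 2 = algebraMap F E e)
    (hE : F⟮s⟯ = ⊤) (x : E) : ∃ a b : F, x = algebraMap F E a + algebraMap F E b * s := by
  have hint : IsIntegral F s := by
    refine ⟨Polynomial.X ^ 2 - Polynomial.C e, Polynomial.monic_X_pow_sub_C _ two_ne_zero, ?_⟩
    simp [hs]
  have hx : x ∈ Algebra.adjoin F {s} := by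
    rw [← IntermediateField.adjoin_simple_toSubalgebra_of_isAlgebraic hint.isAlgebraic, hE]
    trivial
  induction hx using Algebra.adjoin_induction with
  | mem x hx => exact ⟨0, 1, by simp [Set.mem_singleton_iff.1 hx]⟩
  | algebraMap r => exact ⟨r, 0, by simp⟩
  | add x y _ _ hx hy =>
    obtain ⟨a, b, rfl⟩ := hx
    obtain ⟨c, d, rfl⟩ := hy
    exact ⟨a + c, b + d, by rw [map_add, map_add]; ring⟩
  | mul x y _ _ hx hy =>
    obtain ⟨a, b, rfl⟩ := hx
    obtain ⟨c, d, rfl⟩ := hy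
    refine ⟨a * c + b * d * e, a * d + b * c, ?_⟩
    simp only [map_add, map_mul, ← hs]
    ring

lemma map_generator_eq_neg {s : E} {e : F} (hs : s ^ 2 = algebraMap F E e) (hE : F⟮s⟯ = ⊤)
    {σ : E ≃ₐ[F] E} (hσ : σ ≠ 1) : σ s = -s := by
  have h : σ s ^ 2 = s ^ 2 := by rw [← map_pow, hs, AlgEquiv.commutes]
  rcases sq_eq_sq_iff_eq_or_eq_neg.1 h with h | h
  · refine absurd (AlgEquiv.ext fun x => ?_) hσ
    obtain ⟨a, b, rfl⟩ := exists_eq_add_mul_of_adjoin_eq_top hs hE x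
    simp [h]
  · exact h

end Quadratic

/-! ### Absolute value and residue field of F(√ε). -/

section Unramified

variable {F E : Type*} [Field F] [ValuativeRel F] [TopologicalSpace F]
  [IsNonarchimedeanLocalField F]
  [Field E] [ValuativeRel E] [TopologicalSpace E] [IsNonarchimedeanLocalField E]
  [Algebra F E]

/-- The properties of an unramified quadratic extension `E / F` of odd residual characteristic,
with conjugation `σ` and uniformizer `ϖ`. -/
structure Unramified (σ : E ≃ₐ[F] E) (ϖ : F) : Prop where
  conj_conj : ∀ x, σ (σ x) = x
  normAbs_conj : ∀ x, normAbs E (σ x) = normAbs E x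
  normAbs_unif : normAbs E (algebraMap F E ϖ) = unifAbs E
  normAbs_two : normAbs E 2 = 1
  resCard_eq : resCard E = resCard F ^ 2
  -- Skew integers fill only q of the q² residue classes. This is what makes a refinement in the
  -- x-direction cost q instead of q².
  exists_skew : ∃ R : Finset E, R.card = resCard F ∧
    (∀ a ∈ R, normAbs E a ≤ 1 ∧ σ a = -a) ∧
    ∀ x : E, normAbs E x ≤ 1 → σ x = -x → ∃! a, a ∈ R ∧ normAbs E (x - a) < 1

variable [ValuativeExtension F E]

omit [TopologicalSpace F] [IsNonarchimedeanLocalField F] in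
lemma normAbs_algebraMap_le_one_iff {x : F} :
    normAbs E (algebraMap F E x) ≤ 1 ↔ x ∈ 𝒪[F] := by
  rw [← map_one (normAbs E), normAbs_le_iff, ← map_one (algebraMap F E),
    ← Valuation.Compatible.vle_iff_le, ValuativeExtension.vle_iff_vle,
    Valuation.Compatible.vle_iff_le (v := ValuativeRel.valuation F), map_one]
  rfl

lemma normAbs_algebraMap_le_one_iff' {x : F} :
    normAbs E (algebraMap F E x) ≤ 1 ↔ normAbs F x ≤ 1 := by
  rw [normAbs_algebraMap_le_one_iff, normAbs_le_one_iff]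

lemma normAbs_algebraMap_lt_one_iff {x : F} :
    normAbs E (algebraMap F E x) < 1 ↔ normAbs F x < 1 := by
  rcases eq_or_ne x 0 with rfl | hx
  · simp
  rw [← not_iff_not, not_lt, not_lt]
  have h := normAbs_algebraMap_le_one_iff' (E := E) (x := x⁻¹)
  rw [map_inv₀, map_inv₀, map_inv₀] at h
  have hF := normAbs_pos.2 hx
  have hE := normAbs_pos.2 ((map_ne_zero (algebraMap F E)).2 hx)
  rwa [inv_le_one₀ hE, inv_le_one₀ hF] at h

variable (hodd : ringChar 𝓀[F] ≠ 2) {ε : 𝒪[F]ˣ} (hε : ¬ IsSquare ε)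
  {s : E} (hs : s ^ 2 = algebraMap F E (ε : 𝒪[F]))

include hs in
lemma normAbs_generator : normAbs E s = 1 := by
  have h1 : normAbs F (ε : 𝒪[F]) = 1 := by
    refine le_antisymm (normAbs_le_one_iff.2 (ε : 𝒪[F]).2) (not_lt.1 fun h => ?_)
    exact mem_maximalIdeal_iff.2 h ε.isUnit
  have h2 : normAbs E s ^ 2 = 1 := by
    rw [← map_pow, hs]
    refine le_antisymm (normAbs_algebraMap_le_one_iff'.2 h1.le) (not_lt.1 fun h => ?_)
    exact (normAbs_algebraMap_lt_one_iff.1 h).ne h1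
  exact (pow_eq_one_iff_of_nonneg zero_le two_ne_zero).1 h2

include hodd hε hs in
-- The place where ε being a non-square enters: if b were a unit, ε would be congruent to (a/b)²
-- modulo the maximal ideal, hence a square by Hensel.
lemma normAbs_coeff_lt_one {a b : F} (ha : normAbs F a ≤ 1) (hb : normAbs F b ≤ 1)
    (h : normAbs E (algebraMap F E a + algebraMap F E b * s) < 1) :
    normAbs F a < 1 ∧ normAbs F b < 1 := by
  have hs1 := normAbs_generator hs
  have hb1 : normAbs F b < 1 := by
    refine lt_of_le_of_ne hb fun hb1 => hε ?_
    have hb0 : b ≠ 0 := normAbs_pos.1 (hb1 ▸ one_pos)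
    have hc : normAbs F (a / b) ≤ 1 := by rwa [map_div₀, hb1, div_one]
    refine isSquare_of_sub_sq_mem hodd ε ⟨a / b, normAbs_le_one_iff.1 hc⟩ ?_
    rw [mem_maximalIdeal_iff, ← normAbs_algebraMap_lt_one_iff (E := E)]
    have hbE : algebraMap F E b ≠ 0 := (map_ne_zero _).2 hb0
    have hbE1 : normAbs E (algebraMap F E b) = 1 :=
      le_antisymm (normAbs_algebraMap_le_one_iff'.2 hb)
        (not_lt.1 fun h => (normAbs_algebraMap_lt_one_iff.1 h).ne hb1)
    -- ε - (a/b)² = (s + a/b)(s - a/b), whose first factor is small by assumption and whose second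
    -- is integral.
    have e1 : algebraMap F E (((ε : 𝒪[F]) - (⟨a / b, normAbs_le_one_iff.1 hc⟩ : 𝒪[F]) ^ 2 : 𝒪[F]) : F)
        = (algebraMap F E a + algebraMap F E b * s) / algebraMap F E b *
          (s - algebraMap F E a / algebraMap F E b) := by
      have : (((ε : 𝒪[F]) - (⟨a / b, normAbs_le_one_iff.1 hc⟩ : 𝒪[F]) ^ 2 : 𝒪[F]) : F)
        = (ε : 𝒪[F]) - (a / b) ^ 2 := rfl
      rw [this, map_sub, ← hs, map_pow, map_div₀]
      field_simp
      ring
    rw [e1, map_mul, map_div₀, hbE1, div_one]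
    refine mul_lt_one_of_nonneg_of_lt_one_left zero_le h (normAbs_sub_le_of_le hs1.le ?_)
    rw [map_div₀, hbE1, div_one]
    exact normAbs_algebraMap_le_one_iff'.2 ha
  refine ⟨?_, hb1⟩
  rw [← normAbs_algebraMap_lt_one_iff (E := E)]
  have h1 : normAbs E (algebraMap F E b * s) < 1 := by
    rw [map_mul, hs1, mul_one]
    exact normAbs_algebraMap_lt_one_iff.2 hb1
  have := (normAbs_sub_le _ _).trans_lt (max_lt h h1)
  rwa [add_sub_cancel_right] at this

omit [TopologicalSpace F] [IsNonarchimedeanLocalField F] in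
lemma normAbs_algebraMap_le_iff {x y : F} :
    normAbs E (algebraMap F E x) ≤ normAbs E (algebraMap F E y) ↔
      ValuativeRel.valuation F x ≤ ValuativeRel.valuation F y := by
  rw [normAbs_le_iff, ← Valuation.Compatible.vle_iff_le, ValuativeExtension.vle_iff_vle,
    Valuation.Compatible.vle_iff_le (v := ValuativeRel.valuation F)]

include hodd hε hs in
-- Dividing by the larger coefficient reduces to the integral case just treated. So 1, s is an
-- orthogonal basis of E over F. That σ is an isometry, that ϖ stays a uniformizer and that the
-- residue degree is 2 all follow.
lemma normAbs_add_mul_generator (a b : F) :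
    normAbs E (algebraMap F E a + algebraMap F E b * s) =
      max (normAbs E (algebraMap F E a)) (normAbs E (algebraMap F E b)) := by
  have hs1 := normAbs_generator hs
  refine le_antisymm ?_ ?_
  · refine (normAbs_add_le _ _).trans ?_
    rw [map_mul, hs1, mul_one]
  · obtain ⟨c, hc, hca, hcb⟩ : ∃ c : F, normAbs E (algebraMap F E c) =
        max (normAbs E (algebraMap F E a)) (normAbs E (algebraMap F E b)) ∧
        normAbs E (algebraMap F E a) ≤ normAbs E (algebraMap F E c) ∧
        normAbs E (algebraMap F E b) ≤ normAbs E (algebraMap F E c) := by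
      rcases le_total (normAbs E (algebraMap F E a)) (normAbs E (algebraMap F E b)) with h | h
      · exact ⟨b, by rw [max_eq_right h], h, le_rfl⟩
      · exact ⟨a, by rw [max_eq_left h], le_rfl, h⟩
    rw [← hc]
    rcases eq_or_ne c 0 with rfl | hc0
    · simp
    by_contra! hlt
    have hcE : algebraMap F E c ≠ 0 := (map_ne_zero _).2 hc0
    have hcp := normAbs_pos.2 hcE
    have hle : ∀ x : F, normAbs E (algebraMap F E x) ≤ normAbs E (algebraMap F E c) →
        normAbs F (x / c) ≤ 1 := by
      intro x hx
      rw [← normAbs_algebraMap_le_one_iff' (E := E), map_div₀, map_div₀]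
      exact div_le_one_of_le₀ hx zero_le
    have h := normAbs_coeff_lt_one hodd hε hs (hle a hca) (hle b hcb) (by
      have : algebraMap F E (a / c) + algebraMap F E (b / c) * s =
          (algebraMap F E a + algebraMap F E b * s) / algebraMap F E c := by
        rw [map_div₀, map_div₀]
        field_simp
      rw [this, map_div₀]
      exact (div_lt_one hcp).2 hlt)
    have hlt' : ∀ x : F, normAbs F (x / c) < 1 →
        normAbs E (algebraMap F E x) < normAbs E (algebraMap F E c) := by
      intro x hx
      rw [← normAbs_algebraMap_lt_one_iff (E := E), map_div₀, map_div₀] at hx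
      exact (div_lt_one hcp).1 hx
    exact (max_lt (hlt' a h.1) (hlt' b h.2)).ne hc.symm

variable (hE : F⟮s⟯ = ⊤)

include hodd hε hs hE in
-- By orthogonality of 1, s every absolute value attained on E is attained on F, so the extension is
-- unramified.
lemma normAbs_algebraMap_unif {ϖ : 𝒪[F]} (hϖ : Irreducible ϖ) :
    normAbs E (algebraMap F E ϖ) = unifAbs E := by
  have hF := normAbs_eq_unifAbs hϖ
  have hlt : normAbs E (algebraMap F E ϖ) < 1 :=
    normAbs_algebraMap_lt_one_iff.2 (hF.trans_lt (unifAbs_lt_one F))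
  refine le_antisymm (normAbs_le_unifAbs hlt) ?_
  obtain ⟨x, hx⟩ := exists_normAbs_eq_zpow E (-1)
  rw [zpow_neg_one] at hx
  change normAbs E x = unifAbs E at hx
  rw [← hx]
  obtain ⟨c, hc⟩ : ∃ c : F, normAbs E x = normAbs E (algebraMap F E c) := by
    obtain ⟨a, b, rfl⟩ := exists_eq_add_mul_of_adjoin_eq_top hs hE x
    rw [normAbs_add_mul_generator hodd hε hs]
    rcases max_choice (normAbs E (algebraMap F E a)) (normAbs E (algebraMap F E b)) with h | h
    · exact ⟨a, h⟩
    · exact ⟨b, h⟩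
  rw [hc] at hx ⊢
  have hc1 : normAbs F c < 1 := normAbs_algebraMap_lt_one_iff.1 (hx.trans_lt (unifAbs_lt_one E))
  have := normAbs_le_unifAbs hc1
  rw [← hF, normAbs_le_iff] at this
  exact normAbs_algebraMap_le_iff.2 this

include hodd hε hs hE in
-- By orthogonality, a + b s reduces to 0 exactly when a and b do, so (a, b) ↦ a + b s is a
-- bijection of pairs of residue classes of F with those of E.
lemma resCard_eq_sq : resCard E = resCard F ^ 2 := by
  have hsurj := IsLocalRing.residue_surjective (R := 𝒪[F])
  choose g hg using hsurj
  have hs1 := normAbs_generator hs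
  have hint : ∀ a b : F, normAbs F a ≤ 1 → normAbs F b ≤ 1 →
      algebraMap F E a + algebraMap F E b * s ∈ 𝒪[E] := by
    intro a b ha hb
    rw [← normAbs_le_one_iff, normAbs_add_mul_generator hodd hε hs]
    exact max_le (normAbs_algebraMap_le_one_iff'.2 ha) (normAbs_algebraMap_le_one_iff'.2 hb)
  let f : 𝓀[F] × 𝓀[F] → 𝓀[E] := fun z => IsLocalRing.residue 𝒪[E]
    ⟨_, hint (g z.1) (g z.2) (normAbs_le_one_iff.2 (g z.1).2) (normAbs_le_one_iff.2 (g z.2).2)⟩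
  have key : ∀ a b c d : F, normAbs E ((algebraMap F E a + algebraMap F E b * s) -
      (algebraMap F E c + algebraMap F E d * s)) < 1 ↔
      normAbs F (a - c) < 1 ∧ normAbs F (b - d) < 1 := by
    intro a b c d
    have : (algebraMap F E a + algebraMap F E b * s) - (algebraMap F E c + algebraMap F E d * s) =
      algebraMap F E (a - c) + algebraMap F E (b - d) * s := by
      rw [map_sub, map_sub]; ring
    rw [this, normAbs_add_mul_generator hodd hε hs, max_lt_iff, normAbs_algebraMap_lt_one_iff,
      normAbs_algebraMap_lt_one_iff]
  have hf : Function.Bijective f := by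
    constructor
    · rintro ⟨a, b⟩ ⟨c, d⟩ h
      obtain ⟨h1, h2⟩ := (key _ _ _ _).1 (residue_eq_iff.1 h)
      have h1 := residue_eq_iff.2 h1
      have h2 := residue_eq_iff.2 h2
      simp only [hg] at h1 h2
      rw [h1, h2]
    · intro z
      obtain ⟨x, rfl⟩ := IsLocalRing.residue_surjective z
      obtain ⟨a, b, hab⟩ := exists_eq_add_mul_of_adjoin_eq_top hs hE (x : E)
      have hx := normAbs_le_one_iff.2 x.2
      rw [hab, normAbs_add_mul_generator hodd hε hs, max_le_iff, normAbs_algebraMap_le_one_iff',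
        normAbs_algebraMap_le_one_iff'] at hx
      refine ⟨(IsLocalRing.residue _ ⟨a, normAbs_le_one_iff.1 hx.1⟩,
        IsLocalRing.residue _ ⟨b, normAbs_le_one_iff.1 hx.2⟩), residue_eq_iff.2 ?_⟩
      rw [hab]
      exact (key _ _ _ _).2 ⟨residue_eq_iff.1 (hg _), residue_eq_iff.1 (hg _)⟩
  rw [resCard, ← Nat.card_congr (Equiv.ofBijective f hf), Nat.card_prod, sq]
  rfl

include hodd hε hs hE in
lemma unramified {σ : E ≃ₐ[F] E} (hσ : σ ≠ 1) {ϖ : 𝒪[F]} (hϖ : Irreducible ϖ) :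
    Unramified σ (ϖ : F) where
  conj_conj x := by
    obtain ⟨a, b, rfl⟩ := exists_eq_add_mul_of_adjoin_eq_top hs hE x
    simp [map_generator_eq_neg hs hE hσ]
  normAbs_conj x := by
    obtain ⟨a, b, rfl⟩ := exists_eq_add_mul_of_adjoin_eq_top hs hE x
    have : σ (algebraMap F E a + algebraMap F E b * s) =
        algebraMap F E a + algebraMap F E (-b) * s := by
      simp [map_generator_eq_neg hs hE hσ]
    rw [this, normAbs_add_mul_generator hodd hε hs, normAbs_add_mul_generator hodd hε hs,
      map_neg, normAbs_neg]
  normAbs_unif := normAbs_algebraMap_unif hodd hε hs hE hϖ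
  normAbs_two := by
    have h := normAbs_two hodd
    rw [← map_ofNat (algebraMap F E) 2]
    exact le_antisymm (normAbs_algebraMap_le_one_iff'.2 h.le)
      (not_lt.1 fun h' => (normAbs_algebraMap_lt_one_iff.1 h').ne h)
  resCard_eq := resCard_eq_sq hodd hε hs hE
  exists_skew := by
    classical
    obtain ⟨R, hR, hR1, hR2⟩ := exists_representatives F
    have hs1 := normAbs_generator hs
    have hs0 : s ≠ 0 := normAbs_pos.1 (hs1 ▸ one_pos)
    have hσs := map_generator_eq_neg hs hE hσ
    have h20 : (2 : F) ≠ 0 := normAbs_pos.1 ((normAbs_two hodd) ▸ one_pos)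
    have hinj : Function.Injective fun τ : F => algebraMap F E τ * s := fun x y h =>
      (algebraMap F E).injective (mul_right_cancel₀ hs0 h)
    have habs : ∀ τ : F, normAbs E (algebraMap F E τ * s) = normAbs E (algebraMap F E τ) := by
      intro τ
      rw [map_mul, hs1, mul_one]
    refine ⟨R.image fun τ => algebraMap F E τ * s, ?_, ?_, ?_⟩
    · rw [Finset.card_image_of_injective _ hinj, hR]
    · intro a ha
      obtain ⟨τ, hτ, rfl⟩ := Finset.mem_image.1 ha
      refine ⟨?_, by simp [hσs]⟩
      rw [habs]
      exact normAbs_algebraMap_le_one_iff'.2 (hR1 τ hτ)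
    · intro x hx hσx
      obtain ⟨a, b, rfl⟩ := exists_eq_add_mul_of_adjoin_eq_top hs hE x
      have ha : a = 0 := by
        have h2 : algebraMap F E (2 * a) = 0 := by
          rw [map_mul, map_ofNat]
          simp only [map_add, AlgEquiv.commutes, map_mul, hσs] at hσx
          linear_combination hσx
        have := (map_eq_zero _).1 h2
        exact (mul_eq_zero.1 this).resolve_left h20
      subst ha
      rw [map_zero, zero_add] at hx ⊢
      rw [habs, normAbs_algebraMap_le_one_iff'] at hx
      obtain ⟨τ, ⟨hτ, hτ'⟩, hu⟩ := hR2 b hx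
      have key : ∀ c : F, normAbs E (algebraMap F E b * s - algebraMap F E c * s) < 1 ↔
          normAbs F (b - c) < 1 := by
        intro c
        rw [← sub_mul, ← map_sub, habs, normAbs_algebraMap_lt_one_iff]
      refine ⟨algebraMap F E τ * s, ⟨Finset.mem_image_of_mem _ hτ, (key τ).2 hτ'⟩, ?_⟩
      rintro y ⟨hy, hy'⟩
      obtain ⟨c, hc, rfl⟩ := Finset.mem_image.1 hy
      rw [hu c ⟨hc, (key c).1 hy'⟩]

end Unramified

end U3

end

noncomputable section

namespace U3

/-! ### Entries of unitary matrices -/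

section Entries

variable {F E : Type*} [Field F] [Field E] [Algebra F E] (σ : E ≃ₐ[F] E)

variable {σ} in
lemma G_ext {g h : G σ} (H : ∀ i j, entry σ g i j = entry σ h i j) : g = h :=
  Subtype.ext (Units.ext (Matrix.ext H))

lemma J_mul_J : J E * J E = 1 := by
  ext i j
  fin_cases i <;> fin_cases j <;> simp [J, Matrix.mul_apply, Fin.sum_univ_three]

lemma J_mul_mul_J_apply (A : Matrix (Fin 3) (Fin 3) E) (i j : Fin 3) :
    (J E * A * J E) i j = A i.rev j.rev := by
  fin_cases i <;> fin_cases j <;> simp [J, Matrix.mul_apply, Matrix.vecMul, dotProduct, Fin.sum_univ_three, Fin.rev]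

lemma entry_inv (g : G σ) (i j : Fin 3) :
    entry σ g⁻¹ i j = σ (entry σ g j.rev i.rev) := by
  have h : conjT σ g.val.val * J E * g.val.val = J E := g.2
  have h1 : J E * conjT σ g.val.val * J E * g.val.val = 1 := by
    rw [mul_assoc, mul_assoc, ← mul_assoc (conjT σ g.val.val), h, J_mul_J]
  have h2 : (g⁻¹ : G σ).val.val = J E * conjT σ g.val.val * J E := by
    have h3 : g.val.val * (g⁻¹ : G σ).val.val = 1 := Units.mul_inv g.val
    calc (g⁻¹ : G σ).val.val = (J E * conjT σ g.val.val * J E * g.val.val) * (g⁻¹ : G σ).val.val := by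
          rw [h1, one_mul]
      _ = _ := by rw [mul_assoc, h3, mul_one]
  change (g⁻¹ : G σ).val.val i j = _
  rw [h2, J_mul_mul_J_apply]
  rfl

/-- The unitary relation reads g⁻¹ = J ᵗḡ J, and conjugation by J reverses both indices. All
quadratic relations between the entries are read off from g g⁻¹ = 1 or g⁻¹ g = 1 in this form. -/
lemma entry_inv_mul (g : G σ) (i j : Fin 3) :
    ∑ k, σ (entry σ g k.rev i.rev) * entry σ g k j = if i = j then 1 else 0 := by
  rw [← entry_one σ i j, ← inv_mul_cancel g, entry_mul]
  exact Finset.sum_congr rfl fun k _ => by rw [entry_inv]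

lemma entry_mul_inv (g : G σ) (i j : Fin 3) :
    ∑ k, entry σ g i k * σ (entry σ g j.rev k.rev) = if i = j then 1 else 0 := by
  rw [← entry_one σ i j, ← mul_inv_cancel g, entry_mul]
  exact Finset.sum_congr rfl fun k _ => by rw [entry_inv]

/-- The bottom row of an element of `G` is isotropic. -/
lemma row_isotropic (g : G σ) :
    entry σ g 2 0 * σ (entry σ g 2 2) + entry σ g 2 1 * σ (entry σ g 2 1) +
      entry σ g 2 2 * σ (entry σ g 2 0) = 0 := by
  have := entry_mul_inv σ g 2 0
  simpa [Fin.sum_univ_three, Fin.rev] using this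

/-- The remaining entry below the diagonal has norm 0 by the unitary relation for the first column.
Hence the bottom row alone decides membership in B. -/
lemma mem_B_of_row {b : G σ} (h0 : entry σ b 2 0 = 0) (h1 : entry σ b 2 1 = 0) : b ∈ B σ := by
  have := entry_inv_mul σ b 2 0
  simp [Fin.sum_univ_three, Fin.rev, h0] at this
  have h10 : entry σ b 1 0 = 0 := this
  intro i j hij
  fin_cases i <;> fin_cases j <;> first | exact h0 | exact h1 | exact h10 | (simp at hij)

lemma entry_diag_conj {b : G σ} (hb : b ∈ B σ) : σ (entry σ b 0 0) * entry σ b 2 2 = 1 := by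
  have := entry_inv_mul σ b 2 2
  have h0 : entry σ b 2 0 = 0 := hb 2 0 (by decide)
  have h1 : entry σ b 1 0 = 0 := hb 1 0 (by decide)
  simpa [Fin.sum_univ_three, Fin.rev, h0, h1] using this

/-- Makes the bottom row, up to scalars, a coordinate on B\G; the scalar is the last diagonal entry
of the element of B. -/
lemma mul_inv_mem_B {g g' : G σ} {l : E} (h : ∀ j, entry σ g 2 j = l * entry σ g' 2 j) :
    g * g'⁻¹ ∈ B σ ∧ entry σ (g * g'⁻¹) 2 2 = l := by
  have key : ∀ j, entry σ (g * g'⁻¹) 2 j = l * entry σ 1 2 j := by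
    intro j
    rw [← mul_inv_cancel g', entry_mul, entry_mul, Finset.mul_sum]
    exact Finset.sum_congr rfl fun k _ => by rw [h]; ring
  refine ⟨mem_B_of_row σ ?_ ?_, ?_⟩
  · rw [key, entry_one]; simp
  · rw [key, entry_one]; simp
  · rw [key, entry_one]; simp

lemma row_ne_zero (g : G σ) : ¬ (entry σ g 2 0 = 0 ∧ entry σ g 2 1 = 0 ∧ entry σ g 2 2 = 0) := by
  rintro ⟨h0, h1, h2⟩
  have := entry_mul_inv σ g 2 2
  simp [Fin.sum_univ_three, h0, h1, h2] at this

/-- Constructor for elements of `G` from a matrix. -/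
def mkG (A : Matrix (Fin 3) (Fin 3) E) (h : conjT σ A * J E * A = J E) : G σ :=
  ⟨Matrix.GeneralLinearGroup.mkOfDetNeZero A (by
    intro h0
    have h1 := congrArg Matrix.det h
    rw [Matrix.det_mul, h0, mul_zero] at h1
    have h2 := congrArg Matrix.det (J_mul_J (E := E))
    rw [Matrix.det_mul, ← h1] at h2
    simp at h2), h⟩

lemma entry_mkG (A : Matrix (Fin 3) (Fin 3) E) (h : conjT σ A * J E * A = J E) (i j : Fin 3) :
    entry σ (mkG σ A h) i j = A i j := rfl

end Entries

/-! ### Congruence subgroups -/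

section Congruence

variable {F E : Type*} [Field F] [Field E] [Algebra F E] [ValuativeRel E] [TopologicalSpace E]
  [IsNonarchimedeanLocalField E] (σ : E ≃ₐ[F] E)

/-- The principal congruence subgroup of level `n`; for `n = 0`, the group of integral elements. -/
def congruence (n : ℕ) : Subgroup (G σ) where
  carrier := {g | ∀ i j, normAbs E (entry σ g i j - entry σ 1 i j) ≤ unifAbs E ^ n ∧
    normAbs E (entry σ g⁻¹ i j - entry σ 1 i j) ≤ unifAbs E ^ n}
  one_mem' := fun i j => by simp
  mul_mem' := by
    have key : ∀ a b : G σ,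
        (∀ i j, normAbs E (entry σ a i j - entry σ 1 i j) ≤ unifAbs E ^ n) →
        (∀ i j, normAbs E (entry σ b i j - entry σ 1 i j) ≤ unifAbs E ^ n) → ∀ i j,
        normAbs E (entry σ (a * b) i j - entry σ 1 i j) ≤ unifAbs E ^ n := by
      intro a b ha hb i j
      have h1 : entry σ (a * b) i j - entry σ 1 i j =
          ∑ k, (entry σ a i k - entry σ 1 i k) * (entry σ b k j - entry σ 1 k j) +
          (entry σ a i j - entry σ 1 i j) + (entry σ b i j - entry σ 1 i j) := by
        rw [entry_mul]
        simp only [entry_one, sub_mul, mul_sub, Finset.sum_sub_distrib]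
        simp
      rw [h1]
      refine normAbs_add_le_of_le (normAbs_add_le_of_le ?_ (ha i j)) (hb i j)
      have h2 : ∀ k, normAbs E ((entry σ a i k - entry σ 1 i k) *
          (entry σ b k j - entry σ 1 k j)) ≤ unifAbs E ^ n := fun k => by
        rw [map_mul]
        exact (mul_le_mul' (ha i k) ((hb k j).trans (pow_le_one₀ zero_le
          (unifAbs_lt_one E).le))).trans_eq (mul_one _)
      rw [Fin.sum_univ_three]
      exact normAbs_add_le_of_le (normAbs_add_le_of_le (h2 0) (h2 1)) (h2 2)
    intro a b ha hb i j
    refine ⟨key a b (fun i j => (ha i j).1) (fun i j => (hb i j).1) i j, ?_⟩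
    rw [mul_inv_rev]
    exact key _ _ (fun i j => (hb i j).2) (fun i j => (ha i j).2) i j
  inv_mem' := fun {a} ha i j => ⟨(ha i j).2, by rw [inv_inv]; exact (ha i j).1⟩

lemma mem_congruence_zero_iff {g : G σ} : g ∈ congruence σ 0 ↔
    ∀ i j, normAbs E (entry σ g i j) ≤ 1 ∧ normAbs E (entry σ g⁻¹ i j) ≤ 1 := by
  have h1 : ∀ i j, normAbs E (entry σ 1 i j) ≤ 1 := fun i j => by
    rw [entry_one]
    split_ifs <;> simp
  have h2 : ∀ (x : E) i j, normAbs E (x - entry σ 1 i j) ≤ 1 ↔ normAbs E x ≤ 1 := fun x i j =>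
    ⟨fun h => by simpa using normAbs_add_le_of_le h (h1 i j), fun h => normAbs_sub_le_of_le h (h1 i j)⟩
  change (∀ i j, _ ≤ unifAbs E ^ 0 ∧ _ ≤ unifAbs E ^ 0) ↔ _
  simp only [pow_zero, h2]

lemma congruence_anti {m n : ℕ} (h : m ≤ n) : congruence σ n ≤ congruence σ m := fun _ hg i j =>
  have := pow_le_pow_right_of_le_one' (unifAbs_lt_one E).le h
  ⟨(hg i j).1.trans this, (hg i j).2.trans this⟩

lemma conj_mem_congruence {n : ℕ} {k c : G σ} (hk : k ∈ congruence σ 0) (hc : c ∈ congruence σ n) :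
    k * c * k⁻¹ ∈ congruence σ n := by
  have hk' := (mem_congruence_zero_iff σ).1 hk
  have key : ∀ c : G σ, (∀ i j, normAbs E (entry σ c i j - entry σ 1 i j) ≤ unifAbs E ^ n) →
      ∀ i j, normAbs E (entry σ (k * c * k⁻¹) i j - entry σ 1 i j) ≤ unifAbs E ^ n := by
    intro c hc i j
    have h1 : entry σ (k * c * k⁻¹) i j - entry σ 1 i j =
        ∑ m, (∑ l, entry σ k i l * (entry σ c l m - entry σ 1 l m)) * entry σ k⁻¹ m j := by
      have h2 : entry σ 1 i j = ∑ m, entry σ k i m * entry σ k⁻¹ m j := by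
        rw [← entry_mul, mul_inv_cancel]
      rw [h2, entry_mul, ← Finset.sum_sub_distrib]
      refine Finset.sum_congr rfl fun m _ => ?_
      rw [entry_mul]
      simp only [entry_one, mul_sub, Finset.sum_sub_distrib]
      simp [sub_mul]
    have h3 : ∀ l m, normAbs E (entry σ k i l * (entry σ c l m - entry σ 1 l m)) ≤ unifAbs E ^ n :=
      fun l m => by
        rw [map_mul]
        exact (mul_le_mul' (hk' i l).1 (hc l m)).trans_eq (one_mul _)
    have h4 : ∀ m, normAbs E ((∑ l, entry σ k i l * (entry σ c l m - entry σ 1 l m)) *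
        entry σ k⁻¹ m j) ≤ unifAbs E ^ n := fun m => by
      rw [map_mul]
      refine (mul_le_mul' ?_ (hk' m j).2).trans_eq (mul_one _)
      rw [Fin.sum_univ_three]
      exact normAbs_add_le_of_le (normAbs_add_le_of_le (h3 0 m) (h3 1 m)) (h3 2 m)
    rw [h1, Fin.sum_univ_three]
    exact normAbs_add_le_of_le (normAbs_add_le_of_le (h4 0) (h4 1)) (h4 2)
  intro i j
  refine ⟨key c (fun i j => (hc i j).1) i j, ?_⟩
  have h5 : (k * c * k⁻¹)⁻¹ = k * c⁻¹ * k⁻¹ := by group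
  rw [h5]
  exact key c⁻¹ (fun i j => (hc i j).2) i j

omit [ValuativeRel E] [IsNonarchimedeanLocalField E] in
lemma continuous_entry (i j : Fin 3) : Continuous fun g : G σ => entry σ g i j :=
  (Units.continuous_val.comp continuous_subtype_val).matrix_elem i j

lemma isOpen_congruence (n : ℕ) : IsOpen (congruence σ n : Set (G σ)) := by
  have h : (congruence σ n : Set (G σ)) = ⋂ i, ⋂ j,
      ({g | normAbs E (entry σ g i j - entry σ 1 i j) ≤ unifAbs E ^ n} ∩
       {g | normAbs E (entry σ g⁻¹ i j - entry σ 1 i j) ≤ unifAbs E ^ n}) := by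
    ext g
    simp only [Set.mem_iInter]
    rfl
  rw [h]
  have hpos := pow_pos (unifAbs_pos E) n
  refine isOpen_iInter_of_finite fun i => isOpen_iInter_of_finite fun j => IsOpen.inter ?_ ?_
  · exact (isOpen_normAbs_le hpos).preimage ((continuous_entry σ i j).sub continuous_const)
  · exact (isOpen_normAbs_le hpos).preimage
      (((continuous_entry σ i j).comp continuous_inv).sub continuous_const)

open Filter in
-- The topology of G comes from the embedding g ↦ (g, g⁻¹) into pairs of matrices, so both
-- components have to be controlled. This is why the definition of `congruence` also constrains g⁻¹.
lemma exists_congruence_subset {s : Set (G σ)} (hs : s ∈ nhds 1) :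
    ∃ n, (congruence σ n : Set (G σ)) ⊆ s := by
  have hle : (⨅ n, 𝓟 (congruence σ n : Set (G σ))) ≤ nhds 1 := by
    have hent : ∀ (i j : Fin 3) (t : Set E), t ∈ nhds (entry σ 1 i j) →
        ∃ n, ∀ g ∈ congruence σ n, entry σ g i j ∈ t ∧ entry σ g⁻¹ i j ∈ t := by
      intro i j t ht
      obtain ⟨n, hn⟩ := exists_normAbs_le_subset ht
      exact ⟨n, fun g hg => ⟨hn _ (hg i j).1, hn _ (hg i j).2⟩⟩
    have hval : Tendsto (fun g : G σ => g.val.val) (⨅ n, 𝓟 (congruence σ n : Set (G σ)))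
        (nhds 1) := by
      refine tendsto_pi_nhds.2 fun i => tendsto_pi_nhds.2 fun j t ht => ?_
      obtain ⟨n, hn⟩ := hent i j t ht
      exact mem_map.2 (mem_of_superset (mem_iInf_of_mem n (mem_principal_self _))
        fun g hg => (hn g hg).1)
    have hinv : Tendsto (fun g : G σ => (g⁻¹).val.val) (⨅ n, 𝓟 (congruence σ n : Set (G σ)))
        (nhds 1) := by
      refine tendsto_pi_nhds.2 fun i => tendsto_pi_nhds.2 fun j t ht => ?_
      obtain ⟨n, hn⟩ := hent i j t ht
      exact mem_map.2 (mem_of_superset (mem_iInf_of_mem n (mem_principal_self _))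
        fun g hg => (hn g hg).2)
    rw [Topology.IsInducing.subtypeVal.nhds_eq_comap, Units.isInducing_embedProduct.nhds_eq_comap,
      Filter.comap_comap, ← tendsto_iff_comap]
    exact hval.prodMk_nhds ((MulOpposite.continuous_op.tendsto _).comp hinv)
  have := hle hs
  rw [mem_iInf_of_directed] at this
  · obtain ⟨n, hn⟩ := this
    exact ⟨n, hn⟩
  · intro m n
    refine ⟨max m n, ?_, ?_⟩
    · exact principal_mono.2 (congruence_anti σ (le_max_left _ _))
    · exact principal_mono.2 (congruence_anti σ (le_max_right _ _))

/-- A right-invariant function under a congruence subgroup is locally constant. -/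
lemma isLocallyConstant_of_congruence {f : G σ → ℂ} (n : ℕ)
    (h : ∀ g, ∀ k ∈ congruence σ n, f (g * k) = f g) : IsLocallyConstant f := by
  rw [IsLocallyConstant.iff_eventually_eq]
  intro g
  have h1 : (fun x => g⁻¹ * x) ⁻¹' (congruence σ n) ∈ nhds g := by
    refine ((isOpen_congruence σ n).preimage (continuous_const_mul _)).mem_nhds ?_
    simp [one_mem]
  filter_upwards [h1] with x hx
  have := h g _ hx
  rwa [mul_inv_cancel_left] at this

end Congruence

/-! ### Compactness of the group of integral elements. -/

section Compact

variable {F E : Type*} [Field F] [ValuativeRel F] [TopologicalSpace F]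
  [IsNonarchimedeanLocalField F]
  [Field E] [ValuativeRel E] [TopologicalSpace E] [IsNonarchimedeanLocalField E]
  [Algebra F E] {σ : E ≃ₐ[F] E} {ϖ : F} (hU : Unramified σ ϖ)

include hU

lemma Unramified.mem_congruence_zero {g : G σ} :
    g ∈ congruence σ 0 ↔ ∀ i j, normAbs E (entry σ g i j) ≤ 1 := by
  rw [mem_congruence_zero_iff]
  refine ⟨fun h i j => (h i j).1, fun h i j => ⟨h i j, ?_⟩⟩
  rw [entry_inv, hU.normAbs_conj]
  exact h _ _

lemma Unramified.continuous_conj : Continuous σ := by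
  refine continuous_of_continuousAt_zero σ ?_
  intro s hs
  rw [map_zero] at hs
  obtain ⟨n, hn⟩ := exists_normAbs_le_subset hs
  have h0 : {x : E | normAbs E x ≤ unifAbs E ^ n} ∈ nhds 0 :=
    (isOpen_normAbs_le (pow_pos (unifAbs_pos E) n)).mem_nhds (by simp)
  refine Filter.mem_map.2 (Filter.mem_of_superset h0 fun x hx => hn _ ?_)
  · rw [sub_zero, hU.normAbs_conj]
    exact hx

omit hU in
variable (E) in
lemma t2Space_of_isNonarchimedeanLocalField : T2Space E := by
  have : T1Space E := by
    refine t1Space_iff_exists_open.2 fun x y hxy => ?_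
    have hpos : 0 < normAbs E (y - x) := normAbs_pos.2 (sub_ne_zero.2 hxy.symm)
    refine ⟨(fun z => z - x) ⁻¹' {z : E | normAbs E z ≤ unifAbs E * normAbs E (y - x)},
      (isOpen_normAbs_le (mul_pos (unifAbs_pos E) hpos)).preimage (continuous_id.sub continuous_const),
      by simp, fun h => ?_⟩
    exact (mul_lt_of_lt_one_left hpos (unifAbs_lt_one E)).not_ge h
  infer_instance

/-- Under the closed embedding g ↦ (g, g⁻¹) of G into pairs of matrices, integral elements land in a
product of compact sets of integral matrices. G is closed in GL₃(E) because σ is continuous. -/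
lemma Unramified.isCompact_congruence_zero : IsCompact (congruence σ 0 : Set (G σ)) := by
  have hT := t2Space_of_isNonarchimedeanLocalField E
  have hT1 : T1Space (Matrix (Fin 3) (Fin 3) E) := inferInstance
  have hG : IsClosed (G σ : Set (GL (Fin 3) E)) := by
    have hc : Continuous fun g : GL (Fin 3) E => conjT σ g.val * J E * g.val := by
      have h1 : Continuous fun g : GL (Fin 3) E => g.val := Units.continuous_val
      have h2 : Continuous fun g : GL (Fin 3) E => conjT σ g.val :=
        (h1.matrix_map hU.continuous_conj).matrix_transpose
      fun_prop
    exact isClosed_singleton.preimage hc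
  have he0 : Topology.IsClosedEmbedding (Units.embedProduct (Matrix (Fin 3) (Fin 3) E)) :=
    Units.isClosedEmbedding_embedProduct
  have he := he0.comp hG.isClosedEmbedding_subtypeVal
  have hM : IsCompact {A : Matrix (Fin 3) (Fin 3) E | ∀ i j, normAbs E (A i j) ≤ 1} := by
    have := isCompact_univ_pi fun _ : Fin 3 => isCompact_univ_pi fun _ : Fin 3 =>
      isCompact_normAbs_le_one E
    have heq : {A : Matrix (Fin 3) (Fin 3) E | ∀ i j, normAbs E (A i j) ≤ 1} =
        Set.univ.pi fun _ : Fin 3 => Set.univ.pi fun _ : Fin 3 => {x : E | normAbs E x ≤ 1} := by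
      ext A
      exact ⟨fun h i _ j _ => h i j, fun h i j => h i trivial j trivial⟩
    rw [heq]
    exact this
  have hM' := hM.prod (MulOpposite.opHomeomorph.isCompact_image.2 hM)
  refine (he.isCompact_preimage hM').of_isClosed_subset
    ((congruence σ 0).isClosed_of_isOpen (isOpen_congruence σ 0)) fun g hg => ?_
  have h := (mem_congruence_zero_iff σ).1 hg
  exact ⟨fun i j => (h i j).1, _, fun i j => (h i j).2, rfl⟩

end Compact

end U3

end

noncomputable section

namespace U3

/-! ### Some elements of the unitary group -/

section Elements

variable {F E : Type*} [Field F] [Field E] [Algebra F E] {σ : E ≃ₐ[F] E}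

/-- The lower triangular unipotent elements `(1, 0, 0; x, 1, 0; y, -σ x, 1)`. -/
def lower (hσ : ∀ z, σ (σ z) = z) (x y : E) (h : y + σ y + x * σ x = 0) : G σ :=
  mkG σ !![1, 0, 0; x, 1, 0; y, -σ x, 1] (by
    ext i j
    fin_cases i <;> fin_cases j <;>
      simp [conjT, J, Matrix.mul_apply, Fin.sum_univ_three, hσ]
    linear_combination h)

/-- The elements `diag (a, 1, (σ a)⁻¹)`. -/
def torus (hσ : ∀ z, σ (σ z) = z) (a : E) (ha : a ≠ 0) : G σ :=
  mkG σ !![a, 0, 0; 0, 1, 0; 0, 0, (σ a)⁻¹] (by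
    have : σ a ≠ 0 := (map_ne_zero σ).2 ha
    ext i j
    fin_cases i <;> fin_cases j <;>
      simp [conjT, J, Matrix.mul_apply, Fin.sum_univ_three, hσ, ha, this])

variable (σ) in
/-- The elements `(0, 0, c⁻¹; 0, 1, 0; c, 0, 0)`. -/
def flip (c : F) (hc : c ≠ 0) : G σ :=
  mkG σ !![0, 0, algebraMap F E c⁻¹; 0, 1, 0; algebraMap F E c, 0, 0] (by
    ext i j
    fin_cases i <;> fin_cases j <;>
      simp [conjT, J, Matrix.mul_apply, Fin.sum_univ_three, hc])

variable (hσ : ∀ z, σ (σ z) = z) (g : G σ)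

lemma entry_mul_lower (x y : E) (h : y + σ y + x * σ x = 0) (i : Fin 3) :
    entry σ (g * lower hσ x y h) i 0 = entry σ g i 0 + entry σ g i 1 * x + entry σ g i 2 * y ∧
    entry σ (g * lower hσ x y h) i 1 = entry σ g i 1 - entry σ g i 2 * σ x ∧
    entry σ (g * lower hσ x y h) i 2 = entry σ g i 2 := by
  refine ⟨?_, ?_, ?_⟩ <;> rw [entry_mul, Fin.sum_univ_three] <;> simp [lower, entry_mkG] <;> ring

lemma entry_mul_torus (a : E) (ha : a ≠ 0) (i : Fin 3) :
    entry σ (g * torus hσ a ha) i 0 = entry σ g i 0 * a ∧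
    entry σ (g * torus hσ a ha) i 1 = entry σ g i 1 ∧
    entry σ (g * torus hσ a ha) i 2 = entry σ g i 2 * (σ a)⁻¹ := by
  refine ⟨?_, ?_, ?_⟩ <;> rw [entry_mul, Fin.sum_univ_three] <;> simp [torus, entry_mkG]

lemma entry_mul_flip (c : F) (hc : c ≠ 0) (i : Fin 3) :
    entry σ (g * flip σ c hc) i 0 = entry σ g i 2 * algebraMap F E c ∧
    entry σ (g * flip σ c hc) i 1 = entry σ g i 1 ∧
    entry σ (g * flip σ c hc) i 2 = entry σ g i 0 * algebraMap F E c⁻¹ := by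
  refine ⟨?_, ?_, ?_⟩ <;> rw [entry_mul, Fin.sum_univ_three] <;> simp [flip, entry_mkG]

lemma flip_mul_flip (c : F) (hc : c ≠ 0) : flip σ c hc * flip σ c hc = 1 := by
  refine G_ext fun i j => ?_
  obtain ⟨h0, h1, h2⟩ := entry_mul_flip (flip σ c hc) c hc i
  fin_cases j
  · refine h0.trans ?_
    fin_cases i <;> simp [flip, entry_mkG, entry_one, hc]
  · refine h1.trans ?_
    fin_cases i <;> simp [flip, entry_mkG, entry_one]
  · refine h2.trans ?_
    fin_cases i <;> simp [flip, entry_mkG, entry_one, hc]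

end Elements

/-! ### The induced representation in terms of bottom rows -/

section Rows

variable {F E : Type*} [Field F] [ValuativeRel F] [TopologicalSpace F]
  [IsNonarchimedeanLocalField F]
  [Field E] [ValuativeRel E] [TopologicalSpace E] [IsNonarchimedeanLocalField E]
  [Algebra F E] {σ : E ≃ₐ[F] E} {ϖ : F} (hU : Unramified σ ϖ)

omit [ValuativeRel F] [TopologicalSpace F] [IsNonarchimedeanLocalField F] in
lemma indRep_apply (g x : G σ) (f : Ind (stChar σ)) : (indRep (stChar σ) g f).val x = f.val (x * g) :=
  rfl

omit [ValuativeRel F] [TopologicalSpace F] [IsNonarchimedeanLocalField F] in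
-- One factor |a| comes from the normalization and one from the character |·|_E ⊗ 1. The total is
-- δ_B itself, which is what makes an invariant functional possible.
lemma sqrt_modulusB_mul_stChar (b : B σ) : (Real.sqrt (modulusB σ b) : ℂ) * (stChar σ b : ℂ) =
    ((normAbs E (entry σ b.val 0 0) ^ 2 : ℝ≥0) : ℂ) := by
  have h1 : Real.sqrt (modulusB σ b) = (normAbs E (entry σ b.val 0 0) : ℝ) := by
    rw [modulusB]
    exact Real.sqrt_sq (NNReal.coe_nonneg _)
  have h2 : (stChar σ b : ℂ) = (((normAbs E (entry σ b.val 0 0) : ℝ≥0) : ℝ) : ℂ) := by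
    simp [stChar, tensorChar]
    rfl
  rw [h1, h2]
  push_cast
  ring

include hU

lemma Unramified.normAbs_entry_diag {b : G σ} (hb : b ∈ B σ) :
    normAbs E (entry σ b 0 0) = (normAbs E (entry σ b 2 2))⁻¹ := by
  have := congrArg (normAbs E) (entry_diag_conj σ hb)
  rw [map_mul, map_one, hU.normAbs_conj] at this
  exact eq_inv_of_mul_eq_one_left this

/-- The degree is -2 because the outer diagonal entries a, d of an element of B satisfy |a| = |d|⁻¹.
-/
lemma Unramified.apply_eq_of_row (f : Ind (stChar σ)) {g g' : G σ} {l : E}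
    (h : ∀ j, entry σ g 2 j = l * entry σ g' 2 j) :
    f.val g = (((normAbs E l ^ 2)⁻¹ : ℝ≥0) : ℂ) * f.val g' := by
  obtain ⟨h1, h2⟩ := mul_inv_mem_B σ h
  have := f.2.2 ⟨_, h1⟩ g'
  rw [sqrt_modulusB_mul_stChar] at this
  simp only [inv_mul_cancel_right] at this
  rw [this, hU.normAbs_entry_diag h1, h2, inv_pow]

/-- A function of the bottom row, homogeneous of degree `-2`, as an element of the induced
representation. -/
def Unramified.ofRow (φ : E → E → E → ℝ≥0)
    (hφ : ∀ l x y z, l ≠ 0 → φ (l * x) (l * y) (l * z) = (normAbs E l ^ 2)⁻¹ * φ x y z) (n : ℕ)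
    (hn : ∀ g : G σ, ∀ k ∈ congruence σ n,
      φ (entry σ (g * k) 2 0) (entry σ (g * k) 2 1) (entry σ (g * k) 2 2) =
      φ (entry σ g 2 0) (entry σ g 2 1) (entry σ g 2 2)) : Ind (stChar σ) :=
  ⟨fun g => (φ (entry σ g 2 0) (entry σ g 2 1) (entry σ g 2 2) : ℂ),
    isLocallyConstant_of_congruence σ n fun g k hk => by simp only [hn g k hk], fun b g => by
      rw [sqrt_modulusB_mul_stChar]
      have hrow : ∀ j, entry σ (b.val * g) 2 j = entry σ b.val 2 2 * entry σ g 2 j := by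
        intro j
        rw [entry_mul, Fin.sum_univ_three, b.2 2 0 (by decide), b.2 2 1 (by decide)]
        ring
      have hl : entry σ b.val 2 2 ≠ 0 := fun h => by
        have := entry_diag_conj σ b.2
        rw [h, mul_zero] at this
        exact zero_ne_one this
      simp only [hrow]
      rw [hφ _ _ _ _ hl, hU.normAbs_entry_diag b.2, inv_pow]
      push_cast
      rfl⟩

/-- Isotropy expresses the norm of y as minus the trace of x z̄. So the middle entry is controlled
by the outer two. -/
lemma Unramified.normAbs_row_sq_le (g : G σ) :
    normAbs E (entry σ g 2 1) ^ 2 ≤ normAbs E (entry σ g 2 0) * normAbs E (entry σ g 2 2) := by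
  have h := row_isotropic σ g
  have h1 : entry σ g 2 1 * σ (entry σ g 2 1) = -(entry σ g 2 0 * σ (entry σ g 2 2)) -
      entry σ g 2 2 * σ (entry σ g 2 0) := by linear_combination h
  have h2 := congrArg (normAbs E) h1
  rw [map_mul, hU.normAbs_conj, ← sq] at h2
  rw [h2]
  refine normAbs_sub_le_of_le ?_ ?_
  · rw [normAbs_neg, map_mul, hU.normAbs_conj]
  · rw [map_mul, hU.normAbs_conj, mul_comm]

lemma Unramified.normAbs_row_le (g : G σ) {a b : ℝ≥0} (h0 : normAbs E (entry σ g 2 0) ≤ a * b)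
    (h2 : normAbs E (entry σ g 2 2) ≤ b) {c : ℝ≥0} (hc : a ≤ c ^ 2) :
    normAbs E (entry σ g 2 1) ≤ c * b := by
  refine (pow_le_pow_iff_left₀ zero_le zero_le two_ne_zero).1
    ((hU.normAbs_row_sq_le g).trans ((mul_le_mul' h0 h2).trans ?_))
  calc a * b * b ≤ c ^ 2 * b * b := by gcongr
    _ = _ := by ring

omit hU in
/-- The maximum of the absolute values of the entries of the bottom row. -/
def rowAbs (g : G σ) : ℝ≥0 := max (normAbs E (entry σ g 2 0)) (normAbs E (entry σ g 2 2))

lemma Unramified.normAbs_entry_le_rowAbs (g : G σ) (j : Fin 3) :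
    normAbs E (entry σ g 2 j) ≤ rowAbs g := by
  have h1 : normAbs E (entry σ g 2 1) ≤ rowAbs g := by
    have := hU.normAbs_row_le g (a := 1) (b := rowAbs g) (c := 1)
      (by rw [one_mul]; exact le_max_left _ _) (le_max_right _ _) (by simp)
    rwa [one_mul] at this
  fin_cases j
  · exact le_max_left _ _
  · exact h1
  · exact le_max_right _ _

lemma Unramified.rowAbs_pos (g : G σ) : 0 < rowAbs g := by
  by_contra h
  have h0 : ∀ j, entry σ g 2 j = 0 := fun j => normAbs_eq_zero.1
    (le_antisymm ((hU.normAbs_entry_le_rowAbs g j).trans (not_lt.1 h)) zero_le)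
  exact row_ne_zero σ g ⟨h0 0, h0 1, h0 2⟩

lemma Unramified.normAbs_entry_mul_le (g : G σ) {k : G σ} (hk : k ∈ congruence σ 0) (j : Fin 3) :
    normAbs E (entry σ (g * k) 2 j) ≤ rowAbs g := by
  have hk := hU.mem_congruence_zero.1 hk
  have key : ∀ l, normAbs E (entry σ g 2 l * entry σ k l j) ≤ rowAbs g := fun l => by
    rw [map_mul]
    exact (mul_le_mul' (hU.normAbs_entry_le_rowAbs g l) (hk l j)).trans_eq (mul_one _)
  rw [entry_mul, Fin.sum_univ_three]
  exact normAbs_add_le_of_le (normAbs_add_le_of_le (key 0) (key 1)) (key 2)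

lemma Unramified.rowAbs_mul (g : G σ) {k : G σ} (hk : k ∈ congruence σ 0) :
    rowAbs (g * k) = rowAbs g := by
  have key : ∀ (g : G σ) {k : G σ}, k ∈ congruence σ 0 → rowAbs (g * k) ≤ rowAbs g :=
    fun g k hk => max_le (hU.normAbs_entry_mul_le g hk 0) (hU.normAbs_entry_mul_le g hk 2)
  refine le_antisymm (key g hk) ?_
  have := key (g * k) (inv_mem hk)
  rwa [mul_inv_cancel_right] at this

lemma Unramified.normAbs_entry_mul_sub_le (g : G σ) {n : ℕ} {k : G σ} (hk : k ∈ congruence σ n)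
    (j : Fin 3) :
    normAbs E (entry σ (g * k) 2 j - entry σ g 2 j) ≤ unifAbs E ^ n * rowAbs g := by
  have h1 : entry σ (g * k) 2 j - entry σ g 2 j =
      ∑ l, entry σ g 2 l * (entry σ k l j - entry σ 1 l j) := by
    rw [entry_mul]
    simp only [mul_sub, Finset.sum_sub_distrib, entry_one]
    simp
  have key : ∀ l, normAbs E (entry σ g 2 l * (entry σ k l j - entry σ 1 l j)) ≤
      unifAbs E ^ n * rowAbs g := fun l => by
    rw [map_mul, mul_comm]
    exact mul_le_mul' (hk l j).1 (hU.normAbs_entry_le_rowAbs g l)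
  rw [h1, Fin.sum_univ_three]
  exact normAbs_add_le_of_le (normAbs_add_le_of_le (key 0) (key 1)) (key 2)

/-- The spherical vector. -/
def Unramified.sph : Ind (stChar σ) :=
  hU.ofRow (fun x _ z => (max (normAbs E x) (normAbs E z) ^ 2)⁻¹) (fun l x _ z _ => by
    rw [map_mul, map_mul, ← mul_max_of_nonneg _ _ zero_le, mul_pow, mul_inv]) 0 (fun g k hk => by
    have := hU.rowAbs_mul g hk
    dsimp only [rowAbs] at this ⊢
    rw [this])

lemma Unramified.sph_apply (g : G σ) : hU.sph.val g = (((rowAbs g ^ 2)⁻¹ : ℝ≥0) : ℂ) := rfl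

/-- The condition that the bottom row lies in a box around the last basis vector. -/
def box (i j : ℕ) (x y z : E) : Prop :=
  normAbs E y ≤ unifAbs E ^ i * normAbs E z ∧ normAbs E x ≤ unifAbs E ^ j * normAbs E z

open Classical in
/-- The function supported on the elements with bottom row in a box. -/
def Unramified.boxFun (i j : ℕ) : Ind (stChar σ) :=
  hU.ofRow (fun x y z => if box i j x y z then (normAbs E z ^ 2)⁻¹ else 0) (fun l x y z hl => by
    have hl' := normAbs_pos.2 hl
    have : box i j (l * x) (l * y) (l * z) ↔ box i j x y z := by
      simp only [box, map_mul, mul_left_comm _ (normAbs E l), mul_le_mul_iff_right₀ hl']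
    simp only [this]
    split_ifs
    · rw [map_mul, mul_pow, mul_inv]
    · rw [mul_zero]) (i + j + 1) (fun g k hk => by
    -- The level i + j + 1 is a crude choice: it is at least i and j, so the two inequalities
    -- survive, and it is positive, so |z| does not change.
    have key : ∀ (g : G σ) {k : G σ}, k ∈ congruence σ (i + j + 1) →
        box i j (entry σ g 2 0) (entry σ g 2 1) (entry σ g 2 2) →
        box i j (entry σ (g * k) 2 0) (entry σ (g * k) 2 1) (entry σ (g * k) 2 2) ∧
        normAbs E (entry σ (g * k) 2 2) = normAbs E (entry σ g 2 2) := by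
      intro g k hk hg
      have hr : rowAbs g = normAbs E (entry σ g 2 2) :=
        max_eq_right (hg.2.trans (mul_le_of_le_one_left zero_le
          (pow_le_one₀ zero_le (unifAbs_lt_one E).le)))
      have h := fun l => hU.normAbs_entry_mul_sub_le g hk l
      rw [hr] at h
      have hpos := hU.rowAbs_pos g
      rw [hr] at hpos
      have h2 : normAbs E (entry σ (g * k) 2 2) = normAbs E (entry σ g 2 2) :=
        normAbs_eq_of_sub_lt ((h 2).trans_lt (mul_lt_of_lt_one_left hpos
          (pow_lt_one₀ zero_le (unifAbs_lt_one E) (by lia))))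
      have hle : ∀ m ≤ i + j + 1, unifAbs E ^ (i + j + 1) ≤ unifAbs E ^ m := fun m hm =>
        pow_le_pow_right_of_le_one' (unifAbs_lt_one E).le hm
      have aux : ∀ l, ∀ m ≤ i + j + 1, normAbs E (entry σ g 2 l) ≤
          unifAbs E ^ m * normAbs E (entry σ g 2 2) → normAbs E (entry σ (g * k) 2 l) ≤
          unifAbs E ^ m * normAbs E (entry σ g 2 2) := by
        intro l m hm hl
        have := normAbs_add_le_of_le ((h l).trans (mul_le_mul_left (hle m hm) _)) hl
        rwa [sub_add_cancel] at this
      refine ⟨⟨?_, ?_⟩, h2⟩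
      · rw [h2]; exact aux 1 i (by lia) hg.1
      · rw [h2]; exact aux 0 j (by lia) hg.2
    have hiff : box i j (entry σ (g * k) 2 0) (entry σ (g * k) 2 1) (entry σ (g * k) 2 2) ↔
        box i j (entry σ g 2 0) (entry σ g 2 1) (entry σ g 2 2) := by
      refine ⟨fun h => ?_, fun h => (key g hk h).1⟩
      have := (key (g * k) (inv_mem hk) h).1
      rwa [mul_inv_cancel_right] at this
    by_cases h : box i j (entry σ g 2 0) (entry σ g 2 1) (entry σ g 2 2)
    · rw [if_pos h, if_pos (hiff.2 h), (key g hk h).2]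
    · rw [if_neg h, if_neg (mt hiff.1 h)])

open Classical in
lemma Unramified.boxFun_apply (i j : ℕ) (g : G σ) : (hU.boxFun i j).val g =
    ((if box i j (entry σ g 2 0) (entry σ g 2 1) (entry σ g 2 2) then
      (normAbs E (entry σ g 2 2) ^ 2)⁻¹ else 0 : ℝ≥0) : ℂ) := rfl

lemma Unramified.boxFun_apply_pos {i j : ℕ} {g : G σ}
    (h : box i j (entry σ g 2 0) (entry σ g 2 1) (entry σ g 2 2)) : (hU.boxFun i j).val g =
    (((normAbs E (entry σ g 2 2) ^ 2)⁻¹ : ℝ≥0) : ℂ) := by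
  rw [hU.boxFun_apply, if_pos h]

lemma Unramified.boxFun_apply_neg {i j : ℕ} {g : G σ}
    (h : ¬ box i j (entry σ g 2 0) (entry σ g 2 1) (entry σ g 2 2)) : (hU.boxFun i j).val g = 0 := by
  rw [hU.boxFun_apply, if_neg h, NNReal.coe_zero, Complex.ofReal_zero]

lemma Unramified.boxFun_ne_zero_iff {i j : ℕ} {g : G σ} : (hU.boxFun i j).val g ≠ 0 ↔
    box i j (entry σ g 2 0) (entry σ g 2 1) (entry σ g 2 2) := by
  refine ⟨fun h => by_contra fun h' => h (hU.boxFun_apply_neg h'), fun h => ?_⟩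
  rw [hU.boxFun_apply_pos h]
  have hz : normAbs E (entry σ g 2 2) ≠ 0 := by
    intro h0
    have h1 := h.1
    have h2 := h.2
    rw [h0, mul_zero, nonpos_iff_eq_zero, normAbs_eq_zero] at h1 h2
    exact row_ne_zero σ g ⟨h2, h1, normAbs_eq_zero.1 h0⟩
  simpa using hz

/-- The ball of level `n` around the last basis vector is a box. -/
lemma Unramified.box_iff {i j : ℕ} (h' : 2 * i ≤ j + 1) (g : G σ) :
    box i j (entry σ g 2 0) (entry σ g 2 1) (entry σ g 2 2) ↔
      normAbs E (entry σ g 2 0) ≤ unifAbs E ^ j * normAbs E (entry σ g 2 2) := by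
  refine ⟨fun h => h.2, fun h1 => ⟨?_, h1⟩⟩
  by_cases hx : entry σ g 2 1 = 0
  · rw [hx, map_zero]; exact zero_le
  have hz : entry σ g 2 2 ≠ 0 := fun hz => by
    have := hU.normAbs_row_sq_le g
    rw [hz, map_zero, mul_zero, nonpos_iff_eq_zero, pow_eq_zero_iff two_ne_zero,
      normAbs_eq_zero] at this
    exact hx this
  -- In exponents, isotropy bounds the valuation of y/z below by j/2. Valuations being integers, it
  -- is at least ⌈j/2⌉, and 2 i ≤ j + 1 says that i ≤ ⌈j/2⌉.
  obtain ⟨a, ha⟩ := normAbs_eq_zpow hx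
  obtain ⟨b, hb⟩ := normAbs_eq_zpow hz
  have h2 := (hU.normAbs_row_sq_le g).trans (mul_le_mul_left h1 _)
  have hu : ∀ m : ℕ, unifAbs E ^ m = (resCard E : ℝ≥0) ^ (-(m : ℤ)) := fun m => by
    rw [unifAbs, inv_pow, zpow_neg, zpow_natCast]
  rw [ha, hb, hu, ← zpow_natCast, ← zpow_mul, ← zpow_add₀ (resCard_ne_zero E),
    ← zpow_add₀ (resCard_ne_zero E), zpow_le_zpow_iff_right₀ (one_lt_resCard E)] at h2
  rw [ha, hb, hu, ← zpow_add₀ (resCard_ne_zero E), zpow_le_zpow_iff_right₀ (one_lt_resCard E)]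
  push_cast at h2
  lia

end Rows

end U3

end

noncomputable section

namespace U3

/-! ### Averages and the invariant functional of the maximal compact subgroup -/

section Average

variable {F E : Type*} [Field F] [ValuativeRel F] [TopologicalSpace F]
  [IsNonarchimedeanLocalField F]
  [Field E] [ValuativeRel E] [TopologicalSpace E] [IsNonarchimedeanLocalField E]
  [Algebra F E] {σ : E ≃ₐ[F] E} {ϖ : F} (hU : Unramified σ ϖ)

include hU

lemma Unramified.mem_congruence {n : ℕ} {g : G σ} : g ∈ congruence σ n ↔
    ∀ i j, normAbs E (entry σ g i j - entry σ 1 i j) ≤ unifAbs E ^ n := by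
  refine ⟨fun h i j => (h i j).1, fun h i j => ⟨h i j, ?_⟩⟩
  have h1 : entry σ g⁻¹ i j - entry σ 1 i j =
      σ (entry σ g j.rev i.rev - entry σ 1 j.rev i.rev) := by
    rw [entry_inv, map_sub]
    congr 1
    simp only [entry_one, Fin.rev_inj, apply_ite σ, map_one, map_zero, eq_comm (a := j)]
  rw [h1, hU.normAbs_conj]
  exact h _ _

lemma Unramified.lower_mem_congruence {n : ℕ} {x y : E} (h : y + σ y + x * σ x = 0)
    (hx : normAbs E x ≤ unifAbs E ^ n) (hy : normAbs E y ≤ unifAbs E ^ n) :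
    lower hU.conj_conj x y h ∈ congruence σ n := by
  rw [hU.mem_congruence]
  have hx' : normAbs E (σ x) ≤ unifAbs E ^ n := by rwa [hU.normAbs_conj]
  intro i j
  fin_cases i <;> fin_cases j <;> simp [lower, entry_mkG, entry_one, normAbs_neg, hx, hx', hy]

omit hU [IsNonarchimedeanLocalField F] [TopologicalSpace F] [ValuativeRel F] in
lemma flip_mem_congruence {c : F} (hc : c ≠ 0) (h1 : normAbs E (algebraMap F E c) = 1) :
    flip σ c hc ∈ congruence σ 0 := by
  have h : ∀ i j, normAbs E (entry σ (flip σ c hc) i j) ≤ 1 := by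
    intro i j
    fin_cases i <;> fin_cases j <;> simp [flip, entry_mkG, h1]
  rw [mem_congruence_zero_iff]
  refine fun i j => ⟨h i j, ?_⟩
  rw [inv_eq_of_mul_eq_one_left (flip_mul_flip c hc)]
  exact h i j

/-- An element of `G` whose bottom right entry is not zero lies in `B` times the lower triangular
unipotent group. -/
lemma Unramified.exists_lower {g : G σ} (hg : entry σ g 2 2 ≠ 0) :
    ∃ x y h, normAbs E x = normAbs E (entry σ g 2 1) / normAbs E (entry σ g 2 2) ∧
      normAbs E y = normAbs E (entry σ g 2 0) / normAbs E (entry σ g 2 2) ∧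
      (∀ j, entry σ g 2 j = entry σ g 2 2 * entry σ (lower hU.conj_conj x y h) 2 j) := by
  have hg' : σ (entry σ g 2 2) ≠ 0 := (map_ne_zero σ).2 hg
  have hi := row_isotropic σ g
  refine ⟨-σ (entry σ g 2 1 / entry σ g 2 2), entry σ g 2 0 / entry σ g 2 2, ?_, ?_, ?_, ?_⟩
  · simp only [map_neg, map_div₀, hU.conj_conj]
    field_simp
    linear_combination hi
  · rw [normAbs_neg, hU.normAbs_conj, map_div₀]
  · rw [map_div₀]
  · intro j
    fin_cases j <;> simp [lower, entry_mkG, hU.conj_conj] <;> field_simp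

/-- The Iwasawa decomposition. -/
lemma Unramified.iwasawa (g : G σ) : ∃ b ∈ B σ, ∃ k ∈ congruence σ 0, g = b * k := by
  have key : ∀ g : G σ, normAbs E (entry σ g 2 0) ≤ normAbs E (entry σ g 2 2) →
      ∃ b ∈ B σ, ∃ k ∈ congruence σ 0, g = b * k := by
    intro g hg
    have hr : rowAbs g = normAbs E (entry σ g 2 2) := max_eq_right hg
    have hpos := hU.rowAbs_pos g
    rw [hr] at hpos
    obtain ⟨x, y, h, hx, hy, hrow⟩ := hU.exists_lower (normAbs_pos.1 hpos)
    refine ⟨_, (mul_inv_mem_B σ hrow).1, lower hU.conj_conj x y h, ?_, by simp⟩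
    refine hU.lower_mem_congruence h ?_ ?_
    · rw [hx, pow_zero]
      exact div_le_one_of_le₀ (hr ▸ hU.normAbs_entry_le_rowAbs g 1) zero_le
    · rw [hy, pow_zero]
      exact div_le_one_of_le₀ hg zero_le
  rcases le_total (normAbs E (entry σ g 2 0)) (normAbs E (entry σ g 2 2)) with h | h
  · exact key g h
  · obtain ⟨b, hb, k, hk, hbk⟩ := key (g * flip σ 1 one_ne_zero) (by
      obtain ⟨h0, -, h2⟩ := entry_mul_flip g 1 one_ne_zero 2
      rw [h0, h2]
      simpa using h)
    refine ⟨b, hb, k * flip σ 1 one_ne_zero,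
      mul_mem hk (flip_mem_congruence one_ne_zero (by simp)), ?_⟩
    rw [← mul_assoc, ← hbk, mul_assoc, flip_mul_flip, mul_one]

lemma Unramified.ext_of_integral {f f' : Ind (stChar σ)}
    (h : ∀ k ∈ congruence σ 0, f.val k = f'.val k) : f = f' := by
  refine Subtype.ext (funext fun g => ?_)
  obtain ⟨b, hb, k, hk, rfl⟩ := hU.iwasawa g
  rw [f.2.2 ⟨b, hb⟩, f'.2.2 ⟨b, hb⟩, h k hk]

/-- The induced representation is smooth. -/
lemma Unramified.exists_fixed (f : Ind (stChar σ)) :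
    ∃ n, ∀ c ∈ congruence σ n, indRep (stChar σ) c f = f := by
  have h1 : ∀ x : G σ, ∃ n, ∀ c ∈ congruence σ n, f.val (x * c) = f.val x := by
    intro x
    have ho : IsOpen ((fun c => x * c) ⁻¹' {g | f.val g = f.val x}) :=
      (f.2.1.isOpen_fiber _).preimage (continuous_const_mul x)
    exact exists_congruence_subset σ (ho.mem_nhds (by simp))
  choose n hn using h1
  have hxU : ∀ x : G σ, (fun y => x⁻¹ * y) ⁻¹' (congruence σ (n x)) ∈ nhds x := fun x =>
    ((isOpen_congruence σ (n x)).preimage (continuous_const_mul _)).mem_nhds (by simp [one_mem])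
  obtain ⟨t, -, ht⟩ := hU.isCompact_congruence_zero.elim_nhds_subcover _ fun x _ => hxU x
  refine ⟨t.sup n, fun c hc => hU.ext_of_integral fun k hk => ?_⟩
  obtain ⟨x, hx, hkx⟩ := Set.mem_iUnion₂.1 (ht hk)
  have h2 : x⁻¹ * k ∈ congruence σ (n x) := hkx
  have h3 := hn x _ h2
  have h4 := hn x _ (mul_mem h2 (congruence_anti σ (Finset.le_sup (f := n) hx) hc))
  rw [mul_inv_cancel_left] at h3
  rw [← mul_assoc, mul_inv_cancel_left] at h4
  rw [indRep_apply, h4, h3]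

lemma Unramified.finite_quotient {H : Subgroup (G σ)} (hH : H ≤ congruence σ 0) (n : ℕ) :
    Finite (H ⧸ (congruence σ n).subgroupOf H) := by
  have hc := hU.isCompact_congruence_zero
  have : CompactSpace (congruence σ 0) := isCompact_iff_compactSpace.1 hc
  have hopen : IsOpen (((congruence σ n).subgroupOf (congruence σ 0) :
      Subgroup (congruence σ 0)) : Set (congruence σ 0)) :=
    (isOpen_congruence σ n).preimage continuous_subtype_val
  have hfin : Finite (congruence σ 0 ⧸ (congruence σ n).subgroupOf (congruence σ 0)) :=
    Subgroup.quotient_finite_of_isOpen _ hopen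
  have h1 : (congruence σ n).relIndex (congruence σ 0) ≠ 0 :=
    (Subgroup.finiteIndex_iff_finite_quotient.2 hfin).index_ne_zero
  have h2 : (congruence σ n).relIndex H ≠ 0 := fun h =>
    h1 (Subgroup.relIndex_eq_zero_of_le_right hH h)
  exact Subgroup.finiteIndex_iff_finite_quotient.1 ⟨h2⟩

/-- A function on a compact group that is right-invariant under an open subgroup is summed over
the cosets by a finite system of representatives, and these sums are left-invariant. -/
lemma Unramified.exists_sum_representatives {H : Subgroup (G σ)} (hH : H ≤ congruence σ 0) (n : ℕ) :
    ∃ S : Finset (G σ), (∀ s ∈ S, s ∈ H) ∧ (∃ s ∈ S, s ∈ congruence σ n) ∧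
      ∀ φ : G σ → Ind (stChar σ),
        (∀ k ∈ H, ∀ c ∈ H, c ∈ congruence σ n → φ (k * c) = φ k) →
        ∀ k ∈ H, ∑ s ∈ S, φ (k * s) = ∑ s ∈ S, φ s := by
  classical
  have := hU.finite_quotient hH n
  have : Fintype (H ⧸ (congruence σ n).subgroupOf H) := Fintype.ofFinite _
  let o : H ⧸ (congruence σ n).subgroupOf H → G σ := fun q => (q.out : H)
  have ho : Function.Injective o := fun a b h => by
    rw [← QuotientGroup.out_eq' a, ← QuotientGroup.out_eq' b, Subtype.ext h]
  have hmk : ∀ (q : H ⧸ (congruence σ n).subgroupOf H) (k : H), (k : H ⧸ _) = q →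
      ∃ c ∈ H, c ∈ congruence σ n ∧ o q = k * c := by
    rintro _ k rfl
    obtain ⟨c, hc⟩ := QuotientGroup.mk_out_eq_mul ((congruence σ n).subgroupOf H) k
    exact ⟨c.1, c.1.2, Subgroup.mem_subgroupOf.1 c.2, congrArg Subtype.val hc⟩
  refine ⟨Finset.univ.image o, ?_, ?_, ?_⟩
  · intro s hs
    obtain ⟨q, -, rfl⟩ := Finset.mem_image.1 hs
    exact q.out.2
  · obtain ⟨c, hcH, hc, h⟩ := hmk _ 1 rfl
    refine ⟨_, Finset.mem_image_of_mem o (Finset.mem_univ ((1 : H) : H ⧸ _)), ?_⟩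
    rw [h]
    simpa using hc
  · intro φ hφ k hk
    rw [Finset.sum_image ho.injOn, Finset.sum_image ho.injOn]
    rw [← Equiv.sum_comp (MulAction.toPerm (⟨k, hk⟩ : H)) fun q => φ (o q)]
    refine Finset.sum_congr rfl fun q _ => ?_
    obtain ⟨c, hcH, hc, h⟩ := hmk (MulAction.toPerm (⟨k, hk⟩ : H) q) (⟨k, hk⟩ * q.out) (by
      conv_rhs => rw [← QuotientGroup.out_eq' q]
      rfl)
    rw [h]
    exact (hφ _ (mul_mem hk q.out.2) c hcH hc).symm

/-- Averaging over a compact group. -/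
lemma Unramified.exists_average {H : Subgroup (G σ)} (hH : H ≤ congruence σ 0)
    (f : Ind (stChar σ)) : ∃ S : Finset (G σ), S.Nonempty ∧ (∀ s ∈ S, s ∈ H) ∧
      ∀ k ∈ H, indRep (stChar σ) k (∑ s ∈ S, indRep (stChar σ) s f) =
        ∑ s ∈ S, indRep (stChar σ) s f := by
  obtain ⟨n, hn⟩ := hU.exists_fixed f
  obtain ⟨S, hS, ⟨s, hs, -⟩, h⟩ := hU.exists_sum_representatives hH n
  refine ⟨S, ⟨s, hs⟩, hS, fun k hk => ?_⟩
  rw [map_sum, ← h (fun s => indRep (stChar σ) s f) _ k hk]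
  · exact Finset.sum_congr rfl fun s _ => by rw [map_mul]; rfl
  · intro k _ c _ hc
    rw [map_mul, Module.End.mul_apply, hn c hc]

/-- Every vector is a linear combination of translates of a function supported in a small box. -/
lemma Unramified.exists_eq_sum_boxFun (f : Ind (stChar σ)) : ∃ N, ∀ i j, N ≤ i → N ≤ j →
    ∃ (S : Finset (G σ)) (c : G σ → ℂ), (∀ s ∈ S, s ∈ congruence σ 0) ∧
      f = ∑ s ∈ S, c s • indRep (stChar σ) s (hU.boxFun i j) := by
  classical
  obtain ⟨N, hN⟩ := hU.exists_fixed f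
  refine ⟨N, fun i j hi hj => ?_⟩
  obtain ⟨n, hn⟩ := hU.exists_fixed (hU.boxFun i j)
  obtain ⟨S, hS, ⟨s₀, hs₀, hs₀n⟩, h⟩ :=
    hU.exists_sum_representatives (le_refl (congruence σ 0)) n
  set D := hU.boxFun i j with hD
  have hsum : ∀ k ∈ congruence σ 0, ∑ s ∈ S, D.val (k * s) = ∑ s ∈ S, D.val s := by
    intro k hk
    have h1 := h (fun s => indRep (stChar σ) s D) (fun k _ c _ hc => by
      rw [map_mul, Module.End.mul_apply, hn _ hc]) k hk
    have h2 := congrArg (fun F : Ind (stChar σ) => F.val 1) h1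
    simpa [indRep_apply, AddSubmonoidClass.coe_finsetSum, Finset.sum_apply] using h2
  have hone : D.val 1 = 1 := by
    rw [hD, hU.boxFun_apply_pos]
    · simp [entry_one]
    · simp [box, entry_one]
  -- The values of D are non-negative, and one representative lies in the subgroup fixing D, where D
  -- takes its value at 1, namely 1. So the sum is positive.
  have hc0 : ∑ s ∈ S, D.val s ≠ 0 := by
    have hre : ∀ g, ∃ x : ℝ≥0, D.val g = ((x : ℝ) : ℂ) := fun g => ⟨_, hU.boxFun_apply i j g⟩
    choose x hx using hre
    have h1 : x s₀ = 1 := by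
      have h2 := hn _ hs₀n
      have h3 := congrArg (fun F : Ind (stChar σ) => F.val 1) h2
      simp only [indRep_apply, one_mul, hone, hx] at h3
      exact_mod_cast h3
    have h2 : ∑ s ∈ S, D.val s = ((∑ s ∈ S, x s : ℝ≥0) : ℝ) := by
      push_cast
      exact Finset.sum_congr rfl fun s _ => hx _
    have h3 : (0 : ℝ≥0) < ∑ s ∈ S, x s :=
      zero_lt_one.trans_le (h1 ▸ Finset.single_le_sum (f := fun s => x s)
        (fun _ _ => zero_le) hs₀)
    rw [h2]
    exact_mod_cast h3.ne'
  -- If D(ks) ≠ 0, the row of ks is up to a unit that of a lower unipotent u close to 1. So f(k) =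
  -- f(u s⁻¹) = f(s⁻¹ · s u s⁻¹) = f(s⁻¹), since s u s⁻¹ again fixes f.
  have hval : ∀ k ∈ congruence σ 0, ∀ s ∈ S, f.val s⁻¹ * D.val (k * s) =
      f.val k * D.val (k * s) := by
    intro k hk s hs
    by_cases h0 : D.val (k * s) = 0
    · rw [h0, mul_zero, mul_zero]
    congr 1
    obtain ⟨g, hg⟩ : ∃ g, g = k * s := ⟨_, rfl⟩
    rw [← hg] at h0
    have hgK : g ∈ congruence σ 0 := hg ▸ mul_mem hk (hS s hs)
    have hb : box i j _ _ _ := hU.boxFun_ne_zero_iff.1 h0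
    have hr : rowAbs g = normAbs E (entry σ g 2 2) :=
      max_eq_right (hb.2.trans (mul_le_of_le_one_left zero_le
        (pow_le_one₀ zero_le (unifAbs_lt_one E).le)))
    have hr1 : rowAbs g = 1 := by
      have := hU.rowAbs_mul 1 hgK
      rw [one_mul] at this
      rw [this]
      simp [rowAbs, entry_one]
    have h22 := hr.symm.trans hr1
    have hle : ∀ m, N ≤ m → unifAbs E ^ m ≤ unifAbs E ^ N := fun m hm =>
      pow_le_pow_right_of_le_one' (unifAbs_lt_one E).le hm
    obtain ⟨x, y, hxy, hx, hy, hrow⟩ := hU.exists_lower (normAbs_pos.1 (h22 ▸ one_pos))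
    have hu : lower hU.conj_conj x y hxy ∈ congruence σ N := by
      refine hU.lower_mem_congruence hxy ?_ ?_
      · rw [hx, h22, div_one]
        refine hb.1.trans ?_
        rw [h22, mul_one]
        exact hle i hi
      · rw [hy, h22, div_one]
        refine hb.2.trans ?_
        rw [h22, mul_one]
        exact hle j hj
    have hk' : k = g * s⁻¹ := by rw [hg, mul_inv_cancel_right]
    have h3 : f.val k = f.val (lower hU.conj_conj x y hxy * s⁻¹) := by
      rw [hk', hU.apply_eq_of_row f (g' := lower hU.conj_conj x y hxy * s⁻¹) (l := entry σ g 2 2)]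
      · rw [h22]
        simp
      · intro l
        rw [entry_mul, entry_mul, Finset.mul_sum]
        exact Finset.sum_congr rfl fun m _ => by rw [hrow m]; ring
    have h4 := hN _ (conj_mem_congruence σ (hS s hs) hu)
    have h5 := congrArg (fun F : Ind (stChar σ) => F.val s⁻¹) h4
    simp only [indRep_apply] at h5
    rw [h3, ← h5]
    group
  -- The translates of D, divided by their constant sum, form a partition of unity on K on whose
  -- pieces f is constant.
  refine ⟨S, fun s => (∑ s ∈ S, D.val s)⁻¹ * f.val s⁻¹, hS, ?_⟩
  · refine hU.ext_of_integral fun k hk => ?_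
    simp only [AddSubmonoidClass.coe_finsetSum, Finset.sum_apply, Submodule.coe_smul,
      Pi.smul_apply, indRep_apply, smul_eq_mul, mul_assoc]
    rw [← Finset.mul_sum, Finset.sum_congr rfl (hval k hk), ← Finset.mul_sum, hsum k hk]
    field_simp

open MeasureTheory in
/-- A functional that is invariant under the maximal compact subgroup. -/
lemma Unramified.exists_functional : ∃ I : Ind (stChar σ) →ₗ[ℂ] ℂ,
    (∀ k ∈ congruence σ 0, ∀ f, I (indRep (stChar σ) k f) = I f) ∧ I hU.sph = 1 := by
  have hc := hU.isCompact_congruence_zero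
  have : CompactSpace (congruence σ 0) := isCompact_iff_compactSpace.1 hc
  let _ : MeasurableSpace (congruence σ 0) := borel _
  have : BorelSpace (congruence σ 0) := ⟨rfl⟩
  let μ : Measure (congruence σ 0) := Measure.haarMeasure ⊤
  -- Integrating f(k⁻¹) turns right translation of f into left translation of the integrand, so left
  -- invariance of Haar measure applies.
  have hcont : ∀ f : Ind (stChar σ), Continuous fun k : congruence σ 0 => f.val (k⁻¹ : G σ) :=
    fun f => f.2.1.continuous.comp (continuous_subtype_val.inv)
  have hint : ∀ f : Ind (stChar σ), Integrable (fun k : congruence σ 0 => f.val (k⁻¹ : G σ)) μ :=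
    fun f => (hcont f).integrable_of_hasCompactSupport (HasCompactSupport.of_compactSpace _)
  refine ⟨{ toFun := fun f => ∫ k, f.val (k⁻¹ : G σ) ∂μ
            map_add' := fun f f' => integral_add (hint f) (hint f')
            map_smul' := fun c f => integral_const_mul c _ }, ?_, ?_⟩
  · intro k hk f
    have := integral_mul_left_eq_self (μ := μ) (fun x : congruence σ 0 => f.val (x⁻¹ : G σ))
      ⟨k⁻¹, inv_mem hk⟩
    simpa [indRep_apply] using this
  · have h1 : ∀ k : congruence σ 0, hU.sph.val (k⁻¹ : G σ) = 1 := by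
      intro k
      have := hU.rowAbs_mul 1 (inv_mem k.2)
      rw [one_mul] at this
      rw [hU.sph_apply, this]
      simp [rowAbs, entry_one]
    have h2 : μ Set.univ = 1 := Measure.haarMeasure_self
    simp [h1, Measure.real, h2]

end Average

end U3

end

noncomputable section

namespace U3

/-! ### Masses of boxes -/

section Mass

variable {F E : Type*} [Field F] [ValuativeRel F] [TopologicalSpace F]
  [IsNonarchimedeanLocalField F]
  [Field E] [ValuativeRel E] [TopologicalSpace E] [IsNonarchimedeanLocalField E]
  [Algebra F E] {σ : E ≃ₐ[F] E} {ϖ : F} (hU : Unramified σ ϖ)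

include hU

lemma Unramified.unif_ne_zero : algebraMap F E ϖ ≠ 0 :=
  normAbs_pos.1 (hU.normAbs_unif ▸ unifAbs_pos E)

lemma Unramified.normAbs_unif_pow (n : ℕ) : normAbs E (algebraMap F E ϖ ^ n) = unifAbs E ^ n := by
  rw [map_pow, hU.normAbs_unif]

lemma Unramified.two_ne_zero : (2 : E) ≠ 0 := normAbs_pos.1 (hU.normAbs_two ▸ one_pos)

/-- With zero in the middle, the unitary condition on a lower unipotent only asks its corner to be
skew. Such elements move x and leave y and z alone. -/
lemma Unramified.exists_lower_of_skew {n : ℕ} {a : E} (ha : normAbs E a ≤ 1) (hσ : σ a = -a) :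
    ∃ u ∈ congruence σ 0, ∀ g : G σ,
      entry σ (g * u) 2 0 = entry σ g 2 0 + entry σ g 2 2 * (algebraMap F E ϖ ^ n * a) ∧
      entry σ (g * u) 2 1 = entry σ g 2 1 ∧ entry σ (g * u) 2 2 = entry σ g 2 2 := by
  have h : algebraMap F E ϖ ^ n * a + σ (algebraMap F E ϖ ^ n * a) + 0 * σ 0 = 0 := by
    rw [map_mul, map_pow, AlgEquiv.commutes, hσ]
    ring
  refine ⟨lower hU.conj_conj _ _ h, hU.lower_mem_congruence h (by simp) ?_, fun g => ?_⟩
  · rw [map_mul, hU.normAbs_unif_pow, pow_zero]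
    exact mul_le_one' (pow_le_one₀ zero_le (unifAbs_lt_one E).le) ha
  · obtain ⟨h0, h1, h2⟩ := entry_mul_lower hU.conj_conj g _ _ h 2
    rw [h0, h1, h2]
    simp

/-- Any middle entry x can be completed by the corner -x x̄ / 2, which has absolute value |x|²
because 2 is a unit. This moves y by a prescribed multiple of z; of the resulting change in the
first entry only the size matters. -/
lemma Unramified.exists_lower_of_integral {n : ℕ} {a : E} (ha : normAbs E a ≤ 1) :
    ∃ u ∈ congruence σ 0, ∀ g : G σ,
      (∃ z w : E, normAbs E z ≤ unifAbs E ^ n ∧ normAbs E w ≤ unifAbs E ^ (2 * n) ∧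
        entry σ (g * u) 2 0 = entry σ g 2 0 + entry σ g 2 1 * z + entry σ g 2 2 * w) ∧
      entry σ (g * u) 2 1 = entry σ g 2 1 - entry σ g 2 2 * (algebraMap F E ϖ ^ n * a) ∧
      entry σ (g * u) 2 2 = entry σ g 2 2 := by
  set x := σ (algebraMap F E ϖ ^ n * a) with hx
  have h2 := hU.two_ne_zero
  have hx1 : normAbs E x ≤ unifAbs E ^ n := by
    rw [hU.normAbs_conj, map_mul, hU.normAbs_unif_pow]
    exact mul_le_of_le_one_right zero_le ha
  have hy1 : normAbs E (-(x * σ x) / 2) ≤ unifAbs E ^ (2 * n) := by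
    rw [map_div₀, hU.normAbs_two, div_one, normAbs_neg, map_mul, hU.normAbs_conj x, ← sq, mul_comm,
      pow_mul]
    gcongr
  have h : -(x * σ x) / 2 + σ (-(x * σ x) / 2) + x * σ x = 0 := by
    rw [map_div₀, map_neg, map_mul, hU.conj_conj, map_ofNat]
    field_simp
    ring
  have hle : ∀ m, unifAbs E ^ m ≤ unifAbs E ^ 0 := fun m => by
    rw [pow_zero]
    exact pow_le_one₀ zero_le (unifAbs_lt_one E).le
  refine ⟨lower hU.conj_conj _ _ h, hU.lower_mem_congruence h (hx1.trans (hle _))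
    (hy1.trans (hle _)), fun g => ?_⟩
  obtain ⟨e0, e1, e2⟩ := entry_mul_lower hU.conj_conj g _ _ h 2
  refine ⟨⟨_, _, hx1, hy1, e0⟩, ?_, e2⟩
  rw [e1, hx, hU.conj_conj]

/-- The general principle by which masses of boxes are compared. -/
lemma Unramified.functional_boxFun {I : Ind (stChar σ) →ₗ[ℂ] ℂ}
    (hI : ∀ k ∈ congruence σ 0, ∀ f, I (indRep (stChar σ) k f) = I f) {R : Finset E}
    {i j i' j' : ℕ} (u : E → G σ) (hu : ∀ a ∈ R, u a ∈ congruence σ 0)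
    (h22 : ∀ a ∈ R, ∀ g, entry σ (g * u a) 2 2 = entry σ g 2 2)
    (h1 : ∀ g : G σ, box i j (entry σ g 2 0) (entry σ g 2 1) (entry σ g 2 2) →
      ∃! a, a ∈ R ∧ box i' j' (entry σ (g * u a) 2 0) (entry σ (g * u a) 2 1)
        (entry σ (g * u a) 2 2))
    (h2 : ∀ g : G σ, ∀ a ∈ R, box i' j' (entry σ (g * u a) 2 0) (entry σ (g * u a) 2 1)
        (entry σ (g * u a) 2 2) → box i j (entry σ g 2 0) (entry σ g 2 1) (entry σ g 2 2)) :
    I (hU.boxFun i j) = R.card * I (hU.boxFun i' j') := by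
  -- The translates of the smaller box partition the larger one, and |z| is unchanged on each piece,
  -- so the functions agree exactly.
  have h : hU.boxFun i j = ∑ a ∈ R, indRep (stChar σ) (u a) (hU.boxFun i' j') := by
    refine Subtype.ext (funext fun g => ?_)
    rw [AddSubmonoidClass.coe_finsetSum, Finset.sum_apply]
    simp only [indRep_apply]
    by_cases hg : box i j (entry σ g 2 0) (entry σ g 2 1) (entry σ g 2 2)
    · obtain ⟨a, ⟨ha, hb⟩, huniq⟩ := h1 g hg
      rw [Finset.sum_eq_single a, hU.boxFun_apply_pos hg, hU.boxFun_apply_pos hb, h22 a ha]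
      · exact fun c hc hne => hU.boxFun_apply_neg fun h => hne (huniq c ⟨hc, h⟩)
      · exact fun h => absurd ha h
    · rw [hU.boxFun_apply_neg hg]
      exact (Finset.sum_eq_zero fun a ha => hU.boxFun_apply_neg fun h => hg (h2 g a ha h)).symm
  rw [h, map_sum, Finset.sum_congr rfl fun a ha => hI (u a) (hu a ha) _]
  simp

/-- The trace of x/z is minus the norm of y/z, hence of size at most r^(2 i) ≤ r^(j + 1). Modulo the
next level only the skew part T of x/z is free, and it takes q values. -/
lemma Unramified.functional_boxFun_succ_right {I : Ind (stChar σ) →ₗ[ℂ] ℂ}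
    (hI : ∀ k ∈ congruence σ 0, ∀ f, I (indRep (stChar σ) k f) = I f) {i j : ℕ}
    (hij : j + 1 ≤ 2 * i) :
    I (hU.boxFun i j) = resCard F * I (hU.boxFun i (j + 1)) := by
  classical
  obtain ⟨R, hR, hR1, hR2⟩ := hU.exists_skew
  choose! u hu hue using fun a (ha : a ∈ R) =>
    hU.exists_lower_of_skew (n := j) (hR1 a ha).1 (hR1 a ha).2
  rw [← hR]
  have hr := unifAbs_pos E
  have hp := hU.unif_ne_zero
  refine hU.functional_boxFun hI u hu (fun a ha g => (hue a ha g).2.2) ?_ ?_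
  · intro g hg
    have hz : entry σ g 2 2 ≠ 0 := fun hz => by
      have h1 := hg.1
      have h2 := hg.2
      rw [hz, map_zero, mul_zero, nonpos_iff_eq_zero, normAbs_eq_zero] at h1 h2
      exact row_ne_zero σ g ⟨h2, h1, hz⟩
    have hzp := normAbs_pos.2 hz
    have hσz : σ (entry σ g 2 2) ≠ 0 := (map_ne_zero σ).2 hz
    set Y := entry σ g 2 0 / entry σ g 2 2 with hY
    set X := entry σ g 2 1 / entry σ g 2 2 with hX
    have hYσ : Y + σ Y = -(X * σ X) := by
      have := row_isotropic σ g
      rw [hY, hX, map_div₀, map_div₀]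
      field_simp
      linear_combination this
    have hY1 : normAbs E Y ≤ unifAbs E ^ j := by
      rw [hY, map_div₀]
      exact (div_le_iff₀ hzp).2 hg.2
    have hX1 : normAbs E X ≤ unifAbs E ^ i := by
      rw [hX, map_div₀]
      exact (div_le_iff₀ hzp).2 hg.1
    have h2 := hU.two_ne_zero
    set T := (Y - σ Y) / 2 with hT
    have hT1 : normAbs E T ≤ unifAbs E ^ j := by
      rw [hT, map_div₀, hU.normAbs_two, div_one]
      exact normAbs_sub_le_of_le hY1 (by rwa [hU.normAbs_conj])
    have hYT : normAbs E (Y - T) ≤ unifAbs E ^ (j + 1) := by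
      have : Y - T = (Y + σ Y) / 2 := by rw [hT]; field_simp; ring
      rw [this, hYσ, map_div₀, hU.normAbs_two, div_one, normAbs_neg, map_mul, hU.normAbs_conj,
        ← sq]
      calc normAbs E X ^ 2 ≤ (unifAbs E ^ i) ^ 2 := by gcongr
        _ = unifAbs E ^ (2 * i) := by rw [← pow_mul, mul_comm]
        _ ≤ _ := pow_le_pow_right_of_le_one' (unifAbs_lt_one E).le hij
    have hσT : σ T = -T := by
      rw [hT, map_div₀, map_sub, hU.conj_conj, map_ofNat]
      ring
    obtain ⟨a, ⟨ha, ha1⟩, huniq⟩ := hR2 (-T / algebraMap F E ϖ ^ j)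
      (by
        rw [map_div₀, hU.normAbs_unif_pow, normAbs_neg]
        exact div_le_one_of_le₀ hT1 zero_le)
      (by
        rw [map_div₀, map_neg, hσT, map_pow, AlgEquiv.commutes]
        ring)
    have key : ∀ c ∈ R, box i (j + 1) (entry σ (g * u c) 2 0) (entry σ (g * u c) 2 1)
        (entry σ (g * u c) 2 2) ↔ normAbs E (-T / algebraMap F E ϖ ^ j - c) < 1 := by
      intro c hc
      obtain ⟨e0, e1, e2⟩ := hue c hc g
      rw [e0, e1, e2]
      have e3 : entry σ g 2 0 + entry σ g 2 2 * (algebraMap F E ϖ ^ j * c) =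
          entry σ g 2 2 * (Y + algebraMap F E ϖ ^ j * c) := by
        rw [hY]; field_simp
      have e4 : -T / algebraMap F E ϖ ^ j - c =
          -(T + algebraMap F E ϖ ^ j * c) / algebraMap F E ϖ ^ j := by
        field_simp
        ring
      rw [e3, e4, map_div₀, normAbs_neg, hU.normAbs_unif_pow]
      have e5 : normAbs E (entry σ g 2 2 * (Y + algebraMap F E ϖ ^ j * c)) ≤
          unifAbs E ^ (j + 1) * normAbs E (entry σ g 2 2) ↔
          normAbs E (Y + algebraMap F E ϖ ^ j * c) ≤ unifAbs E ^ (j + 1) := by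
        rw [map_mul, mul_comm, mul_le_mul_iff_left₀ hzp]
      have e6 : normAbs E (Y + algebraMap F E ϖ ^ j * c) ≤ unifAbs E ^ (j + 1) ↔
          normAbs E (T + algebraMap F E ϖ ^ j * c) ≤ unifAbs E ^ (j + 1) := by
        constructor
        · intro h
          have := normAbs_sub_le_of_le h hYT
          rwa [show Y + algebraMap F E ϖ ^ j * c - (Y - T) = T + algebraMap F E ϖ ^ j * c by ring]
            at this
        · intro h
          have := normAbs_add_le_of_le h hYT
          rwa [show T + algebraMap F E ϖ ^ j * c + (Y - T) = Y + algebraMap F E ϖ ^ j * c by ring]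
            at this
      rw [div_lt_one (pow_pos hr j)]
      constructor
      · intro h
        refine (e6.1 (e5.1 h.2)).trans_lt ?_
        rw [pow_succ]
        exact mul_lt_of_lt_one_right (pow_pos hr j) (unifAbs_lt_one E)
      · intro h
        refine ⟨hg.1, e5.2 (e6.2 ?_)⟩
        rw [← hU.normAbs_unif_pow] at h
        have := normAbs_le_unifAbs_mul h
        rwa [hU.normAbs_unif_pow, ← pow_succ'] at this
    exact ⟨a, ⟨ha, (key a ha).2 ha1⟩, fun c hc => huniq c ⟨hc.1, (key c hc.1).1 hc.2⟩⟩
  · intro g a ha hb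
    obtain ⟨e0, e1, e2⟩ := hue a ha g
    rw [e0, e1, e2] at hb
    refine ⟨hb.1, ?_⟩
    have h3 : normAbs E (entry σ g 2 2 * (algebraMap F E ϖ ^ j * a)) ≤
        unifAbs E ^ j * normAbs E (entry σ g 2 2) := by
      rw [map_mul, map_mul, hU.normAbs_unif_pow, mul_comm]
      gcongr
      exact mul_le_of_le_one_right zero_le (hR1 a ha).1
    have h4 := hb.2.trans (mul_le_mul_left (pow_le_pow_right_of_le_one' (unifAbs_lt_one E).le
      (Nat.le_succ j)) _)
    have := normAbs_sub_le_of_le h4 h3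
    rwa [add_sub_cancel_right] at this

/-- Here y/z runs freely through the q² residue classes at level i, and j ≤ 2 i ensures that the
unipotents used to shift y do not disturb the condition on x. -/
lemma Unramified.functional_boxFun_succ_left {I : Ind (stChar σ) →ₗ[ℂ] ℂ}
    (hI : ∀ k ∈ congruence σ 0, ∀ f, I (indRep (stChar σ) k f) = I f) {i j : ℕ}
    (hij : j ≤ 2 * i) :
    I (hU.boxFun i j) = resCard E * I (hU.boxFun (i + 1) j) := by
  classical
  obtain ⟨R, hR, hR1, hR2⟩ := exists_representatives E
  choose! u hu hue using fun a (ha : a ∈ R) =>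
    hU.exists_lower_of_integral (n := i) (hR1 a ha)
  rw [← hR]
  have hr := unifAbs_pos E
  have hp := hU.unif_ne_zero
  have hpow : ∀ {m n : ℕ}, m ≤ n → unifAbs E ^ n ≤ unifAbs E ^ m := fun h =>
    pow_le_pow_right_of_le_one' (unifAbs_lt_one E).le h
  -- The change y Z + z W in the first entry has size at most r^(2 i) |z| ≤ r^j |z|.
  have hfirst : ∀ x y z Z W : E, normAbs E y ≤ unifAbs E ^ i * normAbs E z →
      normAbs E Z ≤ unifAbs E ^ i → normAbs E W ≤ unifAbs E ^ (2 * i) →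
      (normAbs E (x + y * Z + z * W) ≤ unifAbs E ^ j * normAbs E z ↔
        normAbs E x ≤ unifAbs E ^ j * normAbs E z) := by
    intro x y z Z W hy hZ hW
    have h1 : normAbs E (y * Z) ≤ unifAbs E ^ j * normAbs E z := by
      rw [map_mul]
      calc normAbs E y * normAbs E Z ≤ unifAbs E ^ i * normAbs E z * unifAbs E ^ i := by gcongr
        _ = unifAbs E ^ (2 * i) * normAbs E z := by ring
        _ ≤ _ := by gcongr ?_ * _; exact hpow hij
    have h2 : normAbs E (z * W) ≤ unifAbs E ^ j * normAbs E z := by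
      rw [map_mul, mul_comm]
      gcongr
      exact hW.trans (hpow hij)
    constructor
    · intro h
      have := normAbs_sub_le_of_le (normAbs_sub_le_of_le h h2) h1
      rwa [add_sub_cancel_right, add_sub_cancel_right] at this
    · intro h
      exact normAbs_add_le_of_le (normAbs_add_le_of_le h h1) h2
  refine hU.functional_boxFun hI u hu (fun a ha g => (hue a ha g).2.2) ?_ ?_
  · intro g hg
    have hz : entry σ g 2 2 ≠ 0 := fun hz => by
      have h1 := hg.1
      have h2 := hg.2
      rw [hz, map_zero, mul_zero, nonpos_iff_eq_zero, normAbs_eq_zero] at h1 h2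
      exact row_ne_zero σ g ⟨h2, h1, hz⟩
    have hzp := normAbs_pos.2 hz
    obtain ⟨a, ⟨ha, ha1⟩, huniq⟩ := hR2 (entry σ g 2 1 / entry σ g 2 2 / algebraMap F E ϖ ^ i)
      (by
        rw [map_div₀, map_div₀, hU.normAbs_unif_pow]
        exact div_le_one_of_le₀ ((div_le_iff₀ hzp).2 hg.1) zero_le)
    have key : ∀ c ∈ R, box (i + 1) j (entry σ (g * u c) 2 0) (entry σ (g * u c) 2 1)
        (entry σ (g * u c) 2 2) ↔
        normAbs E (entry σ g 2 1 / entry σ g 2 2 / algebraMap F E ϖ ^ i - c) < 1 := by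
      intro c hc
      obtain ⟨⟨Z, W, hZ, hW, e0⟩, e1, e2⟩ := hue c hc g
      rw [e0, e1, e2, box, hfirst _ _ _ _ _ hg.1 hZ hW, and_iff_left hg.2]
      have e4 : entry σ g 2 1 / entry σ g 2 2 / algebraMap F E ϖ ^ i - c =
          (entry σ g 2 1 - entry σ g 2 2 * (algebraMap F E ϖ ^ i * c)) /
            (algebraMap F E ϖ ^ i * entry σ g 2 2) := by
        field_simp
      have hpos : 0 < normAbs E (algebraMap F E ϖ ^ i * entry σ g 2 2) :=
        normAbs_pos.2 (mul_ne_zero (pow_ne_zero _ hp) hz)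
      rw [e4, map_div₀, div_lt_one hpos]
      have e5 : unifAbs E ^ (i + 1) * normAbs E (entry σ g 2 2) =
          unifAbs E * normAbs E (algebraMap F E ϖ ^ i * entry σ g 2 2) := by
        rw [map_mul, hU.normAbs_unif_pow]
        ring
      rw [e5]
      constructor
      · intro h
        exact h.trans_lt (mul_lt_of_lt_one_left hpos (unifAbs_lt_one E))
      · exact normAbs_le_unifAbs_mul
    exact ⟨a, ⟨ha, (key a ha).2 ha1⟩, fun c hc => huniq c ⟨hc.1, (key c hc.1).1 hc.2⟩⟩
  · intro g a ha hb
    obtain ⟨⟨Z, W, hZ, hW, e0⟩, e1, e2⟩ := hue a ha g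
    rw [e0, e1, e2] at hb
    have h3 : normAbs E (entry σ g 2 2 * (algebraMap F E ϖ ^ i * a)) ≤
        unifAbs E ^ i * normAbs E (entry σ g 2 2) := by
      rw [map_mul, map_mul, hU.normAbs_unif_pow, mul_comm]
      gcongr
      exact mul_le_of_le_one_right zero_le (hR1 a ha)
    have h4 := hb.1.trans (mul_le_mul_left (hpow (Nat.le_succ i)) _)
    have h5 := normAbs_add_le_of_le h4 h3
    rw [sub_add_cancel] at h5
    exact ⟨h5, (hfirst _ _ _ _ _ h5 hZ hW).1 hb.2⟩

/-- The function supported on the ball of radius `n` around the last basis vector. -/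
def Unramified.ballFun (n : ℕ) : Ind (stChar σ) := hU.boxFun ((n + 1) / 2) n

/-- (n + 1) / 2 is the largest i with 2 i ≤ n + 1, so the condition on y in the box follows from the
one on x. -/
lemma Unramified.ballFun_ne_zero_iff {n : ℕ} {g : G σ} : (hU.ballFun n).val g ≠ 0 ↔
    normAbs E (entry σ g 2 0) ≤ unifAbs E ^ n * normAbs E (entry σ g 2 2) := by
  rw [ballFun, hU.boxFun_ne_zero_iff, hU.box_iff (by lia)]

lemma Unramified.ballFun_apply_pos {n : ℕ} {g : G σ}
    (h : normAbs E (entry σ g 2 0) ≤ unifAbs E ^ n * normAbs E (entry σ g 2 2)) :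
    (hU.ballFun n).val g = (((normAbs E (entry σ g 2 2) ^ 2)⁻¹ : ℝ≥0) : ℂ) :=
  hU.boxFun_apply_pos ((hU.box_iff (by lia) g).2 h)

lemma Unramified.ballFun_apply_neg {n : ℕ} {g : G σ}
    (h : ¬ normAbs E (entry σ g 2 0) ≤ unifAbs E ^ n * normAbs E (entry σ g 2 2)) :
    (hU.ballFun n).val g = 0 :=
  hU.boxFun_apply_neg (mt (hU.box_iff (by lia) g).1 h)

lemma Unramified.functional_ballFun_one {I : Ind (stChar σ) →ₗ[ℂ] ℂ}
    (hI : ∀ k ∈ congruence σ 0, ∀ f, I (indRep (stChar σ) k f) = I f) :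
    I (hU.ballFun 1) = resCard F * I (hU.ballFun 2) :=
  hU.functional_boxFun_succ_right hI (i := 1) (j := 1) (by norm_num)

/-- Shrinking the radius by two levels refines y once, at cost q², and x twice, at cost q each. -/
lemma Unramified.functional_ballFun_add_two {I : Ind (stChar σ) →ₗ[ℂ] ℂ}
    (hI : ∀ k ∈ congruence σ 0, ∀ f, I (indRep (stChar σ) k f) = I f) (n : ℕ) :
    I (hU.ballFun n) = resCard F ^ 4 * I (hU.ballFun (n + 2)) := by
  have hq : (resCard E : ℂ) = (resCard F : ℂ) ^ 2 := by exact_mod_cast hU.resCard_eq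
  obtain ⟨m, rfl | rfl⟩ := Nat.even_or_odd' n
  · have e1 : (2 * m + 1) / 2 = m := by lia
    have e2 : (2 * m + 2 + 1) / 2 = m + 1 := by lia
    rw [ballFun, ballFun, e1, e2, hU.functional_boxFun_succ_left hI (by lia),
      hU.functional_boxFun_succ_right hI (by lia), hU.functional_boxFun_succ_right hI (by lia), hq]
    ring
  · have e1 : (2 * m + 1 + 1) / 2 = m + 1 := by lia
    have e2 : (2 * m + 1 + 2 + 1) / 2 = m + 1 + 1 := by lia
    rw [ballFun, ballFun, e1, e2, hU.functional_boxFun_succ_right hI (by lia),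
      hU.functional_boxFun_succ_left hI (by lia), hU.functional_boxFun_succ_right hI (by lia), hq]
    ring

end Mass

end U3

end

noncomputable section

namespace U3

/-! ### Invariance of the functional under the whole group -/

lemma natCast_resCard_ne_zero (K : Type*) [Field K] [ValuativeRel K] [TopologicalSpace K]
    [IsNonarchimedeanLocalField K] : (resCard K : ℂ) ≠ 0 := by
  have := resCard_ne_zero K
  exact_mod_cast this

section Invariance

variable {F E : Type*} [Field F] [ValuativeRel F] [TopologicalSpace F]
  [IsNonarchimedeanLocalField F]
  [Field E] [ValuativeRel E] [TopologicalSpace E] [IsNonarchimedeanLocalField E]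
  [Algebra F E] {σ : E ≃ₐ[F] E} {ϖ : F} (hU : Unramified σ ϖ)

/-- All entries of `g` have absolute value at most `unifAbs E ^ (-m)`. -/
def IsBounded (m : ℕ) (g : G σ) : Prop := ∀ i j, unifAbs E ^ m * normAbs E (entry σ g i j) ≤ 1

omit [ValuativeRel F] [TopologicalSpace F] [IsNonarchimedeanLocalField F] in
lemma exists_isBounded (g : G σ) : ∃ m, IsBounded m g := by
  set c := ∑ i, ∑ j, normAbs E (entry σ g i j) with hc
  have hc0 : 0 < c + 1 := by positivity
  obtain ⟨m, hm⟩ := exists_pow_lt_of_lt_one (inv_pos.2 hc0) (unifAbs_lt_one E)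
  refine ⟨m, fun i j => ?_⟩
  have h1 : normAbs E (entry σ g i j) ≤ c + 1 :=
    ((Finset.single_le_sum (f := fun j => normAbs E (entry σ g i j)) (fun _ _ => zero_le)
      (Finset.mem_univ j)).trans (Finset.single_le_sum
      (f := fun i => ∑ j, normAbs E (entry σ g i j)) (fun _ _ => zero_le)
      (Finset.mem_univ i))).trans (le_add_of_nonneg_right zero_le)
  calc _ ≤ (c + 1)⁻¹ * (c + 1) := mul_le_mul' hm.le h1
    _ = 1 := inv_mul_cancel₀ hc0.ne'

include hU

lemma Unramified.isBounded_inv {m : ℕ} {g : G σ} (h : IsBounded m g) : IsBounded m g⁻¹ := by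
  intro i j
  rw [entry_inv, hU.normAbs_conj]
  exact h _ _

lemma Unramified.isBounded_mul {m : ℕ} {g k : G σ} (h : IsBounded m g)
    (hk : k ∈ congruence σ 0) : IsBounded m (g * k) := by
  have hk := hU.mem_congruence_zero.1 hk
  have hpos := pow_pos (unifAbs_pos E) m
  intro i j
  rw [mul_comm, ← le_div_iff₀ hpos, entry_mul, Fin.sum_univ_three]
  have h1 : ∀ l, normAbs E (entry σ g i l * entry σ k l j) ≤ 1 / unifAbs E ^ m := fun l => by
    rw [le_div_iff₀ hpos, map_mul, mul_comm, ← mul_assoc]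
    exact mul_le_one' (h i l) (hk l j)
  exact normAbs_add_le_of_le (normAbs_add_le_of_le (h1 0) (h1 1)) (h1 2)

/-- |x| ≤ r^(4 m + 2) |z| forces |y| ≤ r^(2 m + 1) |z|. The entries of b have size at most r^(-m),
so the terms with x and y contribute at most r^(m + 1) |z|. This is less than |z d|, as |d| = |a|⁻¹
≥ r^m. -/
lemma Unramified.normAbs_entry_mul_of_mem_B {b : G σ} (hb : b ∈ B σ) {m : ℕ} (hm : IsBounded m b)
    {g : G σ} (hg : normAbs E (entry σ g 2 0) ≤ unifAbs E ^ (4 * m + 2) * normAbs E (entry σ g 2 2)) :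
    normAbs E (entry σ (g * b) 2 2) = normAbs E (entry σ g 2 2) * normAbs E (entry σ b 2 2) := by
  have hpos := pow_pos (unifAbs_pos E) m
  have hr0 := unifAbs_pos E
  have hz : 0 < normAbs E (entry σ g 2 2) := by
    rw [pos_iff_ne_zero]
    intro h0
    have h1 := hU.normAbs_row_sq_le g
    rw [h0, mul_zero, nonpos_iff_eq_zero] at hg
    rw [h0, mul_zero, nonpos_iff_eq_zero, pow_eq_zero_iff (_root_.two_ne_zero)] at h1
    exact row_ne_zero σ g ⟨normAbs_eq_zero.1 hg, normAbs_eq_zero.1 h1, normAbs_eq_zero.1 h0⟩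
  have hd : unifAbs E ^ m ≤ normAbs E (entry σ b 2 2) := by
    have h1 := hm 0 0
    rw [hU.normAbs_entry_diag hb] at h1
    have hd0 : normAbs E (entry σ b 2 2) ≠ 0 := by
      intro h0
      have := entry_diag_conj σ hb
      rw [normAbs_eq_zero.1 h0, mul_zero] at this
      exact zero_ne_one this
    rwa [← div_eq_mul_inv, div_le_one (pos_iff_ne_zero.2 hd0)] at h1
  have h1 : normAbs E (entry σ g 2 1) ≤ unifAbs E ^ (2 * m + 1) * normAbs E (entry σ g 2 2) :=
    hU.normAbs_row_le g hg le_rfl (by rw [← pow_mul]; exact le_of_eq (by ring))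
  have hlt : unifAbs E ^ (m + 1) * normAbs E (entry σ g 2 2) <
      normAbs E (entry σ g 2 2 * entry σ b 2 2) := by
    rw [map_mul, mul_comm (normAbs E (entry σ g 2 2))]
    refine mul_lt_mul_of_pos_right (lt_of_lt_of_le ?_ hd) hz
    rw [pow_succ]
    exact mul_lt_of_lt_one_right hpos (unifAbs_lt_one E)
  have hsmall : ∀ {x y : E} {k : ℕ}, normAbs E x ≤ unifAbs E ^ k * normAbs E (entry σ g 2 2) →
      2 * m + 1 ≤ k → unifAbs E ^ m * normAbs E y ≤ 1 →
      normAbs E (x * y) ≤ unifAbs E ^ (m + 1) * normAbs E (entry σ g 2 2) := by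
    intro x y k hx hk hy
    have h2 : normAbs E x ≤ unifAbs E ^ (2 * m + 1) * normAbs E (entry σ g 2 2) :=
      hx.trans (mul_le_mul_left (pow_le_pow_right_of_le_one' (unifAbs_lt_one E).le hk) _)
    rw [map_mul]
    calc _ ≤ unifAbs E ^ (2 * m + 1) * normAbs E (entry σ g 2 2) * normAbs E y := by gcongr
      _ = unifAbs E ^ (m + 1) * normAbs E (entry σ g 2 2) * (unifAbs E ^ m * normAbs E y) := by ring
      _ ≤ _ := mul_le_of_le_one_right zero_le hy
  rw [entry_mul, Fin.sum_univ_three, ← map_mul]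
  exact normAbs_add_eq_right ((normAbs_add_le_of_le (hsmall hg (by lia) (hm 0 2))
    (hsmall h1 le_rfl (hm 1 2))).trans_lt hlt)

lemma Unramified.unifAbs_eq_inv : ((unifAbs E : ℝ) : ℂ) = ((resCard F : ℂ) ^ 2)⁻¹ := by
  rw [unifAbs, hU.resCard_eq]
  push_cast
  rfl

variable {I : Ind (stChar σ) →ₗ[ℂ] ℂ}
    (hI : ∀ k ∈ congruence σ 0, ∀ f, I (indRep (stChar σ) k f) = I f)

include hI

lemma Unramified.functional_ballFun_add (n k : ℕ) :
    I (hU.ballFun (n + 2 * k)) = ((unifAbs E : ℝ) : ℂ) ^ (2 * k) * I (hU.ballFun n) := by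
  have hq := natCast_resCard_ne_zero F
  induction k with
  | zero => simp
  | succ k ih =>
    have := hU.functional_ballFun_add_two hI (n + 2 * k)
    rw [ih] at this
    rw [mul_add 2 k 1, pow_add, mul_right_comm, this, hU.unifAbs_eq_inv, ← add_assoc, mul_one]
    field_simp

lemma Unramified.functional_ballFun_sub {n n' : ℕ} {e : ℤ} (h : (n' : ℤ) = n - 2 * e) :
    ((unifAbs E : ℝ) : ℂ) ^ (2 * e) * I (hU.ballFun n') = I (hU.ballFun n) := by
  have hr : ((unifAbs E : ℝ) : ℂ) ≠ 0 := by exact_mod_cast unifAbs_ne_zero E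
  obtain ⟨k, rfl | rfl⟩ := Int.eq_nat_or_neg e
  · have h1 : n = n' + 2 * k := by lia
    rw [h1, hU.functional_ballFun_add hI]
    norm_cast
  · have h1 : n' = n + 2 * k := by lia
    rw [h1, hU.functional_ballFun_add hI, mul_neg, ← mul_assoc, zpow_neg]
    have : ((unifAbs E : ℝ) : ℂ) ^ (2 * (k : ℤ)) = ((unifAbs E : ℝ) : ℂ) ^ (2 * k) := by norm_cast
    rw [this, inv_mul_cancel₀ (pow_ne_zero _ hr), one_mul]

/-- If |d| = r^(-e), then b carries the ball of radius n to r^(2 e) times the ball of radius n - 2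
e, and the mass of the latter is larger or smaller by exactly the inverse factor. As |e| ≤ m, the
bound 6 m + 2 leaves n - 2 e ≥ 4 m + 2, as the previous estimate needs. -/
lemma Unramified.functional_ballFun_of_mem_B {b : G σ} (hb : b ∈ B σ) {m : ℕ}
    (hm : IsBounded m b) {n : ℕ} (hn : 6 * m + 2 ≤ n) :
    I (indRep (stChar σ) b (hU.ballFun n)) = I (hU.ballFun n) := by
  have hr1 := one_lt_resCard E
  have hr0 := resCard_ne_zero E
  have hd0 : entry σ b 2 2 ≠ 0 := by
    intro h0
    have := entry_diag_conj σ hb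
    rw [h0, mul_zero] at this
    exact zero_ne_one this
  obtain ⟨e, he⟩ := normAbs_eq_zpow hd0
  have ha : normAbs E (entry σ b 0 0) = (resCard E : ℝ≥0) ^ (-e) := by
    rw [hU.normAbs_entry_diag hb, he, zpow_neg]
  have hpow : ∀ m : ℕ, unifAbs E ^ m = (resCard E : ℝ≥0) ^ (-(m : ℤ)) := fun m => by
    rw [unifAbs, inv_pow, zpow_neg, zpow_natCast]
  have he1 : e ≤ m := by
    have h := hm 2 2
    rw [he, hpow, ← zpow_add₀ hr0, ← zpow_zero (resCard E : ℝ≥0), zpow_le_zpow_iff_right₀ hr1] at h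
    lia
  have he2 : -e ≤ m := by
    have h := hm 0 0
    rw [ha, hpow, ← zpow_add₀ hr0, ← zpow_zero (resCard E : ℝ≥0), zpow_le_zpow_iff_right₀ hr1] at h
    lia
  obtain ⟨n', hn'⟩ : ∃ n' : ℕ, (n' : ℤ) = n - 2 * e := ⟨(n - 2 * e : ℤ).toNat, by lia⟩
  have hle : ∀ {k : ℕ} (g : G σ), 4 * m + 2 ≤ k →
      normAbs E (entry σ g 2 0) ≤ unifAbs E ^ k * normAbs E (entry σ g 2 2) →
      normAbs E (entry σ g 2 0) ≤ unifAbs E ^ (4 * m + 2) * normAbs E (entry σ g 2 2) :=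
    fun g hk h => h.trans (mul_le_mul_left
      (pow_le_pow_right_of_le_one' (unifAbs_lt_one E).le hk) _)
  have h10 : ∀ g : G σ, normAbs E (entry σ (g * b) 2 0) =
      normAbs E (entry σ g 2 0) * (resCard E : ℝ≥0) ^ (-e) := by
    intro g
    rw [entry_mul, Fin.sum_univ_three, hb 1 0 (by decide), hb 2 0 (by decide), mul_zero, mul_zero,
      add_zero, add_zero, map_mul, ha]
  have hcond : ∀ g : G σ, normAbs E (entry σ (g * b) 2 2) =
      normAbs E (entry σ g 2 2) * normAbs E (entry σ b 2 2) →
      (normAbs E (entry σ (g * b) 2 0) ≤ unifAbs E ^ n * normAbs E (entry σ (g * b) 2 2) ↔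
        normAbs E (entry σ g 2 0) ≤ unifAbs E ^ n' * normAbs E (entry σ g 2 2)) := by
    intro g h
    have hpos : 0 < (resCard E : ℝ≥0) ^ (-e) := zpow_pos (pos_iff_ne_zero.2 hr0) _
    rw [h10, h, he, ← mul_le_mul_iff_left₀ hpos (b := normAbs E (entry σ g 2 0))]
    have : unifAbs E ^ n * (normAbs E (entry σ g 2 2) * (resCard E : ℝ≥0) ^ e) =
        unifAbs E ^ n' * normAbs E (entry σ g 2 2) * (resCard E : ℝ≥0) ^ (-e) := by
      rw [hpow, hpow, mul_left_comm, ← zpow_add₀ hr0, mul_comm _ (normAbs E (entry σ g 2 2)),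
        mul_assoc, ← zpow_add₀ hr0, hn']
      congr 2
      ring
    rw [this]
  have heq : indRep (stChar σ) b (hU.ballFun n) =
      (((unifAbs E : ℝ) : ℂ) ^ (2 * e)) • hU.ballFun n' := by
    refine Subtype.ext (funext fun g => ?_)
    rw [indRep_apply, Submodule.coe_smul, Pi.smul_apply, smul_eq_mul]
    by_cases hg : normAbs E (entry σ g 2 0) ≤ unifAbs E ^ n' * normAbs E (entry σ g 2 2)
    · have h1 := hU.normAbs_entry_mul_of_mem_B hb hm (hle g (by lia) hg)
      rw [hU.ballFun_apply_pos hg, hU.ballFun_apply_pos ((hcond g h1).2 hg), h1, he]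
      rw [unifAbs]
      push_cast
      rw [inv_zpow, ← zpow_neg, mul_pow, mul_inv, mul_comm, ← zpow_natCast, ← zpow_mul, ← zpow_neg]
      congr 2
      push_cast
      ring
    · rw [hU.ballFun_apply_neg hg, mul_zero]
      refine hU.ballFun_apply_neg fun h => hg ?_
      have h1 := hU.normAbs_entry_mul_of_mem_B (inv_mem hb) (hU.isBounded_inv hm)
        (hle (g * b) (by lia) h)
      rw [mul_inv_cancel_right, entry_inv, hU.normAbs_conj] at h1
      change _ = _ * normAbs E (entry σ b 0 0) at h1
      refine (hcond g ?_).1 h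
      rw [h1, hU.normAbs_entry_diag hb, inv_mul_cancel_right₀ (normAbs_pos.2 hd0).ne']
  rw [heq, map_smul, smul_eq_mul, hU.functional_ballFun_sub hI hn']

/-- The functional is invariant under the whole group. -/
lemma Unramified.functional_invariant (g : G σ) (f : Ind (stChar σ)) :
    I (indRep (stChar σ) g f) = I f := by
  obtain ⟨m, hm⟩ := exists_isBounded g
  obtain ⟨N, hN⟩ := hU.exists_eq_sum_boxFun f
  -- The first bound is for the invariance under B, the second makes (n + 1) / 2 at least N.
  set n := max (6 * m + 2) (2 * N) with hn
  obtain ⟨S, c, hS, hf⟩ := hN ((n + 1) / 2) n (by lia) (by lia)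
  -- Decomposing the inverse puts the integral factor on the left, where I absorbs it. The factor in
  -- B inherits the bound m on the entries of g, independently of k.
  have key : ∀ k ∈ congruence σ 0, I (indRep (stChar σ) (g * k) (hU.ballFun n)) =
      I (hU.ballFun n) := by
    intro k hk
    obtain ⟨b, hb, k', hk', h⟩ := hU.iwasawa (g * k)⁻¹
    have h1 : g * k = k'⁻¹ * b⁻¹ := by rw [← mul_inv_rev, ← h, inv_inv]
    have h2 : b = (g * k)⁻¹ * k'⁻¹ := by rw [h, mul_inv_cancel_right]
    have hbm : IsBounded m b := by
      rw [h2]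
      exact hU.isBounded_mul (hU.isBounded_inv (hU.isBounded_mul hm hk)) (inv_mem hk')
    rw [h1, map_mul, Module.End.mul_apply, hI _ (inv_mem hk')]
    exact hU.functional_ballFun_of_mem_B hI (inv_mem hb) (hU.isBounded_inv hbm) (le_max_left _ _)
  have h0 : I f = ∑ s ∈ S, c s * I (hU.ballFun n) := by
    conv_lhs => rw [hf]
    rw [map_sum]
    refine Finset.sum_congr rfl fun s hs => ?_
    rw [map_smul, smul_eq_mul, hI s (hS s hs)]
    rfl
  rw [h0]
  conv_lhs => rw [hf]
  rw [map_sum, map_sum]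
  refine Finset.sum_congr rfl fun s hs => ?_
  rw [map_smul, map_smul, smul_eq_mul, ← Module.End.mul_apply, ← map_mul]
  congr 1
  exact key s (hS s hs)

end Invariance

end U3

end

noncomputable section

namespace U3

/-! ### Non-zero subrepresentations contain the kernel of the invariant functional -/

section Subrep

variable {F E : Type*} [Field F] [ValuativeRel F] [TopologicalSpace F]
  [IsNonarchimedeanLocalField F]
  [Field E] [ValuativeRel E] [TopologicalSpace E] [IsNonarchimedeanLocalField E]
  [Algebra F E] {σ : E ≃ₐ[F] E} {ϖ : F} (hU : Unramified σ ϖ)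

/-- The integral elements that fix a given vector. -/
def fixer (f : Ind (stChar σ)) : Subgroup (G σ) where
  carrier := {k | k ∈ congruence σ 0 ∧ indRep (stChar σ) k f = f}
  one_mem' := ⟨one_mem _, by simp⟩
  mul_mem' := fun {a b} ha hb => ⟨mul_mem ha.1 hb.1, by
    rw [map_mul, Module.End.mul_apply, hb.2, ha.2]⟩
  inv_mem' := fun {a} ha => ⟨inv_mem ha.1, by
    conv_lhs => rw [← ha.2]
    rw [← Module.End.mul_apply, ← map_mul, inv_mul_cancel, map_one, Module.End.one_apply]⟩

include hU

lemma Unramified.ball_or_dual (g : G σ) :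
    (normAbs E (entry σ g 2 0) ≤ normAbs E (entry σ g 2 2) ∧
      rowAbs g = normAbs E (entry σ g 2 2) ∧
      ¬ normAbs E (entry σ g 2 2) ≤ unifAbs E * normAbs E (entry σ g 2 0)) ∨
    (normAbs E (entry σ g 2 2) ≤ unifAbs E * normAbs E (entry σ g 2 0) ∧
      rowAbs g = normAbs E (entry σ g 2 0) ∧
      ¬ normAbs E (entry σ g 2 0) ≤ normAbs E (entry σ g 2 2)) := by
  have hpos := hU.rowAbs_pos g
  rcases le_or_gt (normAbs E (entry σ g 2 0)) (normAbs E (entry σ g 2 2)) with h | h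
  · have hr : rowAbs g = normAbs E (entry σ g 2 2) := max_eq_right h
    rw [hr] at hpos
    refine Or.inl ⟨h, hr, fun h' => ?_⟩
    exact ((h'.trans (mul_le_mul_right h _)).trans_lt
      (mul_lt_of_lt_one_left hpos (unifAbs_lt_one E))).false
  · exact Or.inr ⟨normAbs_le_unifAbs_mul h, max_eq_left h.le, h.not_ge⟩

lemma Unramified.sph_fixed {k : G σ} (hk : k ∈ congruence σ 0) :
    indRep (stChar σ) k hU.sph = hU.sph :=
  Subtype.ext (funext fun g => by rw [indRep_apply, hU.sph_apply, hU.sph_apply, hU.rowAbs_mul g hk])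

lemma Unramified.eq_smul_sph {f : Ind (stChar σ)}
    (hf : ∀ k ∈ congruence σ 0, indRep (stChar σ) k f = f) : f = f.val 1 • hU.sph := by
  refine hU.ext_of_integral fun k hk => ?_
  have h1 := congrArg (fun f : Ind (stChar σ) => f.val 1) (hf k hk)
  have h2 := congrArg (fun f : Ind (stChar σ) => f.val 1) (hU.sph_fixed hk)
  rw [indRep_apply, one_mul] at h1 h2
  rw [h1, Submodule.coe_smul, Pi.smul_apply, h2, hU.sph_apply]
  simp [rowAbs, entry_one]

omit hU [ValuativeRel F] [TopologicalSpace F] [IsNonarchimedeanLocalField F] in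
lemma flip_one_mem : flip σ 1 one_ne_zero ∈ congruence σ 0 :=
  flip_mem_congruence one_ne_zero (by simp)

omit hU [ValuativeRel F] [TopologicalSpace F] [IsNonarchimedeanLocalField F] [ValuativeRel E]
  [TopologicalSpace E] [IsNonarchimedeanLocalField E] in
lemma entry_mul_flip_one (g : G σ) (i : Fin 3) :
    entry σ (g * flip σ 1 one_ne_zero) i 0 = entry σ g i 2 ∧
    entry σ (g * flip σ 1 one_ne_zero) i 1 = entry σ g i 1 ∧
    entry σ (g * flip σ 1 one_ne_zero) i 2 = entry σ g i 0 := by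
  obtain ⟨h0, h1, h2⟩ := entry_mul_flip g 1 one_ne_zero i
  exact ⟨by simpa using h0, h1, by simpa using h2⟩

/-- By discreteness every row satisfies either |x| ≤ |z| or |z| ≤ r |x|. With the mass recursion
this fixes all masses of balls. -/
lemma Unramified.sph_eq_add :
    hU.sph = hU.ballFun 0 + indRep (stChar σ) (flip σ 1 one_ne_zero) (hU.ballFun 1) := by
  refine Subtype.ext (funext fun g => ?_)
  rw [Submodule.coe_add, Pi.add_apply, indRep_apply, hU.sph_apply]
  obtain ⟨h0, h1, h2⟩ := entry_mul_flip_one g 2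
  rcases hU.ball_or_dual g with ⟨h, hr, h'⟩ | ⟨h, hr, h'⟩
  · rw [hU.ballFun_apply_pos (by simpa using h), hU.ballFun_apply_neg, add_zero, hr]
    rwa [h0, h2, pow_one]
  · rw [hU.ballFun_apply_neg (by simpa using h'), hU.ballFun_apply_pos, zero_add, hr, h2]
    rwa [h0, h2, pow_one]

/-- The element `diag (ϖ⁻¹, 1, ϖ)`. -/
def Unramified.expand : G σ :=
  torus hU.conj_conj (algebraMap F E ϖ)⁻¹ (inv_ne_zero hU.unif_ne_zero)

lemma Unramified.normAbs_entry_mul_expand (g : G σ) (i : Fin 3) :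
    normAbs E (entry σ (g * hU.expand) i 0) = (unifAbs E)⁻¹ * normAbs E (entry σ g i 0) ∧
    entry σ (g * hU.expand) i 1 = entry σ g i 1 ∧
    normAbs E (entry σ (g * hU.expand) i 2) = unifAbs E * normAbs E (entry σ g i 2) := by
  obtain ⟨h0, h1, h2⟩ := entry_mul_torus hU.conj_conj g _ (inv_ne_zero hU.unif_ne_zero) i
  refine ⟨?_, h1, ?_⟩
  · rw [expand, h0, map_mul, map_inv₀, hU.normAbs_unif, mul_comm]
  · rw [expand, h2, map_inv₀, AlgEquiv.commutes, inv_inv, map_mul, hU.normAbs_unif, mul_comm]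

lemma Unramified.expand_ballFun (n : ℕ) : indRep (stChar σ) hU.expand (hU.ballFun n) =
    (((unifAbs E : ℝ) : ℂ) ^ 2)⁻¹ • hU.ballFun (n + 2) := by
  refine Subtype.ext (funext fun g => ?_)
  rw [Submodule.coe_smul, Pi.smul_apply, indRep_apply, smul_eq_mul]
  obtain ⟨h0, h1, h2⟩ := hU.normAbs_entry_mul_expand g 2
  have hiff : normAbs E (entry σ (g * hU.expand) 2 0) ≤
      unifAbs E ^ n * normAbs E (entry σ (g * hU.expand) 2 2) ↔
      normAbs E (entry σ g 2 0) ≤ unifAbs E ^ (n + 2) * normAbs E (entry σ g 2 2) := by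
    rw [h0, h2, inv_mul_le_iff₀ (unifAbs_pos E)]
    ring_nf
  by_cases h : normAbs E (entry σ g 2 0) ≤ unifAbs E ^ (n + 2) * normAbs E (entry σ g 2 2)
  · rw [hU.ballFun_apply_pos h, hU.ballFun_apply_pos (hiff.2 h), h2]
    push_cast
    rw [mul_pow, mul_inv]
  · rw [hU.ballFun_apply_neg h, hU.ballFun_apply_neg (mt hiff.1 h), mul_zero]

/-- The translate is a constant multiple of `sph` on each of the three shells |x| > r |z|, |x| = r
|z| and |x| ≤ r² |z|, with factors r², 1 and r⁻². -/
lemma Unramified.expand_sph : indRep (stChar σ) hU.expand hU.sph =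
    ((unifAbs E : ℝ) : ℂ) ^ 2 • hU.sph + (1 - ((unifAbs E : ℝ) : ℂ) ^ 2) • hU.ballFun 1 +
      ((((unifAbs E : ℝ) : ℂ) ^ 2)⁻¹ - 1) • hU.ballFun 2 := by
  refine Subtype.ext (funext fun g => ?_)
  simp only [Submodule.coe_add, Pi.add_apply, Submodule.coe_smul, Pi.smul_apply, smul_eq_mul]
  rw [indRep_apply, hU.sph_apply, hU.sph_apply]
  obtain ⟨h0, h1, h2⟩ := hU.normAbs_entry_mul_expand g 2
  have hr0 := unifAbs_pos E
  have hr1 := unifAbs_lt_one E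
  have hra : rowAbs (g * hU.expand) = max ((unifAbs E)⁻¹ * normAbs E (entry σ g 2 0))
      (unifAbs E * normAbs E (entry σ g 2 2)) := by rw [rowAbs, h0, h2]
  have hle1 : unifAbs E * normAbs E (entry σ g 2 2) ≤ normAbs E (entry σ g 2 2) :=
    mul_le_of_le_one_left zero_le hr1.le
  have hle2 : unifAbs E * (unifAbs E * normAbs E (entry σ g 2 2)) ≤
      unifAbs E * normAbs E (entry σ g 2 2) := by gcongr
  rcases le_or_gt (normAbs E (entry σ g 2 0)) (unifAbs E * normAbs E (entry σ g 2 2)) with h | h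
  · have hr : rowAbs g = normAbs E (entry σ g 2 2) := max_eq_right (h.trans hle1)
    rw [hU.ballFun_apply_pos (n := 1) (by rwa [pow_one])]
    rcases lt_or_ge (normAbs E (entry σ g 2 0)) (unifAbs E * normAbs E (entry σ g 2 2)) with h' | h'
    · have h3 : normAbs E (entry σ g 2 0) ≤
          unifAbs E * (unifAbs E * normAbs E (entry σ g 2 2)) := by
        rw [← hU.normAbs_unif, ← map_mul] at h'
        have := normAbs_le_unifAbs_mul h'
        rwa [map_mul, hU.normAbs_unif] at this
      rw [hU.ballFun_apply_pos (n := 2) (by rwa [sq, mul_assoc]), hr, hra, max_eq_right]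
      · push_cast
        rw [mul_pow, mul_inv]
        ring
      · rwa [inv_mul_le_iff₀ hr0]
    · have heq := le_antisymm h h'
      have hz := hU.rowAbs_pos g
      rw [hr] at hz
      rw [hU.ballFun_apply_neg (n := 2), hr, hra, heq, inv_mul_cancel_left₀ hr0.ne',
        max_eq_left hle1]
      · ring
      · rw [heq, sq, mul_assoc, not_le]
        exact mul_lt_of_lt_one_left (mul_pos hr0 hz) hr1
  · have h3 : normAbs E (entry σ g 2 2) ≤ normAbs E (entry σ g 2 0) := by
      rw [← hU.normAbs_unif, ← map_mul] at h
      have := normAbs_le_unifAbs_mul h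
      rwa [map_mul, hU.normAbs_unif, mul_le_mul_iff_right₀ hr0] at this
    have hr : rowAbs g = normAbs E (entry σ g 2 0) := max_eq_left h3
    rw [hU.ballFun_apply_neg (n := 1) (by rw [pow_one]; exact h.not_ge),
      hU.ballFun_apply_neg (n := 2) (by rw [sq, mul_assoc]; exact (hle2.trans_lt h).not_ge),
      hr, hra, max_eq_left]
    · push_cast
      rw [mul_pow, mul_inv, inv_pow, inv_inv]
      ring
    · rw [← mul_inv_le_iff₀' (inv_pos.2 hr0), inv_inv]
      calc _ ≤ normAbs E (entry σ g 2 2) * 1 * 1 := by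
            rw [mul_comm (unifAbs E)]
            gcongr
        _ ≤ _ := by rwa [mul_one, mul_one]

/-- Conjugation by the flip produces integral upper unipotents. They keep x and change z only by
multiples of x and y, which are small compared with z on the ball of radius 1. -/
lemma Unramified.flip_lower_flip_mem_fixer {x y : E} (h : y + σ y + x * σ x = 0)
    (hx : normAbs E x ≤ 1) (hy : normAbs E y ≤ 1) :
    flip σ 1 one_ne_zero * lower hU.conj_conj x y h * flip σ 1 one_ne_zero ∈
      fixer (hU.ballFun 1) := by
  set k := flip σ 1 one_ne_zero * lower hU.conj_conj x y h * flip σ 1 one_ne_zero with hk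
  have hkK : k ∈ congruence σ 0 := mul_mem (mul_mem flip_one_mem
    (hU.lower_mem_congruence h (by simpa using hx) (by simpa using hy))) flip_one_mem
  refine ⟨hkK, Subtype.ext (funext fun g => ?_)⟩
  rw [indRep_apply]
  have hrow : entry σ (g * k) 2 0 = entry σ g 2 0 ∧ entry σ (g * k) 2 2 =
      entry σ g 2 2 + entry σ g 2 1 * x + entry σ g 2 0 * y := by
    rw [hk, ← mul_assoc, ← mul_assoc]
    obtain ⟨a0, a1, a2⟩ := entry_mul_flip_one g 2
    obtain ⟨b0, b1, b2⟩ := entry_mul_lower hU.conj_conj (g * flip σ 1 one_ne_zero) x y h 2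
    obtain ⟨c0, c1, c2⟩ := entry_mul_flip_one
      (g * flip σ 1 one_ne_zero * lower hU.conj_conj x y h) 2
    exact ⟨by rw [c0, b2, a2], by rw [c2, b0, a0, a1, a2]⟩
  obtain ⟨h0, h2⟩ := hrow
  by_cases hg : normAbs E (entry σ g 2 0) ≤ unifAbs E ^ 1 * normAbs E (entry σ g 2 2)
  · have hb := (hU.box_iff (i := 1) (j := 1) (by norm_num) g).2 hg
    rw [pow_one] at hg
    have hz : 0 < normAbs E (entry σ g 2 2) := by
      have := hU.rowAbs_pos g
      rwa [rowAbs, max_eq_right (hg.trans (mul_le_of_le_one_left zero_le (unifAbs_lt_one E).le))]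
        at this
    have hb1 : normAbs E (entry σ g 2 1) ≤ unifAbs E * normAbs E (entry σ g 2 2) := by
      simpa using hb.1
    have h3 : normAbs E (entry σ (g * k) 2 2) = normAbs E (entry σ g 2 2) := by
      refine normAbs_eq_of_sub_lt (lt_of_le_of_lt ?_
        (mul_lt_of_lt_one_left hz (unifAbs_lt_one E)))
      rw [h2, add_assoc, add_sub_cancel_left]
      refine normAbs_add_le_of_le ?_ ?_
      · rw [map_mul]
        exact (mul_le_of_le_one_right zero_le hx).trans hb1
      · rw [map_mul]
        exact (mul_le_of_le_one_right zero_le hy).trans hg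
    rw [hU.ballFun_apply_pos, hU.ballFun_apply_pos, h3]
    · rwa [pow_one]
    · rwa [h0, h3, pow_one]
  · rw [hU.ballFun_apply_neg hg, hU.ballFun_apply_neg]
    intro h4
    rw [pow_one] at hg h4
    rw [h0] at h4
    rw [not_le] at hg
    have h5 : normAbs E (entry σ g 2 2) ≤ normAbs E (entry σ g 2 0) := by
      rw [← hU.normAbs_unif, ← map_mul] at hg
      have := normAbs_le_unifAbs_mul hg
      rwa [map_mul, hU.normAbs_unif, mul_le_mul_iff_right₀ (unifAbs_pos E)] at this
    have hr : rowAbs g = normAbs E (entry σ g 2 0) := max_eq_left h5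
    have h6 := hU.normAbs_entry_mul_le g hkK 2
    have hpos := hU.rowAbs_pos g
    rw [hr] at h6 hpos
    exact ((h4.trans (mul_le_mul_right h6 _)).trans_lt
      (mul_lt_of_lt_one_left hpos (unifAbs_lt_one E))).false

/-- Off the support of `ballFun 1` one has |z| ≤ |x|, and the integral upper unipotents act
transitively on these lines. So an invariant function is a multiple of `sph` there. -/
lemma Unramified.eq_of_fixer {f : Ind (stChar σ)} {c : ℂ}
    (hf : ∀ k ∈ fixer (hU.ballFun 1), indRep (stChar σ) k f = f)
    (hc : ∀ g, (hU.ballFun 1).val g ≠ 0 → f.val g = c * (hU.ballFun 1).val g) :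
    ∃ b : ℂ, f = c • hU.ballFun 1 + b • (hU.sph - hU.ballFun 1) := by
  refine ⟨f.val (flip σ 1 one_ne_zero), Subtype.ext (funext fun g => ?_)⟩
  simp only [Submodule.coe_add, Pi.add_apply, Submodule.coe_smul, Pi.smul_apply, smul_eq_mul,
    AddSubgroupClass.coe_sub, Pi.sub_apply]
  by_cases h : (hU.ballFun 1).val g ≠ 0
  · have h1 := hU.ballFun_ne_zero_iff.1 h
    rw [hc g h, hU.ballFun_apply_pos h1, hU.sph_apply, rowAbs, max_eq_right, sub_self, mul_zero,
      add_zero]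
    exact h1.trans (mul_le_of_le_one_left zero_le (pow_le_one₀ zero_le (unifAbs_lt_one E).le))
  · rw [not_not] at h
    rw [h, mul_zero, zero_add, sub_zero]
    have h1 : normAbs E (entry σ g 2 2) ≤ normAbs E (entry σ g 2 0) := by
      have h2 := mt hU.ballFun_ne_zero_iff.2 (not_not.2 h)
      rw [not_le, pow_one, ← hU.normAbs_unif, ← map_mul] at h2
      have := normAbs_le_unifAbs_mul h2
      rwa [map_mul, hU.normAbs_unif, mul_le_mul_iff_right₀ (unifAbs_pos E)] at this
    have hr : rowAbs g = normAbs E (entry σ g 2 0) := max_eq_left h1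
    have hpos := hU.rowAbs_pos g
    have h3 := hU.normAbs_entry_le_rowAbs g 1
    rw [hr] at hpos h3
    obtain ⟨a0, a1, a2⟩ := entry_mul_flip_one g 2
    obtain ⟨x, y, hxy, hx, hy, hrow⟩ := hU.exists_lower (g := g * flip σ 1 one_ne_zero)
      (by rw [a2]; exact normAbs_pos.1 hpos)
    rw [a1, a2] at hx
    rw [a0, a2] at hy
    have hfix := hf _ (hU.flip_lower_flip_mem_fixer hxy
      (hx ▸ div_le_one_of_le₀ h3 zero_le) (hy ▸ div_le_one_of_le₀ h1 zero_le))
    have h4 := congrArg (fun f : Ind (stChar σ) => f.val (flip σ 1 one_ne_zero)) hfix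
    rw [indRep_apply, ← mul_assoc, ← mul_assoc, flip_mul_flip, one_mul] at h4
    have h5 : g = g * flip σ 1 one_ne_zero * flip σ 1 one_ne_zero := by
      rw [mul_assoc, flip_mul_flip, mul_one]
    rw [← h4, hU.sph_apply, hr, mul_comm]
    refine hU.apply_eq_of_row f fun j => ?_
    conv_lhs => rw [h5]
    rw [entry_mul, entry_mul, Finset.mul_sum]
    exact Finset.sum_congr rfl fun m _ => by rw [hrow m, a2]; ring

variable {I : Ind (stChar σ) →ₗ[ℂ] ℂ}
    (hI : ∀ k ∈ congruence σ 0, ∀ f, I (indRep (stChar σ) k f) = I f) (hI1 : I hU.sph = 1)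

include hI hI1

/-- The total mass 1 is the sum of the masses of the balls of radius 0 and 1, that is, q⁴ + q times
that of radius 2. -/
lemma Unramified.functional_ballFun_two :
    I (hU.ballFun 2) * ((resCard F : ℂ) * ((resCard F : ℂ) ^ 3 + 1)) = 1 := by
  have h := congrArg I hU.sph_eq_add
  rw [hI1, map_add, hI _ flip_one_mem, hU.functional_ballFun_one hI,
    hU.functional_ballFun_add_two hI 0] at h
  linear_combination -h

omit hI hI1 hU in
lemma natCast_resCard_pow_add_one_ne_zero (K : Type*) [Field K] [ValuativeRel K]
    [TopologicalSpace K] [IsNonarchimedeanLocalField K] (n : ℕ) : (resCard K : ℂ) ^ n + 1 ≠ 0 := by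
  have : resCard K ^ n + 1 ≠ 0 := Nat.succ_ne_zero _
  exact_mod_cast this

lemma Unramified.functional_ballFun_two_eq :
    I (hU.ballFun 2) = ((resCard F : ℂ) * ((resCard F : ℂ) ^ 3 + 1))⁻¹ :=
  eq_inv_of_mul_eq_one_left (hU.functional_ballFun_two hI hI1)

lemma Unramified.functional_ballFun_one_eq :
    I (hU.ballFun 1) = ((resCard F : ℂ) ^ 3 + 1)⁻¹ := by
  have := natCast_resCard_ne_zero F
  have := natCast_resCard_pow_add_one_ne_zero F 3
  rw [hU.functional_ballFun_one hI, hU.functional_ballFun_two_eq hI hI1]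
  field_simp

lemma Unramified.functional_ballFun_zero_eq :
    I (hU.ballFun 0) = (resCard F : ℂ) ^ 3 * ((resCard F : ℂ) ^ 3 + 1)⁻¹ := by
  have := natCast_resCard_ne_zero F
  have := natCast_resCard_pow_add_one_ne_zero F 3
  rw [hU.functional_ballFun_add_two hI 0, hU.functional_ballFun_two_eq hI hI1]
  field_simp

variable (W : Subrepresentation (indRep (stChar σ)))

/-- N is the number of coset representatives summed over. The coefficient of `ballFun 1` is known
from the values of f on its support; the other one, b, is only known through I, which the summation
multiplies by N. -/
lemma Unramified.exists_average_mem {f : Ind (stChar σ)} (hf : f ∈ W.toSubmodule) {c : ℂ}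
    (hc : ∀ g, (hU.ballFun 1).val g ≠ 0 → f.val g = c * (hU.ballFun 1).val g) :
    ∃ (N : ℕ) (b : ℂ), N ≠ 0 ∧
      (N * c) • hU.ballFun 1 + b • (hU.sph - hU.ballFun 1) ∈ W.toSubmodule ∧
      N * I f = N * c * I (hU.ballFun 1) + b * (1 - I (hU.ballFun 1)) := by
  obtain ⟨S, hS0, hS, hfix⟩ := hU.exists_average (H := fixer (hU.ballFun 1)) (fun k hk => hk.1) f
  have hmem : ∑ s ∈ S, indRep (stChar σ) s f ∈ W.toSubmodule :=
    Submodule.sum_mem _ fun s _ => W.apply_mem_toSubmodule s hf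
  have hIs : I (∑ s ∈ S, indRep (stChar σ) s f) = S.card * I f := by
    rw [map_sum, Finset.sum_congr rfl fun s hs => hI s (hS s hs).1 f]
    simp
  obtain ⟨b, hb⟩ := hU.eq_of_fixer hfix (c := S.card * c) (by
    intro g hg
    rw [AddSubmonoidClass.coe_finsetSum, Finset.sum_apply]
    have : ∀ s ∈ S, (indRep (stChar σ) s f).val g = c * (hU.ballFun 1).val g := by
      intro s hs
      have h1 := congrArg (fun f : Ind (stChar σ) => f.val g) (hS s hs).2
      rw [indRep_apply] at h1
      rw [indRep_apply, hc _ (h1 ▸ hg), h1]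
    rw [Finset.sum_congr rfl this]
    simp [mul_assoc])
  refine ⟨S.card, b, hS0.card_ne_zero, hb ▸ hmem, ?_⟩
  rw [← hIs, hb, map_add, map_smul, map_smul, map_sub, hI1]
  simp

omit hI1 in
-- Summing over K gives a multiple of `sph` in W, and I shows that the multiple is not zero.
lemma Unramified.sph_mem {f : Ind (stChar σ)} (hf : f ∈ W.toSubmodule) (hIf : I f ≠ 0) :
    hU.sph ∈ W.toSubmodule := by
  obtain ⟨S, hS0, hS, hfix⟩ := hU.exists_average (le_refl (congruence σ 0)) f
  have hmem : ∑ s ∈ S, indRep (stChar σ) s f ∈ W.toSubmodule :=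
    Submodule.sum_mem _ fun s _ => W.apply_mem_toSubmodule s hf
  have hIs : I (∑ s ∈ S, indRep (stChar σ) s f) = S.card * I f := by
    rw [map_sum, Finset.sum_congr rfl fun s hs => hI s (hS s hs) f]
    simp
  set h := ∑ s ∈ S, indRep (stChar σ) s f with hh
  have heq : h = h.val 1 • hU.sph := hU.eq_smul_sph hfix
  have hne : h.val 1 ≠ 0 := by
    intro h0
    rw [heq, h0, zero_smul, map_zero] at hIs
    exact mul_ne_zero (Nat.cast_ne_zero.2 hS0.card_ne_zero) hIf hIs.symm
  rw [heq] at hmem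
  exact (Submodule.smul_mem_iff _ hne).1 hmem

/-- Contraction and averaging give a vector of W in the plane spanned by `ballFun 1` and `sph`, with
a non-zero coefficient on the ball. Either it lies in ker I, which meets the plane in the required
line, or W contains `sph`, and then the whole plane. -/
lemma Unramified.ballFun_one_sub_mem (hW : W.toSubmodule ≠ ⊥) :
    hU.ballFun 1 - I (hU.ballFun 1) • hU.sph ∈ W.toSubmodule := by
  have hr0 := unifAbs_pos E
  have hv1 : 1 - I (hU.ballFun 1) ≠ 0 := by
    have h0 := natCast_resCard_ne_zero F
    have h1 := natCast_resCard_pow_add_one_ne_zero F 3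
    have h2 : 1 - ((resCard F : ℂ) ^ 3 + 1)⁻¹ =
        (resCard F : ℂ) ^ 3 * ((resCard F : ℂ) ^ 3 + 1)⁻¹ := by
      field_simp
      ring
    rw [hU.functional_ballFun_one_eq hI hI1, h2]
    exact mul_ne_zero (pow_ne_zero _ h0) (inv_ne_zero h1)
  obtain ⟨f, hf, hf0⟩ := Submodule.exists_mem_ne_zero_of_ne_bot hW
  obtain ⟨g, hg⟩ : ∃ g, f.val g ≠ 0 := by
    by_contra! h
    exact hf0 (Subtype.ext (funext h))
  set f₁ := indRep (stChar σ) g f with hf₁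
  have hf₁1 : f₁.val 1 ≠ 0 := by rwa [hf₁, indRep_apply, one_mul]
  obtain ⟨n, hn⟩ := hU.exists_fixed f₁
  have hp := pow_ne_zero n hU.unif_ne_zero
  set t := torus hU.conj_conj _ hp with ht
  -- Right multiplication by diag(ϖⁿ, 1, ϖ⁻ⁿ) contracts the ball |x| ≤ r |z| so far that its rows
  -- become, up to scalars, those of lower unipotents of level n, which fix f₁.
  have hc : ∀ g, (hU.ballFun 1).val g ≠ 0 → (indRep (stChar σ) t f₁).val g =
      (((unifAbs E : ℝ) : ℂ) ^ n) ^ 2 * f₁.val 1 * (hU.ballFun 1).val g := by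
    intro g hg
    have hg1 := hU.ballFun_ne_zero_iff.1 hg
    rw [hU.ballFun_apply_pos hg1]
    rw [pow_one] at hg1
    have hle : normAbs E (entry σ g 2 0) ≤ normAbs E (entry σ g 2 2) :=
      hg1.trans (mul_le_of_le_one_left zero_le (unifAbs_lt_one E).le)
    have hr : rowAbs g = normAbs E (entry σ g 2 2) := max_eq_right hle
    have hz := hU.rowAbs_pos g
    have h1 := hU.normAbs_entry_le_rowAbs g 1
    rw [hr] at hz h1
    obtain ⟨e0, e1, e2⟩ := entry_mul_torus hU.conj_conj g _ hp 2
    have hz0 := normAbs_pos.1 hz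
    have e2' : normAbs E (entry σ (g * t) 2 2) = normAbs E (entry σ g 2 2) * (unifAbs E ^ n)⁻¹ := by
      rw [ht, e2, map_mul, map_inv₀, hU.normAbs_conj, hU.normAbs_unif_pow]
    have e0' : normAbs E (entry σ (g * t) 2 0) = normAbs E (entry σ g 2 0) * unifAbs E ^ n := by
      rw [ht, e0, map_mul, hU.normAbs_unif_pow]
    have hpn := pow_pos hr0 n
    have hz' : 0 < normAbs E (entry σ (g * t) 2 2) := by
      rw [e2']
      exact mul_pos hz (inv_pos.2 hpn)
    obtain ⟨x, y, hxy, hx, hy, hrow⟩ := hU.exists_lower (normAbs_pos.1 hz')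
    have hu : lower hU.conj_conj x y hxy ∈ congruence σ n := by
      refine hU.lower_mem_congruence hxy ?_ ?_
      · rw [hx, ht, e1, ← ht, e2', div_le_iff₀ (by rwa [e2'] at hz'), mul_comm (_ ^ n), mul_assoc,
          inv_mul_cancel₀ hpn.ne', mul_one]
        exact h1
      · rw [hy, e0', e2', div_le_iff₀ (by rwa [e2'] at hz'), mul_comm (unifAbs E ^ n), mul_assoc,
          inv_mul_cancel₀ hpn.ne', mul_one]
        exact (mul_le_of_le_one_right zero_le
          (pow_le_one₀ zero_le (unifAbs_lt_one E).le)).trans hle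
    have h2 := congrArg (fun f : Ind (stChar σ) => f.val 1) (hn _ hu)
    rw [indRep_apply, one_mul] at h2
    rw [indRep_apply, hU.apply_eq_of_row f₁ hrow, h2, e2']
    push_cast
    rw [mul_pow, mul_inv, inv_pow, inv_inv]
    ring
  obtain ⟨N, b, hN, hmem, hmass⟩ := hU.exists_average_mem hI hI1 W
    (W.apply_mem_toSubmodule t (W.apply_mem_toSubmodule g hf)) hc
  rw [← hf₁] at hmass
  set c : ℂ := (((unifAbs E : ℝ) : ℂ) ^ n) ^ 2 * f₁.val 1 with hcdef
  have hc0 : (N : ℂ) * c ≠ 0 := by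
    have : ((unifAbs E : ℝ) : ℂ) ≠ 0 := by exact_mod_cast unifAbs_ne_zero E
    exact mul_ne_zero (Nat.cast_ne_zero.2 hN) (mul_ne_zero (pow_ne_zero _ (pow_ne_zero _ this)) hf₁1)
  set d : ℂ := N * c with hd
  by_cases h0 : d * I (hU.ballFun 1) + b * (1 - I (hU.ballFun 1)) = 0
  · have hdb : d - b ≠ 0 := by
      intro h
      have hb : b = d := (sub_eq_zero.1 h).symm
      rw [hb] at h0
      exact hc0 (by linear_combination h0)
    have heq : d • hU.ballFun 1 + b • (hU.sph - hU.ballFun 1) =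
        (d - b) • (hU.ballFun 1 - I (hU.ballFun 1) • hU.sph) := by
      have hb : b = -(d - b) * I (hU.ballFun 1) := by linear_combination h0
      rw [smul_sub (d - b), smul_smul]
      nth_rewrite 1 [smul_sub, hb]
      module
    rw [heq] at hmem
    exact (Submodule.smul_mem_iff _ hdb).1 hmem
  · have hsph : hU.sph ∈ W.toSubmodule := by
      refine hU.sph_mem hI W hmem ?_
      rw [map_add, map_smul, map_smul, map_sub, hI1]
      exact h0
    -- The inverse of `expand` multiplies `sph` by r² on the support of `ballFun 1`, so f₂ vanishes
    -- there, but I f₂ = 1 - r² ≠ 0. Its average is thus a non-zero multiple of `sph - ballFun 1`.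
    set f₂ := indRep (stChar σ) hU.expand⁻¹ hU.sph - (((unifAbs E : ℝ) : ℂ) ^ 2) • hU.sph with hf₂
    have hf₂mem : f₂ ∈ W.toSubmodule :=
      sub_mem (W.apply_mem_toSubmodule _ hsph) (Submodule.smul_mem _ _ hsph)
    have hIf₂ : I f₂ = 1 - ((unifAbs E : ℝ) : ℂ) ^ 2 := by
      rw [hf₂, map_sub, hU.functional_invariant hI, map_smul, hI1, smul_eq_mul, mul_one]
    have hc₂ : ∀ g, (hU.ballFun 1).val g ≠ 0 → f₂.val g = 0 * (hU.ballFun 1).val g := by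
      intro g hg
      have hg1 := hU.ballFun_ne_zero_iff.1 hg
      rw [pow_one] at hg1
      have hle : normAbs E (entry σ g 2 0) ≤ normAbs E (entry σ g 2 2) :=
        hg1.trans (mul_le_of_le_one_left zero_le (unifAbs_lt_one E).le)
      obtain ⟨e0, -, e2⟩ := hU.normAbs_entry_mul_expand (g * hU.expand⁻¹) 2
      rw [inv_mul_cancel_right] at e0 e2
      have e0' := (eq_inv_mul_iff_mul_eq₀ hr0.ne').1 e0
      have e2' := (inv_mul_eq_iff_eq_mul₀ hr0.ne').2 e2
      have hr : rowAbs (g * hU.expand⁻¹) = (unifAbs E)⁻¹ * normAbs E (entry σ g 2 2) := by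
        rw [rowAbs, ← e0', ← e2']
        refine max_eq_right ?_
        calc _ ≤ 1 * normAbs E (entry σ g 2 2) := mul_le_mul' (unifAbs_lt_one E).le hle
          _ ≤ _ := by gcongr; exact (one_le_inv₀ hr0).2 (unifAbs_lt_one E).le
      rw [hf₂, AddSubgroupClass.coe_sub, Pi.sub_apply, indRep_apply, hU.sph_apply, hr,
        Submodule.coe_smul, Pi.smul_apply, hU.sph_apply, rowAbs, max_eq_right hle, smul_eq_mul]
      push_cast
      rw [mul_pow, mul_inv, inv_pow, inv_inv]
      ring
    obtain ⟨N', b', hN', hmem', hmass'⟩ := hU.exists_average_mem hI hI1 W hf₂mem hc₂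
    have hb' : b' ≠ 0 := by
      intro h
      rw [h, hIf₂] at hmass'
      have h1 : (N' : ℂ) * (1 - ((unifAbs E : ℝ) : ℂ) ^ 2) = 0 := by linear_combination hmass'
      rcases mul_eq_zero.1 h1 with h1 | h1
      · exact hN' (Nat.cast_eq_zero.1 h1)
      · have h2 : unifAbs E ^ 2 = 1 := by
          have : ((unifAbs E : ℝ) : ℂ) ^ 2 = 1 := by linear_combination -h1
          exact_mod_cast this
        exact (pow_lt_one₀ zero_le (unifAbs_lt_one E) _root_.two_ne_zero).ne h2
    rw [mul_zero, zero_smul, zero_add] at hmem'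
    have h3 := (Submodule.smul_mem_iff _ hb').1 hmem'
    have h4 := sub_mem hsph h3
    rw [sub_sub_cancel] at h4
    exact sub_mem h4 (Submodule.smul_mem _ _ hsph)

end Subrep

end U3

end

noncomputable section

namespace U3

/-! ### Generation of the kernel of the invariant functional. -/

section Kernel

variable {F E : Type*} [Field F] [ValuativeRel F] [TopologicalSpace F]
  [IsNonarchimedeanLocalField F]
  [Field E] [ValuativeRel E] [TopologicalSpace E] [IsNonarchimedeanLocalField E]
  [Algebra F E] {σ : E ≃ₐ[F] E} {ϖ : F} (hU : Unramified σ ϖ)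
  {I : Ind (stChar σ) →ₗ[ℂ] ℂ}
  (hI : ∀ k ∈ congruence σ 0, ∀ f, I (indRep (stChar σ) k f) = I f) (hI1 : I hU.sph = 1)
  (W : Subrepresentation (indRep (stChar σ)))

include hU hI hI1

/-- The flip exchanges radius 1 with the complement of radius 0, and `expand` raises radii by 2. It
does not fix `sph`, but `expand_sph` puts the difference of `sph` and its translate in W once radii
1 and 2 are known. -/
lemma Unramified.ballFun_sub_mem (hW : W.toSubmodule ≠ ⊥) (k : ℕ) :
    hU.ballFun (2 * k) - I (hU.ballFun (2 * k)) • hU.sph ∈ W.toSubmodule := by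
  have hq := natCast_resCard_ne_zero F
  have hq3 := natCast_resCard_pow_add_one_ne_zero F 3
  have hq1 : (resCard F : ℂ) + 1 ≠ 0 := by
    simpa using natCast_resCard_pow_add_one_ne_zero F 1
  have hr := hU.unifAbs_eq_inv
  have h1 := hU.ballFun_one_sub_mem hI hI1 W hW
  have hI0 := hU.functional_ballFun_zero_eq hI hI1
  have hI1' := hU.functional_ballFun_one_eq hI hI1
  have hI2 := hU.functional_ballFun_two_eq hI hI1
  have hsph := hU.expand_sph
  rw [hr] at hsph
  have h0 : hU.ballFun 0 - I (hU.ballFun 0) • hU.sph ∈ W.toSubmodule := by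
    have heq : hU.ballFun 0 - I (hU.ballFun 0) • hU.sph = -indRep (stChar σ)
        (flip σ 1 one_ne_zero) (hU.ballFun 1 - I (hU.ballFun 1) • hU.sph) := by
      have h2 : hU.ballFun 0 = hU.sph -
          indRep (stChar σ) (flip σ 1 one_ne_zero) (hU.ballFun 1) := by
        conv_rhs => rw [hU.sph_eq_add]
        rw [add_sub_cancel_right]
      have h3 : I (hU.ballFun 0) = 1 - I (hU.ballFun 1) := by
        rw [hI0, hI1']
        field_simp
        ring
      rw [map_sub, map_smul, hU.sph_fixed flip_one_mem, h3, h2]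
      module
    rw [heq]
    exact neg_mem (W.apply_mem_toSubmodule _ h1)
  have h2 : hU.ballFun 2 - I (hU.ballFun 2) • hU.sph ∈ W.toSubmodule := by
    have h3 := W.apply_mem_toSubmodule hU.expand h0
    -- This is the coefficient q⁴ - I(`ballFun 0`) (q⁴ - 1) of `ballFun 2` in the translate by
    -- `expand`.
    have hA : (resCard F : ℂ) ^ 3 * ((resCard F : ℂ) + 1) / ((resCard F : ℂ) ^ 3 + 1) ≠ 0 :=
      div_ne_zero (mul_ne_zero (pow_ne_zero _ hq) hq1) hq3
    refine (Submodule.smul_mem_iff _ hA).1 ?_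
    have heq : ((resCard F : ℂ) ^ 3 * ((resCard F : ℂ) + 1) / ((resCard F : ℂ) ^ 3 + 1)) •
        (hU.ballFun 2 - I (hU.ballFun 2) • hU.sph) =
        indRep (stChar σ) hU.expand (hU.ballFun 0 - I (hU.ballFun 0) • hU.sph) +
        (I (hU.ballFun 0) * (1 - (((resCard F : ℂ) ^ 2)⁻¹) ^ 2)) •
          (hU.ballFun 1 - I (hU.ballFun 1) • hU.sph) := by
      rw [map_sub, map_smul, hU.expand_ballFun, hsph, hr, hI0, hI1', hI2]
      match_scalars <;> field_simp <;> ring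
    rw [heq]
    exact add_mem h3 (Submodule.smul_mem _ _ h1)
  have hpsi : indRep (stChar σ) hU.expand hU.sph - hU.sph ∈ W.toSubmodule := by
    have heq : indRep (stChar σ) hU.expand hU.sph - hU.sph =
        (1 - (((resCard F : ℂ) ^ 2)⁻¹) ^ 2) • (hU.ballFun 1 - I (hU.ballFun 1) • hU.sph) +
        (((((resCard F : ℂ) ^ 2)⁻¹) ^ 2)⁻¹ - 1) •
          (hU.ballFun 2 - I (hU.ballFun 2) • hU.sph) := by
      rw [hsph, hI1', hI2]
      match_scalars <;> field_simp <;> ring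
    rw [heq]
    exact add_mem (Submodule.smul_mem _ _ h1) (Submodule.smul_mem _ _ h2)
  induction k with
  | zero => exact h0
  | succ k ih =>
    have heq : hU.ballFun (2 * (k + 1)) - I (hU.ballFun (2 * (k + 1))) • hU.sph =
        ((((resCard F : ℂ) ^ 2)⁻¹) ^ 2) • (indRep (stChar σ) hU.expand
          (hU.ballFun (2 * k) - I (hU.ballFun (2 * k)) • hU.sph) +
          I (hU.ballFun (2 * k)) • (indRep (stChar σ) hU.expand hU.sph - hU.sph)) := by
      rw [map_sub, map_smul, hU.expand_ballFun, hU.functional_ballFun_add_two hI (2 * k), hr,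
        mul_add 2 k 1, mul_one]
      match_scalars <;> field_simp <;> ring
    rw [heq]
    exact Submodule.smul_mem _ _ (add_mem (W.apply_mem_toSubmodule _ ih)
      (Submodule.smul_mem _ _ hpsi))

/-- Every non-zero subrepresentation contains the kernel of the invariant functional. -/
lemma Unramified.ker_le (hW : W.toSubmodule ≠ ⊥) : LinearMap.ker I ≤ W.toSubmodule := by
  intro f hf
  rw [LinearMap.mem_ker] at hf
  obtain ⟨N, hN⟩ := hU.exists_eq_sum_boxFun f
  -- The radius is even, as `ballFun_sub_mem` requires, and its box has indices 2 N and 4 N, both at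
  -- least N.
  obtain ⟨S, c, hS, hfS⟩ := hN ((2 * (2 * N) + 1) / 2) (2 * (2 * N)) (by lia) (by lia)
  change f = ∑ s ∈ S, c s • indRep (stChar σ) s (hU.ballFun (2 * (2 * N))) at hfS
  set D := hU.ballFun (2 * (2 * N)) with hD
  -- Since `sph` is fixed by K, this vanishing allows I(D) · `sph` to be subtracted from every D
  -- without changing the sum.
  have h0 : (∑ s ∈ S, c s) * I D = 0 := by
    rw [← hf]
    conv_rhs => rw [hfS]
    rw [map_sum, Finset.sum_mul]
    refine Finset.sum_congr rfl fun s hs => ?_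
    rw [map_smul, smul_eq_mul, hI s (hS s hs)]
  have h1 : f = ∑ s ∈ S, c s • indRep (stChar σ) s (D - I D • hU.sph) := by
    have h2 : ∀ s ∈ S, c s • indRep (stChar σ) s (D - I D • hU.sph) =
        c s • indRep (stChar σ) s D - (c s * I D) • hU.sph := by
      intro s hs
      rw [map_sub, map_smul, hU.sph_fixed (hS s hs), smul_sub, smul_smul]
    rw [Finset.sum_congr rfl h2, Finset.sum_sub_distrib, ← Finset.sum_smul, ← Finset.sum_mul, h0,
      zero_smul, sub_zero]
    exact hfS
  rw [h1]
  exact Submodule.sum_mem _ fun s _ => Submodule.smul_mem _ _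
    (W.apply_mem_toSubmodule _ (hU.ballFun_sub_mem hI hI1 W hW _))

end Kernel

end U3

end

noncomputable section

namespace U3

/-! ### The groups `K_n` -/

section Level

variable {F E : Type*} [Field F] [ValuativeRel F] [TopologicalSpace F]
  [IsNonarchimedeanLocalField F]
  [Field E] [ValuativeRel E] [TopologicalSpace E] [IsNonarchimedeanLocalField E]
  [Algebra F E] {σ : E ≃ₐ[F] E} {ϖ : F} (hU : Unramified σ ϖ)

omit [ValuativeRel F] [TopologicalSpace F] [IsNonarchimedeanLocalField F] in
lemma mem_Kn {n : ℕ} {g : G σ} : g ∈ Kn σ n ↔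
    normAbs E (entry σ g 0 0) ≤ 1 ∧ normAbs E (entry σ g 0 1) ≤ 1 ∧
    normAbs E (entry σ g 0 2) ≤ (unifAbs E ^ n)⁻¹ ∧
    normAbs E (entry σ g 1 0) ≤ unifAbs E ^ n ∧ normAbs E (entry σ g 1 1 - 1) ≤ unifAbs E ^ n ∧
    normAbs E (entry σ g 1 2) ≤ 1 ∧
    normAbs E (entry σ g 2 0) ≤ unifAbs E ^ n ∧ normAbs E (entry σ g 2 1) ≤ unifAbs E ^ n ∧
    normAbs E (entry σ g 2 2) ≤ 1 := by
  simp only [Kn, Set.mem_ofPred_eq, mem_primePow, zpow_zero, zpow_neg, zpow_natCast]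

omit [ValuativeRel F] [TopologicalSpace F] [IsNonarchimedeanLocalField F] in
lemma normAbs_mul_le {x y : E} {a b c : ℝ≥0} (hx : normAbs E x ≤ a) (hy : normAbs E y ≤ b)
    (h : a * b ≤ c) : normAbs E (x * y) ≤ c := by
  rw [map_mul]
  exact (mul_le_mul' hx hy).trans h

include hU

/-- The set `K_n` as a subgroup. -/
def Unramified.level (n : ℕ) : Subgroup (G σ) where
  carrier := Kn σ n
  one_mem' := by
    rw [mem_Kn]
    simp [entry_one]
  mul_mem' := by
    intro g h hg hh
    rw [mem_Kn] at hg hh ⊢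
    obtain ⟨a00, a01, a02, a10, a11, a12, a20, a21, a22⟩ := hg
    obtain ⟨b00, b01, b02, b10, b11, b12, b20, b21, b22⟩ := hh
    have hr : unifAbs E ^ n ≠ 0 := pow_ne_zero _ (unifAbs_ne_zero E)
    have hr1 : unifAbs E ^ n ≤ 1 := pow_le_one₀ zero_le (unifAbs_lt_one E).le
    have hri : 1 ≤ (unifAbs E ^ n)⁻¹ := (one_le_inv₀ (pow_pos (unifAbs_pos E) n)).2 hr1
    have hrr : unifAbs E ^ n * unifAbs E ^ n ≤ unifAbs E ^ n := mul_le_of_le_one_left zero_le hr1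
    have c11 : ∀ {x : E}, normAbs E (x - 1) ≤ unifAbs E ^ n → normAbs E x ≤ 1 := fun {x} h => by
      have := normAbs_add_le_of_le (h.trans hr1) (map_one (normAbs E)).le
      rwa [sub_add_cancel] at this
    have a11' := c11 a11
    have b11' := c11 b11
    simp only [entry_mul, Fin.sum_univ_three]
    have key : entry σ g 1 0 * entry σ h 0 1 + entry σ g 1 1 * entry σ h 1 1 +
        entry σ g 1 2 * entry σ h 2 1 - 1 = entry σ g 1 0 * entry σ h 0 1 +
        ((entry σ g 1 1 - 1) * entry σ h 1 1 + (entry σ h 1 1 - 1)) +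
        entry σ g 1 2 * entry σ h 2 1 := by ring
    rw [key]
    refine ⟨?_, ?_, ?_, ?_, ?_, ?_, ?_, ?_, ?_⟩
    · exact normAbs_add_le_of_le (normAbs_add_le_of_le (normAbs_mul_le a00 b00 (by simp))
        (normAbs_mul_le a01 b10 (by simpa))) (normAbs_mul_le a02 b20 (by simp [hr]))
    · exact normAbs_add_le_of_le (normAbs_add_le_of_le (normAbs_mul_le a00 b01 (by simp))
        (normAbs_mul_le a01 b11' (by simp))) (normAbs_mul_le a02 b21 (by simp [hr]))
    · exact normAbs_add_le_of_le (normAbs_add_le_of_le (normAbs_mul_le a00 b02 (by simp))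
        (normAbs_mul_le a01 b12 (by simpa))) (normAbs_mul_le a02 b22 (by simp))
    · exact normAbs_add_le_of_le (normAbs_add_le_of_le (normAbs_mul_le a10 b00 (by simp))
        (normAbs_mul_le a11' b10 (by simp))) (normAbs_mul_le a12 b20 (by simp))
    · exact normAbs_add_le_of_le (normAbs_add_le_of_le (normAbs_mul_le a10 b01 (by simp))
        (normAbs_add_le_of_le (normAbs_mul_le a11 b11' (by simp)) b11))
        (normAbs_mul_le a12 b21 (by simp))
    · exact normAbs_add_le_of_le (normAbs_add_le_of_le (normAbs_mul_le a10 b02 (by simp [hr]))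
        (normAbs_mul_le a11' b12 (by simp))) (normAbs_mul_le a12 b22 (by simp))
    · exact normAbs_add_le_of_le (normAbs_add_le_of_le (normAbs_mul_le a20 b00 (by simp))
        (normAbs_mul_le a21 b10 hrr)) (normAbs_mul_le a22 b20 (by simp))
    · exact normAbs_add_le_of_le (normAbs_add_le_of_le (normAbs_mul_le a20 b01 (by simp))
        (normAbs_mul_le a21 b11' (by simp))) (normAbs_mul_le a22 b21 (by simp))
    · exact normAbs_add_le_of_le (normAbs_add_le_of_le (normAbs_mul_le a20 b02 (by simp [hr]))
        (normAbs_mul_le a21 b12 (by simpa))) (normAbs_mul_le a22 b22 (by simp))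
  inv_mem' := by
    intro g hg
    rw [mem_Kn] at hg ⊢
    obtain ⟨a00, a01, a02, a10, a11, a12, a20, a21, a22⟩ := hg
    have h1 : σ (entry σ g 1 1) - 1 = σ (entry σ g 1 1 - 1) := by rw [map_sub, map_one]
    have e0 : Fin.rev (0 : Fin 3) = 2 := rfl
    have e1 : Fin.rev (1 : Fin 3) = 1 := rfl
    have e2 : Fin.rev (2 : Fin 3) = 0 := rfl
    simp only [entry_inv, e0, e1, e2, h1, hU.normAbs_conj]
    exact ⟨a22, a12, a02, a21, a11, a01, a20, a10, a00⟩

lemma Unramified.mem_level {n : ℕ} {g : G σ} : g ∈ hU.level n ↔ g ∈ Kn σ n := Iff.rfl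

lemma Unramified.lower_mem_level {n : ℕ} {x y : E} (h : y + σ y + x * σ x = 0)
    (hx : normAbs E x ≤ unifAbs E ^ n) (hy : normAbs E y ≤ unifAbs E ^ n) :
    lower hU.conj_conj x y h ∈ hU.level n := by
  rw [hU.mem_level, mem_Kn]
  simp [lower, entry_mkG, normAbs_neg, hU.normAbs_conj, hx, hy]

lemma Unramified.flip_mem_level (n : ℕ) (h : ϖ ^ n ≠ 0) : flip σ (ϖ ^ n) h ∈ hU.level n := by
  rw [hU.mem_level, mem_Kn]
  simp [flip, entry_mkG, hU.normAbs_unif]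

lemma Unramified.torus_mem_level {n : ℕ} {a : E} (ha : normAbs E a = 1) :
    torus hU.conj_conj a (normAbs_pos.1 (ha ▸ one_pos)) ∈ hU.level n := by
  rw [hU.mem_level, mem_Kn]
  simp [torus, entry_mkG, hU.normAbs_conj, ha]

/-- The norm of the bottom row that is invariant under `K_n`. -/
def levelAbs (n : ℕ) (g : G σ) : ℝ≥0 :=
  max ((unifAbs E ^ n)⁻¹ * normAbs E (entry σ g 2 0)) (normAbs E (entry σ g 2 2))

omit hU [ValuativeRel F] [TopologicalSpace F] [IsNonarchimedeanLocalField F] in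
lemma levelAbs_eq_right {n : ℕ} {g : G σ}
    (h : normAbs E (entry σ g 2 0) ≤ unifAbs E ^ n * normAbs E (entry σ g 2 2)) :
    levelAbs n g = normAbs E (entry σ g 2 2) :=
  max_eq_right ((inv_mul_le_iff₀ (pow_pos (unifAbs_pos E) n)).2 h)

omit hU [ValuativeRel F] [TopologicalSpace F] [IsNonarchimedeanLocalField F] in
lemma levelAbs_eq_left {n : ℕ} {g : G σ}
    (h : unifAbs E ^ n * normAbs E (entry σ g 2 2) ≤ normAbs E (entry σ g 2 0)) :
    levelAbs n g = (unifAbs E ^ n)⁻¹ * normAbs E (entry σ g 2 0) :=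
  max_eq_left ((le_inv_mul_iff₀ (pow_pos (unifAbs_pos E) n)).2 h)

omit hU [ValuativeRel F] [TopologicalSpace F] [IsNonarchimedeanLocalField F] in
lemma rowAbs_le_levelAbs (n : ℕ) (g : G σ) : rowAbs g ≤ levelAbs n g :=
  max_le_max_right _ (le_mul_of_one_le_left zero_le
    ((one_le_inv₀ (pow_pos (unifAbs_pos E) n)).2 (pow_le_one₀ zero_le (unifAbs_lt_one E).le)))

lemma Unramified.levelAbs_pos (n : ℕ) (g : G σ) : 0 < levelAbs n g :=
  (hU.rowAbs_pos g).trans_le (rowAbs_le_levelAbs n g)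

/-- A condition for the bottom row to be proportional to that of an element of `K_n`. -/
lemma Unramified.exists_mem_level {n : ℕ} {g : G σ}
    (h1 : normAbs E (entry σ g 2 1) ≤ unifAbs E ^ n * levelAbs n g) :
    ∃ k ∈ hU.level n, ∃ l, normAbs E l = levelAbs n g ∧
      ∀ j, entry σ g 2 j = l * entry σ k 2 j := by
  have key : ∀ g : G σ,
      normAbs E (entry σ g 2 0) ≤ unifAbs E ^ n * normAbs E (entry σ g 2 2) →
      normAbs E (entry σ g 2 1) ≤ unifAbs E ^ n * normAbs E (entry σ g 2 2) →
      ∃ k ∈ hU.level n, ∀ j, entry σ g 2 j = entry σ g 2 2 * entry σ k 2 j := by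
    intro g h0 h1
    have hz := hU.levelAbs_pos n g
    rw [levelAbs_eq_right h0] at hz
    obtain ⟨x, y, h, hx, hy, hrow⟩ := hU.exists_lower (normAbs_pos.1 hz)
    exact ⟨_, hU.lower_mem_level h (hx ▸ (div_le_iff₀ hz).2 h1) (hy ▸ (div_le_iff₀ hz).2 h0), hrow⟩
  have hr := pow_pos (unifAbs_pos E) n
  rcases le_total (normAbs E (entry σ g 2 0)) (unifAbs E ^ n * normAbs E (entry σ g 2 2)) with h | h
  · rw [levelAbs_eq_right h] at h1 ⊢
    obtain ⟨k, hk, hrow⟩ := key g h h1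
    exact ⟨k, hk, _, rfl, hrow⟩
  · rw [levelAbs_eq_left h] at h1 ⊢
    have hp : ϖ ^ n ≠ 0 := fun h0 => pow_ne_zero n hU.unif_ne_zero (by rw [← map_pow, h0, map_zero])
    -- This element of K_n exchanges the two terms of `levelAbs`, reducing to the case where z
    -- dominates.
    set w := flip σ (ϖ ^ n) hp with hw
    obtain ⟨e0, e1, e2⟩ := entry_mul_flip g _ hp 2
    have e0' : normAbs E (entry σ (g * w) 2 0) = unifAbs E ^ n * normAbs E (entry σ g 2 2) := by
      rw [hw, e0, map_mul, map_pow, hU.normAbs_unif_pow, mul_comm]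
    have e2' : normAbs E (entry σ (g * w) 2 2) = (unifAbs E ^ n)⁻¹ * normAbs E (entry σ g 2 0) := by
      rw [hw, e2, map_mul, map_inv₀, map_pow, map_inv₀, hU.normAbs_unif_pow, mul_comm]
    obtain ⟨k, hk, hrow⟩ := key (g * w) (by
      rw [e0', e2', mul_inv_cancel_left₀ hr.ne']
      exact h) (by rwa [e2', hw, e1])
    refine ⟨k * w, mul_mem hk (hU.flip_mem_level n hp), entry σ (g * w) 2 2, e2', fun j => ?_⟩
    have h5 : g = g * w * w := by rw [mul_assoc, hw, flip_mul_flip, mul_one]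
    conv_lhs => rw [h5]
    rw [entry_mul σ (g * w) w, entry_mul σ k w, Finset.mul_sum]
    exact Finset.sum_congr rfl fun m _ => by rw [hrow m]; ring

lemma Unramified.apply_eq_of_level {n : ℕ} {f : Ind (stChar σ)}
    (hf : f ∈ fixed (indRep (stChar σ)) n) {g : G σ}
    (h1 : normAbs E (entry σ g 2 1) ≤ unifAbs E ^ n * levelAbs n g) :
    f.val g = (((levelAbs n g ^ 2)⁻¹ : ℝ≥0) : ℂ) * f.val 1 := by
  obtain ⟨k, hk, l, hl, hrow⟩ := hU.exists_mem_level h1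
  have h2 := congrArg (fun f : Ind (stChar σ) => f.val 1) (hf k hk)
  rw [indRep_apply, one_mul] at h2
  rw [hU.apply_eq_of_row f hrow, hl, h2]

lemma Unramified.eq_smul_of_fixed_zero {f : Ind (stChar σ)}
    (hf : f ∈ fixed (indRep (stChar σ)) 0) : f = f.val 1 • hU.sph := by
  refine hU.eq_smul_sph fun k hk => hf k ?_
  have hk := hU.mem_congruence_zero.1 hk
  rw [mem_Kn]
  simp only [pow_zero, inv_one, hk, true_and, and_true]
  exact normAbs_sub_le_of_le (hk _ _) (map_one _).le

/-- At level 1 isotropy already forces |y| ≤ r · `levelAbs 1`, so G = B K₁. The bracket on the right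
is the function `levelAbs 1` to the power -2. -/
lemma Unramified.eq_smul_of_fixed_one {f : Ind (stChar σ)}
    (hf : f ∈ fixed (indRep (stChar σ)) 1) :
    f = f.val 1 • ((1 - ((unifAbs E : ℝ) : ℂ) ^ 2) • hU.ballFun 1 +
      ((unifAbs E : ℝ) : ℂ) ^ 2 • hU.sph) := by
  refine Subtype.ext (funext fun g => ?_)
  simp only [Submodule.coe_add, Pi.add_apply, Submodule.coe_smul, Pi.smul_apply, smul_eq_mul]
  by_cases h : normAbs E (entry σ g 2 0) ≤ unifAbs E ^ 1 * normAbs E (entry σ g 2 2)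
  · have h1 := ((hU.box_iff (i := 1) (j := 1) (by norm_num) g).2 h).1
    have hM := levelAbs_eq_right h
    have hR : rowAbs g = normAbs E (entry σ g 2 2) := max_eq_right (h.trans
      (mul_le_of_le_one_left zero_le (pow_le_one₀ zero_le (unifAbs_lt_one E).le)))
    rw [hU.apply_eq_of_level hf (by rwa [hM]), hU.ballFun_apply_pos h, hU.sph_apply, hM, hR]
    ring
  · have hM := levelAbs_eq_left (not_le.1 h).le
    have h3 : normAbs E (entry σ g 2 2) ≤ normAbs E (entry σ g 2 0) := by
      rw [pow_one, not_le, ← hU.normAbs_unif, ← map_mul] at h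
      have := normAbs_le_unifAbs_mul h
      rwa [map_mul, hU.normAbs_unif, mul_le_mul_iff_right₀ (unifAbs_pos E)] at this
    have hR : rowAbs g = normAbs E (entry σ g 2 0) := max_eq_left h3
    rw [hU.apply_eq_of_level hf, hU.ballFun_apply_neg h, hU.sph_apply, hM, hR]
    · push_cast
      rw [pow_one, mul_pow, mul_inv, inv_pow, inv_inv]
      ring
    · rw [hM, mul_inv_cancel_left₀ (pow_ne_zero _ (unifAbs_ne_zero E)), ← hR]
      exact hU.normAbs_entry_le_rowAbs g 1

end Level

end U3

end

noncomputable section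

namespace U3

/-! ### The vectors fixed by `K_2` -/

section LevelTwo

variable {F E : Type*} [Field F] [ValuativeRel F] [TopologicalSpace F]
  [IsNonarchimedeanLocalField F]
  [Field E] [ValuativeRel E] [TopologicalSpace E] [IsNonarchimedeanLocalField E]
  [Algebra F E] {σ : E ≃ₐ[F] E} {ϖ : F} (hU : Unramified σ ϖ)

omit [ValuativeRel F] [TopologicalSpace F] [IsNonarchimedeanLocalField F] in
lemma levelAbs_one (n : ℕ) : levelAbs n (1 : G σ) = 1 := by
  simp [levelAbs, entry_one]

/-- The elements of `G` whose bottom row is, up to a scalar, that of an element of `K_2`. -/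
def IsMain (g : G σ) : Prop := normAbs E (entry σ g 2 1) ≤ unifAbs E ^ 2 * levelAbs 2 g

omit [ValuativeRel F] [TopologicalSpace F] [IsNonarchimedeanLocalField F] in
lemma isMain_one : IsMain (1 : G σ) := by
  simp [IsMain, entry_one]

include hU

lemma Unramified.normAbs_entry_le_levelAbs (g : G σ) :
    normAbs E (entry σ g 2 0) ≤ unifAbs E ^ 2 * levelAbs 2 g ∧
    normAbs E (entry σ g 2 1) ≤ levelAbs 2 g ∧ normAbs E (entry σ g 2 2) ≤ levelAbs 2 g :=
  ⟨(inv_mul_le_iff₀ (pow_pos (unifAbs_pos E) 2)).1 (le_max_left _ _),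
    (hU.normAbs_entry_le_rowAbs g 1).trans (rowAbs_le_levelAbs 2 g), le_max_right _ _⟩

lemma Unramified.levelAbs_mul (g : G σ) {k : G σ} (hk : k ∈ hU.level 2) :
    levelAbs 2 (g * k) = levelAbs 2 g := by
  have hr := pow_pos (unifAbs_pos E) 2
  have key : ∀ (g : G σ) {k : G σ}, k ∈ hU.level 2 → levelAbs 2 (g * k) ≤ levelAbs 2 g := by
    intro g k hk
    rw [hU.mem_level, mem_Kn] at hk
    obtain ⟨a00, a01, a02, a10, a11, a12, a20, a21, a22⟩ := hk
    obtain ⟨h0, h1, h2⟩ := hU.normAbs_entry_le_levelAbs g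
    refine max_le ?_ ?_
    · rw [inv_mul_le_iff₀ hr, entry_mul, Fin.sum_univ_three]
      exact normAbs_add_le_of_le (normAbs_add_le_of_le (normAbs_mul_le h0 a00 (mul_one _).le)
        (normAbs_mul_le h1 a10 (mul_comm _ _).le)) (normAbs_mul_le h2 a20 (mul_comm _ _).le)
    · rw [entry_mul, Fin.sum_univ_three]
      exact normAbs_add_le_of_le (normAbs_add_le_of_le
        (normAbs_mul_le h0 a02 (by rw [mul_right_comm, mul_inv_cancel₀ hr.ne', one_mul]))
        (normAbs_mul_le h1 a12 (mul_one _).le)) (normAbs_mul_le h2 a22 (mul_one _).le)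
  refine le_antisymm (key g hk) ?_
  have := key (g * k) (inv_mem hk)
  rwa [mul_inv_cancel_right] at this

lemma Unramified.isMain_mul (g : G σ) {k : G σ} (hk : k ∈ hU.level 2) :
    IsMain (g * k) ↔ IsMain g := by
  have key : ∀ (g : G σ) {k : G σ}, k ∈ hU.level 2 → IsMain g → IsMain (g * k) := by
    intro g k hk hg
    rw [IsMain, hU.levelAbs_mul g hk]
    rw [hU.mem_level, mem_Kn] at hk
    obtain ⟨a00, a01, a02, a10, a11, a12, a20, a21, a22⟩ := hk
    obtain ⟨h0, h1, h2⟩ := hU.normAbs_entry_le_levelAbs g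
    have e : entry σ (g * k) 2 1 = entry σ g 2 0 * entry σ k 0 1 +
        (entry σ g 2 1 * (entry σ k 1 1 - 1) + entry σ g 2 1) + entry σ g 2 2 * entry σ k 2 1 := by
      rw [entry_mul, Fin.sum_univ_three]
      ring
    rw [e]
    exact normAbs_add_le_of_le (normAbs_add_le_of_le (normAbs_mul_le h0 a01 (mul_one _).le)
      (normAbs_add_le_of_le (normAbs_mul_le h1 a11 (mul_comm _ _).le) hg))
      (normAbs_mul_le h2 a21 (mul_comm _ _).le)
  refine ⟨fun h => ?_, key g hk⟩
  have := key (g * k) (inv_mem hk) h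
  rwa [mul_inv_cancel_right] at this

/-- If |x| > r² |z|, then r |z| ≤ |x|, and off the main orbit |x| ≤ r |y| too. Isotropy then gives r
|y|² ≤ r |x| |z| ≤ |x|² ≤ r² |y|², which is absurd. -/
lemma Unramified.not_isMain_iff (g : G σ) : ¬ IsMain g ↔
    normAbs E (entry σ g 2 0) ≤ unifAbs E ^ 2 * normAbs E (entry σ g 2 2) ∧
    ¬ normAbs E (entry σ g 2 1) ≤ unifAbs E ^ 2 * normAbs E (entry σ g 2 2) := by
  rw [IsMain]
  by_cases h : normAbs E (entry σ g 2 0) ≤ unifAbs E ^ 2 * normAbs E (entry σ g 2 2)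
  · rw [levelAbs_eq_right h, and_iff_right h]
  · simp only [h, false_and, iff_false, not_not]
    have hp := hU.unif_ne_zero
    have hr := unifAbs_pos E
    rw [levelAbs_eq_left (not_le.1 h).le, mul_inv_cancel_left₀ (pow_ne_zero _ hr.ne')]
    rw [not_le, ← hU.normAbs_unif_pow, ← map_mul] at h
    have h1 := normAbs_le_unifAbs_mul h
    rw [map_mul, hU.normAbs_unif_pow, sq, mul_assoc, mul_le_mul_iff_right₀ hr] at h1
    by_contra! h2
    have h3 := normAbs_le_unifAbs_mul h2
    have h4 := hU.normAbs_row_sq_le g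
    have hy := zero_le.trans_lt h2
    have h5 : unifAbs E * normAbs E (entry σ g 2 1) ^ 2 ≤
        (unifAbs E * normAbs E (entry σ g 2 1)) ^ 2 := by
      calc _ ≤ unifAbs E * (normAbs E (entry σ g 2 0) * normAbs E (entry σ g 2 2)) := by gcongr
        _ = normAbs E (entry σ g 2 0) * (unifAbs E * normAbs E (entry σ g 2 2)) := by ring
        _ ≤ normAbs E (entry σ g 2 0) * normAbs E (entry σ g 2 0) := by gcongr
        _ ≤ (unifAbs E * normAbs E (entry σ g 2 1)) * (unifAbs E * normAbs E (entry σ g 2 1)) := by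
          gcongr
        _ = _ := (sq _).symm
    rw [mul_pow, sq (unifAbs E), mul_assoc, mul_le_mul_iff_right₀ hr] at h5
    exact (mul_lt_of_lt_one_left (pow_pos hy 2) (unifAbs_lt_one E)).not_ge h5

/-- The function on `G` supported off the main orbit. -/
def Unramified.offFun : Ind (stChar σ) := hU.boxFun 1 2 - hU.boxFun 2 2

/-- The function on `G` supported on the main orbit. -/
def Unramified.mainFun : Ind (stChar σ) :=
  ((unifAbs E : ℝ) : ℂ) ^ 2 • indRep (stChar σ) hU.expand hU.sph - hU.offFun

/-- `expand` turns the norm `rowAbs` into r times `levelAbs 2`, so the rescaled translate of `sph`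
is the K₂-invariant density on all of G. -/
lemma Unramified.offFun_add_mainFun_apply (g : G σ) :
    (hU.offFun + hU.mainFun).val g = (((levelAbs 2 g ^ 2)⁻¹ : ℝ≥0) : ℂ) := by
  rw [mainFun, add_sub_cancel, Submodule.coe_smul, Pi.smul_apply, indRep_apply, hU.sph_apply]
  obtain ⟨h0, h1, h2⟩ := hU.normAbs_entry_mul_expand g 2
  have hr := unifAbs_ne_zero E
  have h : rowAbs (g * hU.expand) = unifAbs E * levelAbs 2 g := by
    rw [rowAbs, h0, h2, levelAbs, mul_max_of_nonneg _ _ zero_le, sq, mul_inv, mul_assoc,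
      mul_inv_cancel_left₀ hr]
  have hr' : ((unifAbs E : ℝ) : ℂ) ≠ 0 := by exact_mod_cast hr
  rw [h, smul_eq_mul]
  push_cast
  rw [mul_pow, mul_inv, mul_inv_cancel_left₀ (pow_ne_zero _ hr')]

/-- The box with indices 1, 2 is the whole ball |x| ≤ r² |z|; subtracting the box with indices 2, 2
removes the rows with |y| ≤ r² |z|. -/
lemma Unramified.offFun_apply (g : G σ) :
    (IsMain g → hU.offFun.val g = 0) ∧
    (¬ IsMain g → hU.offFun.val g = (((levelAbs 2 g ^ 2)⁻¹ : ℝ≥0) : ℂ)) := by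
  simp only [offFun, AddSubgroupClass.coe_sub, Pi.sub_apply]
  refine ⟨fun h => ?_, fun h => ?_⟩
  · have h' := mt (hU.not_isMain_iff g).2 (not_not.2 h)
    by_cases h2 : normAbs E (entry σ g 2 0) ≤ unifAbs E ^ 2 * normAbs E (entry σ g 2 2)
    · have h3 : normAbs E (entry σ g 2 1) ≤ unifAbs E ^ 2 * normAbs E (entry σ g 2 2) := by
        by_contra h4
        exact h' ⟨h2, h4⟩
      rw [hU.boxFun_apply_pos (i := 2) ⟨h3, h2⟩,
        hU.boxFun_apply_pos ((hU.box_iff (by norm_num) g).2 h2), sub_self]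
    · rw [hU.boxFun_apply_neg fun hb => h2 hb.2, hU.boxFun_apply_neg fun hb => h2 hb.2, sub_self]
  · obtain ⟨h1, h2⟩ := (hU.not_isMain_iff g).1 h
    rw [hU.boxFun_apply_neg (i := 2) fun hb => h2 hb.1,
      hU.boxFun_apply_pos ((hU.box_iff (by norm_num) g).2 h1), sub_zero, levelAbs_eq_right h1]

lemma Unramified.mainFun_apply (g : G σ) :
    (IsMain g → hU.mainFun.val g = (((levelAbs 2 g ^ 2)⁻¹ : ℝ≥0) : ℂ)) ∧
    (¬ IsMain g → hU.mainFun.val g = 0) := by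
  have h := hU.offFun_add_mainFun_apply g
  rw [Submodule.coe_add, Pi.add_apply] at h
  obtain ⟨h1, h2⟩ := hU.offFun_apply g
  refine ⟨fun hg => ?_, fun hg => ?_⟩
  · rw [← h, h1 hg, zero_add]
  · rw [h2 hg] at h
    exact add_eq_left.1 h

lemma Unramified.offFun_mem : hU.offFun ∈ fixed (indRep (stChar σ)) 2 := by
  intro k hk
  refine Subtype.ext (funext fun g => ?_)
  have h := hU.isMain_mul g hk
  rw [indRep_apply]
  by_cases hg : IsMain g
  · rw [(hU.offFun_apply g).1 hg, (hU.offFun_apply _).1 (h.2 hg)]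
  · rw [(hU.offFun_apply g).2 hg, (hU.offFun_apply _).2 (mt h.1 hg), hU.levelAbs_mul g hk]

lemma Unramified.mainFun_mem : hU.mainFun ∈ fixed (indRep (stChar σ)) 2 := by
  intro k hk
  refine Subtype.ext (funext fun g => ?_)
  have h := hU.isMain_mul g hk
  rw [indRep_apply]
  by_cases hg : IsMain g
  · rw [(hU.mainFun_apply g).1 hg, (hU.mainFun_apply _).1 (h.2 hg), hU.levelAbs_mul g hk]
  · rw [(hU.mainFun_apply g).2 hg, (hU.mainFun_apply _).2 (mt h.1 hg)]

/-! ### The double cosets of γ₁ and γ₂. -/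

section Gam

variable [CharZero F]

omit hU [ValuativeRel F] [TopologicalSpace F] [IsNonarchimedeanLocalField F] [ValuativeRel E]
  [TopologicalSpace E] [IsNonarchimedeanLocalField E] in
lemma entry_gam (i : ℤ) (a b : Fin 3) : entry σ (gam σ ϖ i) a b =
    !![1, 0, 0;
       algebraMap F E (ϖ ^ i), 1, 0;
       algebraMap F E (-(ϖ ^ i) ^ 2 / 2), -algebraMap F E (ϖ ^ i), 1] a b := rfl

/-- So γ₂ represents the double coset of 1, and a K₂-fixed function takes the same value at both. -/
lemma Unramified.gam_two_mem : gam σ ϖ 2 ∈ hU.level 2 := by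
  rw [hU.mem_level, mem_Kn]
  have h4 : (unifAbs E ^ 2) ^ 2 ≤ unifAbs E ^ 2 :=
    pow_le_of_le_one zero_le (pow_le_one₀ zero_le (unifAbs_lt_one E).le) _root_.two_ne_zero
  have h2 : ϖ ^ (2 : ℤ) = ϖ ^ 2 := zpow_ofNat ϖ 2
  have h3 : algebraMap F E 2 = 2 := map_ofNat _ 2
  simp [entry_gam, hU.normAbs_unif, hU.normAbs_two, normAbs_neg, h2, h3, h4]

lemma Unramified.levelAbs_gam_one : levelAbs 2 (gam σ ϖ 1) = 1 := by
  have h3 : algebraMap F E 2 = 2 := map_ofNat _ 2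
  simp [levelAbs, entry_gam, hU.normAbs_unif, hU.normAbs_two, normAbs_neg, unifAbs_ne_zero, h3]

lemma Unramified.not_isMain_gam_one : ¬ IsMain (gam σ ϖ 1) := by
  rw [IsMain, hU.levelAbs_gam_one, not_le]
  have hr := unifAbs_pos E
  simp only [entry_gam, zpow_one, Matrix.of_apply, Matrix.cons_val, normAbs_neg, hU.normAbs_unif,
    mul_one]
  exact pow_lt_self_of_lt_one₀ hr (unifAbs_lt_one E) one_lt_two

/-- The bottom rows off the main orbit. -/
lemma Unramified.exists_mem_level_of_not_isMain {g : G σ} (hg : ¬ IsMain g) :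
    ∃ k ∈ hU.level 2, ∃ l, normAbs E l = levelAbs 2 g ∧
      ∀ j, entry σ g 2 j = l * entry σ (gam σ ϖ 1 * k) 2 j := by
  have hz := hU.levelAbs_pos 2 g
  obtain ⟨h0, h1⟩ := (hU.not_isMain_iff g).1 hg
  have hb := ((hU.box_iff (i := 1) (j := 2) (by norm_num) g).2 h0).1
  rw [levelAbs_eq_right h0] at hz ⊢
  have hr := unifAbs_pos E
  have hp := hU.unif_ne_zero
  have h2 := hU.two_ne_zero
  have hz0 := normAbs_pos.1 hz
  have hy : normAbs E (entry σ g 2 1) = unifAbs E * normAbs E (entry σ g 2 2) := by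
    refine le_antisymm (by simpa using hb) ?_
    rw [not_le, ← hU.normAbs_unif_pow, ← map_mul] at h1
    have := normAbs_le_unifAbs_mul h1
    rwa [map_mul, hU.normAbs_unif_pow, sq, mul_assoc, mul_le_mul_iff_right₀ hr] at this
  set x := entry σ g 2 0 with hxdef
  set y := entry σ g 2 1 with hydef
  set z := entry σ g 2 2 with hzdef
  have hσz : σ z ≠ 0 := (map_ne_zero σ).2 hz0
  set p := algebraMap F E ϖ with hpdef
  have hσp : σ p = p := AlgEquiv.commutes σ ϖ
  have ha : normAbs E (-(y / (p * z))) = 1 := by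
    rw [normAbs_neg, map_div₀, map_mul, hU.normAbs_unif, hy, div_self (mul_pos hr hz).ne']
  have ha0 : -(y / (p * z)) ≠ 0 := normAbs_pos.1 (ha ▸ one_pos)
  have hy0 : y ≠ 0 := by rintro h; simp [h] at ha0
  have hσa : normAbs E (σ (-(y / (p * z)))) = 1 := by rw [hU.normAbs_conj, ha]
  set t := (x / z - σ (x / z)) / 2 with ht
  have hσt : t + σ t + 0 * σ 0 = 0 := by
    rw [ht, map_div₀ σ (_ - _), map_sub, hU.conj_conj, map_ofNat]
    field_simp
    ring
  have hx : normAbs E (x / z) ≤ unifAbs E ^ 2 := by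
    rw [map_div₀]
    exact (div_le_iff₀ hz).2 h0
  have htn : normAbs E t ≤ unifAbs E ^ 2 := by
    rw [ht, map_div₀, hU.normAbs_two, div_one]
    exact normAbs_sub_le_of_le hx (by rwa [hU.normAbs_conj])
  -- The unit -y/(ϖ z) matches the middle entry with that of γ₁. The self-conjugate part of x/z is
  -- then forced by isotropy, and the lower unipotent with corner t supplies its skew part.
  refine ⟨_, mul_mem (hU.torus_mem_level hσa) (hU.lower_mem_level hσt (by simp) htn),
    z * σ (σ (-(y / (p * z)))), ?_, ?_⟩
  · rw [map_mul, hU.normAbs_conj, hσa, mul_one]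
  · have hi := row_isotropic σ g
    rw [← hxdef, ← hydef, ← hzdef] at hi
    rw [← mul_assoc]
    obtain ⟨l0, l1, l2⟩ := entry_mul_lower hU.conj_conj (gam σ ϖ 1 *
      torus hU.conj_conj (σ (-(y / (p * z)))) (normAbs_pos.1 (hσa ▸ one_pos))) 0 t hσt 2
    obtain ⟨t0, t1, t2⟩ := entry_mul_torus hU.conj_conj (gam σ ϖ 1) _
      (normAbs_pos.1 (hσa ▸ one_pos)) 2
    rw [t0, t1, t2] at l0
    rw [t1, t2] at l1
    rw [t2] at l2
    have g0 : entry σ (gam σ ϖ 1) 2 0 = -p ^ 2 / 2 := by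
      have h3 : algebraMap F E 2 = 2 := map_ofNat _ 2
      simp [entry_gam, hpdef, h3]
    have g1 : entry σ (gam σ ϖ 1) 2 1 = -p := by
      simp [entry_gam, hpdef]
    have g2 : entry σ (gam σ ϖ 1) 2 2 = 1 := by
      simp [entry_gam]
    rw [g0, g1, g2, hU.conj_conj] at l0
    rw [g1, g2] at l1
    rw [g2] at l2
    rw [hU.conj_conj] at l2
    have hσy : σ y ≠ 0 := (map_ne_zero σ).2 hy0
    intro j
    fin_cases j
    · refine Eq.trans ?_ (congrArg _ l0.symm)
      change x = _
      rw [hU.conj_conj, ht, map_neg, map_div₀, map_mul, hσp, map_div₀]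
      field_simp
      linear_combination hi
    · refine Eq.trans ?_ (congrArg _ l1.symm)
      change y = _
      rw [hU.conj_conj, map_zero]
      field_simp
      ring
    · refine Eq.trans ?_ (congrArg _ l2.symm)
      change z = _
      rw [hU.conj_conj]
      field_simp

lemma Unramified.apply_eq_of_not_isMain {f : Ind (stChar σ)}
    (hf : f ∈ fixed (indRep (stChar σ)) 2) {g : G σ} (hg : ¬ IsMain g) :
    f.val g = (((levelAbs 2 g ^ 2)⁻¹ : ℝ≥0) : ℂ) * f.val (gam σ ϖ 1) := by
  obtain ⟨k, hk, l, hl, hrow⟩ := hU.exists_mem_level_of_not_isMain hg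
  have h2 := congrArg (fun f : Ind (stChar σ) => f.val (gam σ ϖ 1)) (hf k hk)
  rw [indRep_apply] at h2
  rw [hU.apply_eq_of_row f hrow, hl, h2]

lemma Unramified.apply_gam_two {f : Ind (stChar σ)}
    (hf : f ∈ fixed (indRep (stChar σ)) 2) : f.val (gam σ ϖ 2) = f.val 1 := by
  have h2 := congrArg (fun f : Ind (stChar σ) => f.val 1) (hf _ hU.gam_two_mem)
  rwa [indRep_apply, one_mul] at h2

lemma Unramified.eq_of_fixed_two {f : Ind (stChar σ)} (hf : f ∈ fixed (indRep (stChar σ)) 2) :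
    f = f.val (gam σ ϖ 1) • hU.offFun + f.val 1 • hU.mainFun := by
  refine Subtype.ext (funext fun g => ?_)
  simp only [Submodule.coe_add, Pi.add_apply, Submodule.coe_smul, Pi.smul_apply, smul_eq_mul]
  by_cases hg : IsMain g
  · rw [hU.apply_eq_of_level hf hg, (hU.offFun_apply g).1 hg, (hU.mainFun_apply g).1 hg]
    ring
  · rw [hU.apply_eq_of_not_isMain hf hg, (hU.offFun_apply g).2 hg, (hU.mainFun_apply g).2 hg]
    ring

omit [CharZero F] in
lemma Unramified.fun_apply_one : hU.offFun.val 1 = 0 ∧ hU.mainFun.val 1 = 1 :=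
  ⟨(hU.offFun_apply 1).1 isMain_one, by
    rw [(hU.mainFun_apply 1).1 isMain_one, levelAbs_one]
    simp⟩

lemma Unramified.fun_apply_gam_one :
    hU.offFun.val (gam σ ϖ 1) = 1 ∧ hU.mainFun.val (gam σ ϖ 1) = 0 :=
  ⟨by
    rw [(hU.offFun_apply _).2 hU.not_isMain_gam_one, hU.levelAbs_gam_one]
    simp, (hU.mainFun_apply _).2 hU.not_isMain_gam_one⟩

omit hU [ValuativeRel F] [TopologicalSpace F] [IsNonarchimedeanLocalField F] [CharZero F] in
/-- A fixed function does not vanish on the double coset of a point where it does not vanish. -/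
lemma apply_ne_zero_of_mem {n : ℕ} {f : Ind (stChar σ)} (hf : f ∈ fixed (indRep (stChar σ)) n)
    {x : G σ} (hx : f.val x ≠ 0) {g : G σ} (hg : g ∈ (B σ : Set (G σ)) * {x} * Kn σ n) :
    f.val g ≠ 0 := by
  obtain ⟨_, ⟨b, hb, y, rfl, rfl⟩, k, hk, rfl⟩ := hg
  dsimp only
  have h2 := congrArg (fun f : Ind (stChar σ) => f.val (b * y)) (hf _ hk)
  rw [indRep_apply] at h2
  rw [h2, f.2.2 ⟨b, hb⟩ _, sqrt_modulusB_mul_stChar]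
  refine mul_ne_zero ?_ hx
  have h3 : entry σ b 0 0 ≠ 0 := fun h0 => by
    have := entry_diag_conj σ hb
    rw [h0, map_zero, zero_mul] at this
    exact zero_ne_one this
  have := pow_ne_zero 2 (normAbs_pos.2 h3).ne'
  exact_mod_cast this

omit hU [ValuativeRel F] [TopologicalSpace F] [IsNonarchimedeanLocalField F] [CharZero F] in
lemma mem_doubleCoset {n : ℕ} {g x k : G σ} (hk : k ∈ Kn σ n) {l : E}
    (h : ∀ j, entry σ g 2 j = l * entry σ (x * k) 2 j) :
    g ∈ (B σ : Set (G σ)) * {x} * Kn σ n :=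
  ⟨g * (x * k)⁻¹ * x, ⟨_, (mul_inv_mem_B σ h).1, x, rfl, rfl⟩, k, hk, by group⟩

lemma Unramified.mem_doubleCoset_of_isMain {g : G σ} (hg : IsMain g) :
    g ∈ (B σ : Set (G σ)) * {gam σ ϖ 2} * Kn σ 2 := by
  obtain ⟨k, hk, l, -, hrow⟩ := hU.exists_mem_level hg
  refine mem_doubleCoset (k := (gam σ ϖ 2)⁻¹ * k) (mul_mem (inv_mem hU.gam_two_mem) hk) (l := l) ?_
  rwa [mul_inv_cancel_left]

lemma Unramified.mem_doubleCoset_of_not_isMain {g : G σ} (hg : ¬ IsMain g) :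
    g ∈ (B σ : Set (G σ)) * {gam σ ϖ 1} * Kn σ 2 := by
  obtain ⟨k, hk, l, -, hrow⟩ := hU.exists_mem_level_of_not_isMain hg
  exact mem_doubleCoset hk hrow

lemma Unramified.isF_one_iff (f : Ind (stChar σ)) :
    IsF (stChar σ) ϖ 2 1 f ↔ f = hU.offFun := by
  have hoff := hU.fun_apply_gam_one.1
  constructor
  · rintro ⟨hf, h1, hs⟩
    -- `offFun` vanishes at 1 but nowhere on B γ₁ K₂, so 1 is not in that double coset.
    have h0 : f.val 1 = 0 := by
      by_contra h
      replace h := Function.mem_support.2 h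
      rw [hs] at h
      exact apply_ne_zero_of_mem hU.offFun_mem (hoff ▸ one_ne_zero) h hU.fun_apply_one.1
    rw [hU.eq_of_fixed_two hf, h1, h0, one_smul, zero_smul, add_zero]
  · rintro rfl
    refine ⟨hU.offFun_mem, hoff, Set.ext fun g => ⟨fun hg => ?_, fun hg => ?_⟩⟩
    · exact hU.mem_doubleCoset_of_not_isMain fun h => hg ((hU.offFun_apply g).1 h)
    · exact apply_ne_zero_of_mem hU.offFun_mem (hoff ▸ one_ne_zero) hg

lemma Unramified.isF_two_iff (f : Ind (stChar σ)) :
    IsF (stChar σ) ϖ 2 2 f ↔ f = hU.mainFun := by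
  have hmain : hU.mainFun.val (gam σ ϖ 2) = 1 :=
    (hU.apply_gam_two hU.mainFun_mem).trans hU.fun_apply_one.2
  constructor
  · rintro ⟨hf, h1, hs⟩
    have h0 : f.val (gam σ ϖ 1) = 0 := by
      by_contra h
      replace h := Function.mem_support.2 h
      rw [hs] at h
      exact apply_ne_zero_of_mem hU.mainFun_mem (hmain ▸ one_ne_zero) h hU.fun_apply_gam_one.2
    rw [hU.apply_gam_two hf] at h1
    rw [hU.eq_of_fixed_two hf, h1, h0, one_smul, zero_smul, zero_add]
  · rintro rfl
    refine ⟨hU.mainFun_mem, hmain, Set.ext fun g => ⟨fun hg => ?_, fun hg => ?_⟩⟩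
    · exact hU.mem_doubleCoset_of_isMain (not_not.1 fun h => hg ((hU.mainFun_apply g).2 h))
    · exact apply_ne_zero_of_mem hU.mainFun_mem (hmain ▸ one_ne_zero) hg

lemma Unramified.fixed_two_eq_span :
    fixed (indRep (stChar σ)) 2 = Submodule.span ℂ {hU.offFun, hU.mainFun} := by
  refine le_antisymm (fun f hf => ?_) (Submodule.span_le.2 ?_)
  · rw [hU.eq_of_fixed_two hf, Submodule.mem_span_pair]
    exact ⟨_, _, rfl⟩
  · rintro f (rfl | rfl)
    · exact hU.offFun_mem
    · exact hU.mainFun_mem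

lemma Unramified.finrank_fixed_two : Module.finrank ℂ (fixed (indRep (stChar σ)) 2) = 2 := by
  have h : LinearIndependent ℂ ![hU.offFun, hU.mainFun] := by
    rw [LinearIndependent.pair_iff]
    intro a b hab
    have h1 := congrArg (fun f : Ind (stChar σ) => f.val 1) hab
    have h2 := congrArg (fun f : Ind (stChar σ) => f.val (gam σ ϖ 1)) hab
    simp [hU.fun_apply_one, hU.fun_apply_gam_one] at h1 h2
    exact ⟨h2, h1⟩
  have h2 := finrank_span_eq_card h
  rw [Matrix.range_cons, Matrix.range_cons, Matrix.range_empty, Set.union_empty,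
    Set.singleton_union, ← hU.fixed_two_eq_span, Fintype.card_fin] at h2
  exact h2

end Gam

end LevelTwo

end U3

end

noncomputable section

namespace U3

/-! ### The Steinberg representation -/

section Steinberg

variable {F E : Type*} [Field F] [ValuativeRel F] [TopologicalSpace F]
  [IsNonarchimedeanLocalField F] [CharZero F]
  [Field E] [ValuativeRel E] [TopologicalSpace E] [IsNonarchimedeanLocalField E]
  [Algebra F E] {σ : E ≃ₐ[F] E} {ϖ : F} (hU : Unramified σ ϖ)
  {I : Ind (stChar σ) →ₗ[ℂ] ℂ}
  (hI : ∀ k ∈ congruence σ 0, ∀ f, I (indRep (stChar σ) k f) = I f) (hI1 : I hU.sph = 1)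
  (V₁ : Subrepresentation (indRep (stChar σ)))

omit [ValuativeRel F] [TopologicalSpace F] [IsNonarchimedeanLocalField F] [CharZero F] in
lemma mem_fixed_toRepresentation {n : ℕ} {v : V₁.toSubmodule} :
    v ∈ fixed V₁.toRepresentation n ↔ (v : Ind (stChar σ)) ∈ fixed (indRep (stChar σ)) n :=
  forall₂_congr fun _ _ => Subtype.ext_iff

/-- The standard newform. -/
def Unramified.newform : Ind (stChar σ) :=
  ((resCard F : ℂ) * (resCard F - 1)) • hU.mainFun - hU.offFun

include hU

omit [CharZero F] in
lemma Unramified.newform_mem_fixed : hU.newform ∈ fixed (indRep (stChar σ)) 2 :=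
  sub_mem (Submodule.smul_mem _ _ hU.mainFun_mem) hU.offFun_mem

lemma Unramified.newform_ne_zero : hU.newform ≠ 0 := by
  intro h
  have h1 := congrArg (fun f : Ind (stChar σ) => f.val (gam σ ϖ 1)) h
  simp [newform, hU.fun_apply_gam_one] at h1

include hI hI1

/-- The total density has mass r² = q⁻⁴. The off-orbit has mass (1 - q⁻²) / (q (q³ + 1)), from the
two boxes. The remainder is the mass of the main orbit, and the ratio of the two is q(q - 1). -/
lemma Unramified.functional_fixed_two {f : Ind (stChar σ)}
    (hf : f ∈ fixed (indRep (stChar σ)) 2) :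
    I f = 0 ↔ f.val 1 = -(resCard F : ℂ) * (resCard F - 1) * f.val (gam σ ϖ 1) := by
  have hq := natCast_resCard_ne_zero F
  have hq3 := natCast_resCard_pow_add_one_ne_zero F 3
  have hq1 : (resCard F : ℂ) + 1 ≠ 0 := by
    simpa using natCast_resCard_pow_add_one_ne_zero F 1
  have hE : (resCard E : ℂ) = (resCard F : ℂ) ^ 2 := by exact_mod_cast hU.resCard_eq
  have h2 : I (hU.boxFun 1 2) = ((resCard F : ℂ) * ((resCard F : ℂ) ^ 3 + 1))⁻¹ :=
    hU.functional_ballFun_two_eq hI hI1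
  have h22 : I (hU.boxFun 2 2) =
      ((resCard F : ℂ) ^ 2)⁻¹ * ((resCard F : ℂ) * ((resCard F : ℂ) ^ 3 + 1))⁻¹ := by
    rw [← h2, hU.functional_boxFun_succ_left hI (i := 1) (j := 2) (by norm_num), hE,
      inv_mul_cancel_left₀ (pow_ne_zero 2 hq)]
  have hoff : I hU.offFun = ((resCard F : ℂ) + 1) * ((resCard F : ℂ) ^ 4 *
      ((resCard F : ℂ) ^ 3 + 1))⁻¹ * (resCard F * (resCard F - 1)) := by
    rw [offFun, map_sub, h2, h22]
    field_simp
    ring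
  have hmain : I hU.mainFun = ((resCard F : ℂ) + 1) * ((resCard F : ℂ) ^ 4 *
      ((resCard F : ℂ) ^ 3 + 1))⁻¹ := by
    rw [mainFun, map_sub, map_smul, hU.functional_invariant hI, hI1, hoff, hU.unifAbs_eq_inv,
      smul_eq_mul]
    field_simp
    ring
  have hne : ((resCard F : ℂ) + 1) * ((resCard F : ℂ) ^ 4 * ((resCard F : ℂ) ^ 3 + 1))⁻¹ ≠ 0 :=
    mul_ne_zero hq1 (inv_ne_zero (mul_ne_zero (pow_ne_zero _ hq) hq3))
  have key : I f = ((resCard F : ℂ) + 1) * ((resCard F : ℂ) ^ 4 * ((resCard F : ℂ) ^ 3 + 1))⁻¹ *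
      (f.val 1 + resCard F * (resCard F - 1) * f.val (gam σ ϖ 1)) := by
    conv_lhs => rw [hU.eq_of_fixed_two hf]
    rw [map_add, map_smul, map_smul, hoff, hmain, smul_eq_mul, smul_eq_mul]
    ring
  rw [key, mul_eq_zero, or_iff_right hne, add_eq_zero_iff_eq_neg]
  simp only [neg_mul]

lemma Unramified.functional_newform : I hU.newform = 0 := by
  rw [hU.functional_fixed_two hI hI1 hU.newform_mem_fixed]
  simp [newform, hU.fun_apply_gam_one, hU.fun_apply_one]

omit [CharZero F] in
-- The fixed vectors of level 0 or 1 are multiples of a single vector on which I does not vanish.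
lemma Unramified.eq_zero_of_fixed {n : ℕ} (hn : n < 2) {f : Ind (stChar σ)}
    (hf : f ∈ fixed (indRep (stChar σ)) n) (h0 : I f = 0) : f = 0 := by
  have hq := natCast_resCard_ne_zero F
  have hq3 := natCast_resCard_pow_add_one_ne_zero F 3
  have hq1 : (resCard F : ℂ) + 1 ≠ 0 := by
    simpa using natCast_resCard_pow_add_one_ne_zero F 1
  have key : ∀ h : Ind (stChar σ), f = f.val 1 • h → I h ≠ 0 → f = 0 := by
    intro h hfh hIh
    have h1 : f.val 1 * I h = 0 := by rw [← h0, ← smul_eq_mul, ← map_smul, ← hfh]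
    rw [hfh, (mul_eq_zero.1 h1).resolve_right hIh, zero_smul]
  have : n = 0 ∨ n = 1 := by lia
  rcases this with rfl | rfl
  · exact key _ (hU.eq_smul_of_fixed_zero hf) (by rw [hI1]; exact one_ne_zero)
  · refine key _ (hU.eq_smul_of_fixed_one hf) ?_
    have h1 : I ((1 - ((unifAbs E : ℝ) : ℂ) ^ 2) • hU.ballFun 1 +
        ((unifAbs E : ℝ) : ℂ) ^ 2 • hU.sph) =
        ((resCard F : ℂ) + 1) * ((resCard F : ℂ) * ((resCard F : ℂ) ^ 3 + 1))⁻¹ := by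
      rw [map_add, map_smul, map_smul, hI1, hU.functional_ballFun_one_eq hI hI1, smul_eq_mul,
        smul_eq_mul, hU.unifAbs_eq_inv]
      field_simp
      ring
    rw [h1]
    exact mul_ne_zero hq1 (inv_ne_zero (mul_ne_zero hq hq3))

/-- The unique irreducible subrepresentation is the kernel of the invariant functional. -/
lemma Unramified.isSteinberg_iff : IsSteinberg V₁ ↔ V₁.toSubmodule = LinearMap.ker I := by
  have hmem : hU.newform ∈ LinearMap.ker I := hU.functional_newform hI hI1
  constructor
  · intro h
    have h : IsSimpleOrder (Subrepresentation V₁.toRepresentation) := h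
    have hV : V₁.toSubmodule ≠ ⊥ := by
      intro hbot
      refine bot_ne_top (α := Subrepresentation V₁.toRepresentation)
        (Subrepresentation.toSubmodule_injective ?_)
      refine le_antisymm bot_le fun v _ => ?_
      have : (v : Ind (stChar σ)) ∈ V₁.toSubmodule := v.2
      exact (Submodule.mem_bot ℂ).2 (Subtype.ext ((Submodule.mem_bot ℂ).1 (hbot ▸ this)))
    have hle := hU.ker_le hI hI1 V₁ hV
    -- The intersection of V₁ with ker I. It contains the newform, so by irreducibility it is all of
    -- V₁, giving the inclusion that `ker_le` does not.
    let W : Subrepresentation V₁.toRepresentation :=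
      ⟨(LinearMap.ker I).comap V₁.toSubmodule.subtype, fun g v hv => by
        have hv : I (v : Ind (stChar σ)) = 0 := hv
        change I (indRep (stChar σ) g v) = 0
        rw [hU.functional_invariant hI, hv]⟩
    rcases eq_bot_or_eq_top W with hW | hW
    · have h1 : (⟨hU.newform, hle hmem⟩ : V₁.toSubmodule) ∈ W.toSubmodule := hmem
      rw [hW] at h1
      exact absurd (congrArg Subtype.val ((Submodule.mem_bot ℂ).1 h1)) hU.newform_ne_zero
    · refine le_antisymm (fun v hv => ?_) hle
      have h1 : (⟨v, hv⟩ : V₁.toSubmodule) ∈ W.toSubmodule := hW ▸ Submodule.mem_top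
      exact h1
  · intro h
    have hn : hU.newform ∈ V₁.toSubmodule := h ▸ hmem
    refine IsSimpleOrder.mk (toNontrivial := ⟨⊥, ⊤, fun hbt => ?_⟩) fun W => ?_
    · have h1 : (⟨_, hn⟩ : V₁.toSubmodule) ∈ (⊤ : Subrepresentation V₁.toRepresentation) :=
        Submodule.mem_top
      rw [← hbt] at h1
      exact hU.newform_ne_zero (congrArg Subtype.val ((Submodule.mem_bot ℂ).1 h1))
    -- A subrepresentation of ker I is regarded inside V, where `ker_le` shows that it is zero or
    -- everything.
    · let W' : Subrepresentation (indRep (stChar σ)) :=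
        ⟨W.toSubmodule.map V₁.toSubmodule.subtype, by
          rintro g _ ⟨v, hv, rfl⟩
          exact ⟨_, W.apply_mem_toSubmodule g hv, rfl⟩⟩
      by_cases hW : W'.toSubmodule = ⊥
      · refine Or.inl (Subrepresentation.toSubmodule_injective ?_)
        exact (Submodule.map_injective_of_injective V₁.toSubmodule.injective_subtype)
          (hW.trans (Submodule.map_bot _).symm)
      · refine Or.inr (Subrepresentation.toSubmodule_injective
          (le_antisymm le_top fun v _ => ?_))
        have h1 : (v : Ind (stChar σ)) ∈ LinearMap.ker I := h ▸ v.2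
        obtain ⟨w, hw, hwv⟩ := hU.ker_le hI hI1 W' hW h1
        rwa [← Subtype.ext hwv]

lemma Unramified.isConductor (h : V₁.toSubmodule = LinearMap.ker I) :
    IsConductor V₁.toRepresentation 2 := by
  have hn : hU.newform ∈ V₁.toSubmodule := h ▸ hU.functional_newform hI hI1
  refine ⟨fun hbot => ?_, fun n hn' => ?_⟩
  · have h1 : (⟨_, hn⟩ : V₁.toSubmodule) ∈ fixed V₁.toRepresentation 2 :=
      (mem_fixed_toRepresentation V₁).2 hU.newform_mem_fixed
    rw [hbot, Submodule.mem_bot] at h1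
    exact hU.newform_ne_zero (congrArg Subtype.val h1)
  · by_contra hlt
    obtain ⟨v, hv, hv0⟩ := Submodule.exists_mem_ne_zero_of_ne_bot hn'
    have h1 : (v : Ind (stChar σ)) ∈ LinearMap.ker I := h ▸ v.2
    exact hv0 (Subtype.ext (hU.eq_zero_of_fixed hI hI1 (not_le.1 hlt)
      ((mem_fixed_toRepresentation V₁).1 hv) h1))

end Steinberg

end U3

end

/-! ### The theorem. -/

theorem proposition4p2
    {F E : Type*} [Field F] [ValuativeRel F] [TopologicalSpace F] [IsNonarchimedeanLocalField F]
    [CharZero F]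
    (hodd : ringChar 𝓀[F] ≠ 2)
    [Field E] [ValuativeRel E] [TopologicalSpace E] [IsNonarchimedeanLocalField E]
    [Algebra F E] [ValuativeExtension F E]
    (ε : 𝒪[F]ˣ) (hε : ¬ IsSquare ε)
    (s : E) (hs : s ^ 2 = algebraMap F E (ε : 𝒪[F])) (hE : F⟮s⟯ = ⊤)
    (σ : E ≃ₐ[F] E) (hσ : σ ≠ 1)
    (ϖ : 𝒪[F]) (hϖ : Irreducible ϖ)
    (q : ℂ) (hq : q = (U3.resCard F : ℂ)) :
    -- the Steinberg representation embeds into `V` in exactly one way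
    (∃! V₁ : Subrepresentation (U3.indRep (U3.stChar σ)), U3.IsSteinberg V₁) ∧
    -- `V(2)` is two-dimensional, spanned by the well-defined functions `f_{2,1}` and `f_{2,2}`
    Module.finrank ℂ (U3.fixed (U3.indRep (U3.stChar σ)) 2) = 2 ∧
    (∃! f₂₁, U3.IsF (U3.stChar σ) (ϖ : F) 2 1 f₂₁) ∧
    (∃! f₂₂, U3.IsF (U3.stChar σ) (ϖ : F) 2 2 f₂₂) ∧
    (∀ f₂₁ f₂₂, U3.IsF (U3.stChar σ) (ϖ : F) 2 1 f₂₁ → U3.IsF (U3.stChar σ) (ϖ : F) 2 2 f₂₂ →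
      U3.fixed (U3.indRep (U3.stChar σ)) 2 = Submodule.span ℂ {f₂₁, f₂₂}) ∧
    ∀ V₁ : Subrepresentation (U3.indRep (U3.stChar σ)), U3.IsSteinberg V₁ →
      -- the newforms for `V₁` are the elements of `V₁(2)`
      U3.IsConductor V₁.toRepresentation 2 ∧
      (∀ f ∈ U3.fixed (U3.indRep (U3.stChar σ)) 2,
        (f ∈ (U3.fixed V₁.toRepresentation 2).map V₁.toSubmodule.subtype ↔
          f.val 1 = -q * (q - 1) * f.val (U3.gam σ (ϖ : F) 1))) ∧
      (∀ f₂₁ f₂₂, U3.IsF (U3.stChar σ) (ϖ : F) 2 1 f₂₁ → U3.IsF (U3.stChar σ) (ϖ : F) 2 2 f₂₂ →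
        ∃ v : V₁.toSubmodule, U3.IsNewform V₁.toRepresentation v ∧
          (v : U3.Ind (U3.stChar σ)) = (q * (q - 1)) • f₂₂ - f₂₁) := by
  subst hq
  have hU := U3.unramified hodd hε hs hE hσ hϖ
  obtain ⟨I, hI, hI1⟩ := hU.exists_functional
  have hSt := hU.isSteinberg_iff hI hI1
  refine ⟨⟨⟨LinearMap.ker I, fun g v hv => ?_⟩, (hSt _).2 rfl, fun V₁ h =>
    Subrepresentation.toSubmodule_injective ((hSt V₁).1 h)⟩, hU.finrank_fixed_two,
    ⟨_, (hU.isF_one_iff _).2 rfl, fun f h => (hU.isF_one_iff f).1 h⟩,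
    ⟨_, (hU.isF_two_iff _).2 rfl, fun f h => (hU.isF_two_iff f).1 h⟩, ?_, fun V₁ hV₁ => ?_⟩
  · rw [LinearMap.mem_ker] at hv ⊢
    rw [hU.functional_invariant hI, hv]
  · intro f₂₁ f₂₂ h₁ h₂
    rw [(hU.isF_one_iff _).1 h₁, (hU.isF_two_iff _).1 h₂]
    exact hU.fixed_two_eq_span
  · have hker := (hSt V₁).1 hV₁
    have hcond := hU.isConductor hI hI1 V₁ hker
    refine ⟨hcond, fun f hf => ?_, fun f₂₁ f₂₂ h₁ h₂ => ?_⟩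
    · rw [← hU.functional_fixed_two hI hI1 hf, ← LinearMap.mem_ker, ← hker]
      constructor
      · rintro ⟨v, -, rfl⟩
        exact v.2
      · exact fun h => ⟨⟨f, h⟩, (U3.mem_fixed_toRepresentation V₁).2 hf, rfl⟩
    · rw [(hU.isF_one_iff _).1 h₁, (hU.isF_two_iff _).1 h₂]
      have hn : hU.newform ∈ V₁.toSubmodule := hker ▸ hU.functional_newform hI hI1
      exact ⟨⟨_, hn⟩, ⟨2, hcond, (U3.mem_fixed_toRepresentation V₁).2 hU.newform_mem_fixed,
        fun h => hU.newform_ne_zero (congrArg Subtype.val h)⟩, rfl⟩
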